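/- Work over $\mathbb Q$. For $g\ge 0$ let $H=H_g$ be the fundamental module of $\mathfrak{sp}_g=\mathfrak{sp}(2g,\mathbb Q)$, with symplectic basis $x_1,\dots,x_g,y_1,\dots,y_g$, and let $U=\Lambda^3H/(H\wedge\sum_i x_i\wedge y_i)$. The exterior algebras $\Lambda\Lambda^3H$ and $\Lambda U$ carry the induced actions of $\mathfrak{sp}_g$ by derivations; $(-)^{\mathfrak{sp}}$ denotes invariants. Let $\mathcal C(\phi)$ be the commutative graded algebra with basis the isomorphism classes of finite trivalent graphs (possibly empty or disconnected, with multiple edges and 1-loops allowed), with disjoint union as product; the degree of a graph is half its number of vertices. Let $loop\subset\mathcal C(\phi)$ be the ideal generated by the graphs containing a 1-loop. A total ordering $\tau$ of a trivalent graph $\Gamma$ of degree $m$ consists of an ordering $v_1,\dots,v_{2m}$ of the vertices, an ordering $f_1(v),f_2(v),f_3(v)$ of the three flags (half-edges) at each vertex $v$, and an ordering $f_+(e),f_-(e)$ of the two flags of each edge $e$. It is $\wedge$-admissible if, for every ordering $e_1,\dots,e_{3m}$ of the edges, the lists of flags $f_1(v_1),f_2(v_1),f_3(v_1),f_1(v_2),\dots,f_3(v_{2m})$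 and $f_+(e_1),f_-(e_1),\dots,f_+(e_{3m}),f_-(e_{3m})$ differ by an even permutation. Let $$\alpha_{(\Gamma,\tau)}=\sum_{\ell}\Big(\prod_e \operatorname{sgn}\ell(f_+(e))\Big)\bigwedge_{k=1}^{2m}\big(\ell(f_1(v_k))\wedge \ell(f_2(v_k))\wedge \ell(f_3(v_k))\big)\in\Lambda^{2m}\Lambda^3H,$$ where $\ell$ runs over all labelings of the flags by basis vectors such that for every edge $e$ one has $\{\ell(f_+(e)),\ell(f_-(e))\}=\{x_i,y_i\}$ for some $i$, and $\operatorname{sgn}x_i=1$, $\operatorname{sgn}y_i=-1$. For $t=t_1\otimes t_2\otimes t_3\otimes t_4\in H^{\otimes 4}$ put $$E(p,q;r,s)=\sum_{i=1}^g (p\wedge q\wedge x_i)\wedge(r\wedge s\wedge y_i)-(p\wedge q\wedge y_i)\wedge(r\wedge s\wedge x_i),$$ $$f_I(t)=E(t_1,t_2;t_3,t_4),\quad f_H(t)=E(t_1,t_3;t_4,t_2),\quad f_X(t)=E(t_1,t_4;t_2,t_3).$$ For scalars $a,b,c\in\mathbb Q$ let $f_{a,b,c}=af_I+bf_H+cf_X:H^{\otimes4}\to\Lambda^2\Lambda^3H$,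 and let $\bar f_{a,b,c}$ be its composite with $\Lambda^2\Lambda^3H\to\Lambda^2U$; $(\operatorname{Im} f)$ denotes the two-sided ideal generated by the image of $f$. An embedding $I\hookrightarrow\Gamma$ is an edge of $\Gamma$ joining two distinct vertices $v,w$, together with a labeling of the other two flags at $v$ by $1,2$ and of the other two flags at $w$ by $3,4$ (these four flags need not lie on distinct edges). Put $\Gamma_I=\Gamma$, and let $\Gamma_H$ (resp. $\Gamma_X$) be obtained by reattaching the flags $1,3$ to $v$ and $4,2$ to $w$ (resp. $1,4$ to $v$ and $2,3$ to $w$). Let $I_{a,b,c}\subset\mathcal C(\phi)$ be the ideal generated by all $a\Gamma_I+b\Gamma_H+c\Gamma_X$. A stable isomorphism of graded algebras multiplying degrees by $2$ means, for each $g$, an algebra homomorphism that maps degree $m$ to degree $2m$ for all $m$ and is bijective from degree $m$ onto degree $2m$ for all $m$ with $g\ge 3m$, where moreover the target vanishes in odd degrees. **Proposition.** For every $g$ there is an algebra homomorphism $\Phi_g:\mathcal C(\phi)\to(\Lambda\Lambda^3H)^{\mathfrak{sp}}$ with $\Phi_g(\Gamma)=\alpha_{(\Gamma,\tau)}$ for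 every trivalent graph $\Gamma$ and every $\wedge$-admissible total ordering $\tau$ of $\Gamma$. It is a stable isomorphism of graded algebras multiplying degrees by $2$, and it induces a stable isomorphism $\mathcal C(\phi)/loop\to(\Lambda U)^{\mathfrak{sp}}$ of the same kind. Moreover, for all scalars $a,b,c$, the map $\Phi_g$ induces stable isomorphisms of graded algebras, multiplying degrees by $2$, $$\mathcal C(\phi)/I_{a,b,c}\;\cong\;\big(\Lambda\Lambda^3H/(\operatorname{Im}f_{a,b,c})\big)^{\mathfrak{sp}},\qquad \mathcal C(\phi)/(I_{a,b,c}\cup loop)\;\cong\;\big(\Lambda U/(\operatorname{Im}\bar f_{a,b,c})\big)^{\mathfrak{sp}}.$$ -/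

import Mathlib

noncomputable section

namespace TrivalentSymplectic

/-! ## Lie algebras acting on exterior algebras by derivations -/

section ExteriorAction

variable {R : Type*} [CommRing R] {M : Type*} [AddCommGroup M] [Module R M]

/-- The algebra homomorphism `a ↦ a + ε D(a)` with values in the dual numbers over `Λ M`. -/
def exteriorDerivationAux (D : Module.End R M) :
    ExteriorAlgebra R M →ₐ[R] TrivSqZeroExt (ExteriorAlgebra R M) (ExteriorAlgebra R M) :=
  ExteriorAlgebra.lift R
    ⟨{ toFun := fun v => (ExteriorAlgebra.ι R v, ExteriorAlgebra.ι R (D v))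
       map_add' := fun v w => by
         refine TrivSqZeroExt.ext ?_ ?_
         · exact map_add (ExteriorAlgebra.ι R) v w
         · change ExteriorAlgebra.ι R (D (v + w)) =
             ExteriorAlgebra.ι R (D v) + ExteriorAlgebra.ι R (D w)
           simp
       map_smul' := fun r v => by
         refine TrivSqZeroExt.ext ?_ ?_
         · exact map_smul (ExteriorAlgebra.ι R) r v
         · change ExteriorAlgebra.ι R (D (r • v)) = r • ExteriorAlgebra.ι R (D v)
           simp },
     fun v => by
       refine TrivSqZeroExt.ext ?_ ?_
       · exact ExteriorAlgebra.ι_sq_zero v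
       · change ExteriorAlgebra.ι R v * ExteriorAlgebra.ι R (D v) +
           ExteriorAlgebra.ι R (D v) * ExteriorAlgebra.ι R v = 0
         exact ExteriorAlgebra.ι_add_mul_swap v (D v)⟩

theorem exteriorDerivationAux_fst (D : Module.End R M) (a : ExteriorAlgebra R M) :
    (exteriorDerivationAux D a).fst = a := by
  have h : (TrivSqZeroExt.fstHom R (ExteriorAlgebra R M) (ExteriorAlgebra R M)).comp
      (exteriorDerivationAux D) = AlgHom.id R _ := by
    refine ExteriorAlgebra.hom_ext ?_
    ext v
    simp only [LinearMap.comp_apply, AlgHom.toLinearMap_apply, AlgHom.comp_apply]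
    rw [exteriorDerivationAux, ExteriorAlgebra.lift_ι_apply]
    rfl
  exact DFunLike.congr_fun h a

/-- The unique derivation of the exterior algebra `Λ M` that extends the endomorphism `D`
of `M`. -/
def exteriorDerivation (D : Module.End R M) : Module.End R (ExteriorAlgebra R M) where
  toFun a := (exteriorDerivationAux D a).snd
  map_add' a b := by simp
  map_smul' r a := by simp

theorem exteriorDerivation_ι (D : Module.End R M) (v : M) :
    exteriorDerivation D (ExteriorAlgebra.ι R v) = ExteriorAlgebra.ι R (D v) := by
  change (exteriorDerivationAux D (ExteriorAlgebra.ι R v)).snd = _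
  rw [exteriorDerivationAux, ExteriorAlgebra.lift_ι_apply]
  rfl

theorem exteriorDerivation_mul (D : Module.End R M) (a b : ExteriorAlgebra R M) :
    exteriorDerivation D (a * b) = exteriorDerivation D a * b + a * exteriorDerivation D b := by
  change (exteriorDerivationAux D (a * b)).snd = (exteriorDerivationAux D a).snd * b +
    a * (exteriorDerivationAux D b).snd
  rw [map_mul, TrivSqZeroExt.snd_mul, exteriorDerivationAux_fst, exteriorDerivationAux_fst,
    smul_eq_mul, MulOpposite.smul_eq_mul_unop, MulOpposite.unop_op, add_comm]

theorem exteriorDerivation_algebraMap (D : Module.End R M) (r : R) :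
    exteriorDerivation D (algebraMap R _ r) = 0 := by
  change (exteriorDerivationAux D (algebraMap R _ r)).snd = 0
  rw [AlgHom.commutes]
  rfl

/-- Two maps `Λ M → Λ M` that are linear, kill scalars, satisfy the Leibniz rule and agree on `M`
are equal. -/
theorem derivation_ext {D E : Module.End R (ExteriorAlgebra R M)}
    (hD : ∀ a b, D (a * b) = D a * b + a * D b) (hE : ∀ a b, E (a * b) = E a * b + a * E b)
    (hD0 : ∀ r, D (algebraMap R _ r) = 0) (hE0 : ∀ r, E (algebraMap R _ r) = 0)
    (h : ∀ v, D (ExteriorAlgebra.ι R v) = E (ExteriorAlgebra.ι R v)) : D = E := by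
  refine LinearMap.ext fun a => ?_
  induction a using ExteriorAlgebra.induction with
  | algebraMap r => rw [hD0, hE0]
  | ι v => exact h v
  | mul a b ha hb => rw [hD, hE, ha, hb]
  | add a b ha hb => rw [map_add, map_add, ha, hb]

variable {L : Type*} [LieRing L] [LieAlgebra R L] [LieRingModule L M] [LieModule R L M]

instance : LieRingModule L (ExteriorAlgebra R M) where
  bracket x a := exteriorDerivation (LieModule.toEnd R L M x) a
  add_lie x y a := by
    have : exteriorDerivation (LieModule.toEnd R L M (x + y)) =
        exteriorDerivation (LieModule.toEnd R L M x) +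
          exteriorDerivation (LieModule.toEnd R L M y) := by
      refine derivation_ext (exteriorDerivation_mul _) (fun a b => ?_)
        (exteriorDerivation_algebraMap _) (fun r => ?_) (fun v => ?_)
      · simp only [LinearMap.add_apply, exteriorDerivation_mul]; noncomm_ring
      · simp [exteriorDerivation_algebraMap]
      · simp [exteriorDerivation_ι]
    exact DFunLike.congr_fun this a
  lie_add x a b := map_add _ a b
  leibniz_lie x y a := by
    have : exteriorDerivation (LieModule.toEnd R L M x) *
          exteriorDerivation (LieModule.toEnd R L M y) =
        exteriorDerivation (LieModule.toEnd R L M ⁅x, y⁆) +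
        exteriorDerivation (LieModule.toEnd R L M y) *
          exteriorDerivation (LieModule.toEnd R L M x) := by
      rw [← sub_eq_iff_eq_add]
      refine derivation_ext (fun a b => ?_) (exteriorDerivation_mul _) (fun r => ?_)
        (exteriorDerivation_algebraMap _) (fun v => ?_)
      · simp only [LinearMap.sub_apply, Module.End.mul_apply, exteriorDerivation_mul, map_add]
        noncomm_ring
      · simp [exteriorDerivation_algebraMap]
      · simp [exteriorDerivation_ι, ← map_sub]
    exact DFunLike.congr_fun this a

theorem lie_def (x : L) (a : ExteriorAlgebra R M) :
    ⁅x, a⁆ = exteriorDerivation (LieModule.toEnd R L M x) a := rfl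

instance : LieModule R L (ExteriorAlgebra R M) where
  smul_lie r x a := by
    have : exteriorDerivation (LieModule.toEnd R L M (r • x)) =
        r • exteriorDerivation (LieModule.toEnd R L M x) := by
      refine derivation_ext (exteriorDerivation_mul _) (fun a b => ?_)
        (exteriorDerivation_algebraMap _) (fun r => ?_) (fun v => ?_)
      · simp [exteriorDerivation_mul]
      · simp [exteriorDerivation_algebraMap]
      · simp [exteriorDerivation_ι]
    exact DFunLike.congr_fun this a
  lie_smul r x a := map_smul _ r a

theorem lie_ι (x : L) (v : M) :
    ⁅x, ExteriorAlgebra.ι R v⁆ = ExteriorAlgebra.ι R ⁅x, v⁆ :=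
  exteriorDerivation_ι _ v

theorem lie_mem_exteriorPower (x : L) (n : ℕ) {a : ExteriorAlgebra R M} (ha : a ∈ ⋀[R]^n M) :
    ⁅x, a⁆ ∈ ⋀[R]^n M := by
  refine Submodule.pow_induction_on_left' (M := LinearMap.range (ExteriorAlgebra.ι R (M := M)))
    (C := fun n a _ => ⁅x, a⁆ ∈ ⋀[R]^n M) ?_ ?_ ?_ ha
  · intro r
    rw [lie_def, exteriorDerivation_algebraMap]
    exact Submodule.zero_mem _
  · intro a b i _ _ h1 h2
    rw [lie_add]
    exact Submodule.add_mem _ h1 h2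
  · rintro m ⟨v, rfl⟩ i a ha h
    have e : ⋀[R]^(i + 1) M = ⋀[R]^1 M * ⋀[R]^i M := by
      rw [← pow_add, add_comm]
    have hι : ∀ w : M, ExteriorAlgebra.ι R w ∈ ⋀[R]^1 M := fun w => by
      exact (pow_one (LinearMap.range (ExteriorAlgebra.ι R (M := M)))).ge
        (LinearMap.mem_range_self _ _)
    rw [lie_def, exteriorDerivation_mul, exteriorDerivation_ι]
    refine Submodule.add_mem _ ?_ ?_
    · exact e ▸ Submodule.mul_mem_mul (hι _) ha
    · exact e ▸ Submodule.mul_mem_mul (hι _) h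

instance (n : ℕ) : LieRingModule L (⋀[R]^n M) where
  bracket x a := ⟨⁅x, (a : ExteriorAlgebra R M)⁆, lie_mem_exteriorPower x n a.2⟩
  add_lie x y a := Subtype.ext (add_lie x y (a : ExteriorAlgebra R M))
  lie_add x a b := Subtype.ext (lie_add x (a : ExteriorAlgebra R M) b)
  leibniz_lie x y a := Subtype.ext (leibniz_lie x y (a : ExteriorAlgebra R M))

theorem coe_lie_exteriorPower (x : L) (n : ℕ) (a : ⋀[R]^n M) :
    ((⁅x, a⁆ : ⋀[R]^n M) : ExteriorAlgebra R M) = ⁅x, (a : ExteriorAlgebra R M)⁆ := rfl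

instance (n : ℕ) : LieModule R L (⋀[R]^n M) where
  smul_lie r x a := Subtype.ext (smul_lie r x (a : ExteriorAlgebra R M))
  lie_smul r x a := Subtype.ext (lie_smul r x (a : ExteriorAlgebra R M))

end ExteriorAction

/-! ## Algebras with an action by derivations, quotients and invariants -/

section Invariants

/-- The Lie algebra `L` acts on the associative algebra `A` by derivations. -/
class ActsByDerivations (R L A : Type*) [CommRing R] [LieRing L] [LieAlgebra R L] [Ring A]
    [Algebra R A] [LieRingModule L A] : Prop where
  lie_mul : ∀ (x : L) (a b : A), ⁅x, a * b⁆ = ⁅x, a⁆ * b + a * ⁅x, b⁆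

instance {R M L : Type*} [CommRing R] [AddCommGroup M] [Module R M] [LieRing L] [LieAlgebra R L]
    [LieRingModule L M] [LieModule R L M] : ActsByDerivations R L (ExteriorAlgebra R M) where
  lie_mul x a b := exteriorDerivation_mul (LieModule.toEnd R L M x) a b

/-- The ideal `J` is stable under the action of `L`. -/
class IsLieStable (L : Type*) {A : Type*} [LieRing L] [Ring A] [LieRingModule L A]
    (J : Ideal A) : Prop where
  lie_mem : ∀ (x : L) {a : A}, a ∈ J → ⁅x, a⁆ ∈ J

variable (R L : Type*) {A : Type*} [CommRing R] [LieRing L] [LieAlgebra R L] [Ring A] [Algebra R A]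
  [LieRingModule L A] [LieModule R L A]

/-- The action of `L` on the quotient of `A` by a stable ideal. -/
instance (J : Ideal A) [IsLieStable L J] : LieRingModule L (A ⧸ J) where
  bracket x := QuotientAddGroup.map J.toAddSubgroup J.toAddSubgroup
    { toFun := fun a => ⁅x, a⁆, map_zero' := lie_zero x, map_add' := lie_add x }
    (fun _ ha => IsLieStable.lie_mem x ha)
  add_lie x y := by
    rintro ⟨a⟩
    exact congrArg (Submodule.Quotient.mk (p := J)) (add_lie x y a)
  lie_add x a b := map_add _ a b
  leibniz_lie x y := by
    rintro ⟨a⟩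
    exact congrArg (Submodule.Quotient.mk (p := J)) (leibniz_lie x y a)

theorem lie_mk (J : Ideal A) [J.IsTwoSided] [IsLieStable L J] (x : L) (a : A) :
    ⁅x, Ideal.Quotient.mk J a⁆ = Ideal.Quotient.mk J ⁅x, a⁆ := rfl

instance (J : Ideal A) [J.IsTwoSided] [IsLieStable L J] : LieModule R L (A ⧸ J) where
  smul_lie r x := by
    rintro ⟨a⟩
    exact congrArg (Submodule.Quotient.mk (p := J)) (smul_lie r x a)
  lie_smul r x := by
    rintro ⟨a⟩
    exact congrArg (Submodule.Quotient.mk (p := J)) (lie_smul r x a)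

instance (J : Ideal A) [J.IsTwoSided] [IsLieStable L J] [h : ActsByDerivations R L A] :
    ActsByDerivations R L (A ⧸ J) where
  lie_mul x := by
    rintro ⟨a⟩ ⟨b⟩
    exact congrArg (Submodule.Quotient.mk (p := J)) (h.lie_mul x a b)

variable (A) in
/-- The algebra `A^L` of `L`-invariants. -/
def invariants [h : ActsByDerivations R L A] : Subalgebra R A where
  carrier := LieModule.maxTrivSubmodule R L A
  add_mem' ha hb := add_mem ha hb
  mul_mem' {a b} ha hb := fun x => by
    rw [h.lie_mul, ha x, hb x, zero_mul, mul_zero, add_zero]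
  algebraMap_mem' r := fun x => by
    have h1 : ⁅x, (1 : A)⁆ = 0 := by
      have := h.lie_mul x 1 1
      simpa using this
    rw [Algebra.algebraMap_eq_smul_one]
    exact (lie_smul r x (1 : A)).trans (by rw [h1, smul_zero])

set_option linter.unusedSectionVars false in
/-- The two-sided ideal generated by a subset whose image under `L` lies in this ideal is stable. -/
theorem isLieStable_span [h : ActsByDerivations R L A] {S : Set A}
    (hS : ∀ (x : L), ∀ s ∈ S, ⁅x, s⁆ ∈ TwoSidedIdeal.span S) :
    IsLieStable L (TwoSidedIdeal.span S).asIdeal where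
  lie_mem x a ha := by
    rw [TwoSidedIdeal.mem_asIdeal] at ha ⊢
    induction ha using TwoSidedIdeal.span_induction with
    | mem s hs => exact hS x s hs
    | zero => rw [lie_zero]; exact zero_mem _
    | add a b _ _ ha hb => rw [lie_add]; exact add_mem ha hb
    | neg a _ ha => rw [lie_neg]; exact neg_mem ha
    | left_absorb b a ha h' =>
      rw [h.lie_mul]
      exact add_mem (TwoSidedIdeal.mul_mem_left _ _ _ ha) (TwoSidedIdeal.mul_mem_left _ _ _ h')
    | right_absorb b a ha h' =>
      rw [h.lie_mul]
      exact add_mem (TwoSidedIdeal.mul_mem_right _ _ _ h') (TwoSidedIdeal.mul_mem_right _ _ _ ha)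

end Invariants

/-! ## The symplectic module `H`, the module `U`, and the maps `f` -/

section Symplectic

open LieAlgebra.Symplectic

/-- The fundamental `sp_g`-module: column vectors of length `2g` over the rationals. -/
abbrev H (g : ℕ) : Type := Fin g ⊕ Fin g → ℚ

/-- The standard basis of `H`: `basisVec (inl i) = x_i` and `basisVec (inr i) = y_i`. -/
def basisVec {g : ℕ} (p : Fin g ⊕ Fin g) : H g := Pi.single p 1

/-- The basis vector `x_i`. -/
abbrev xVec {g : ℕ} (i : Fin g) : H g := basisVec (Sum.inl i)

/-- The basis vector `y_i`. -/
abbrev yVec {g : ℕ} (i : Fin g) : H g := basisVec (Sum.inr i)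

/-- The Lie algebra of symplectic matrices of degree `2g` over the rationals. -/
def sp (g : ℕ) : Type := LieAlgebra.Symplectic.sp (Fin g) ℚ

instance (g : ℕ) : LieRing (sp g) :=
  inferInstanceAs (LieRing (LieAlgebra.Symplectic.sp (Fin g) ℚ))

instance (g : ℕ) : LieAlgebra ℚ (sp g) :=
  inferInstanceAs (LieAlgebra ℚ (LieAlgebra.Symplectic.sp (Fin g) ℚ))

/-- The action of symplectic matrices on column vectors, `⁅X, v⁆ = X *ᵥ v`. -/
instance (g : ℕ) : LieRingModule (sp g) (H g) :=
  inferInstanceAs (LieRingModule (LieAlgebra.Symplectic.sp (Fin g) ℚ) (H g))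

instance (g : ℕ) : LieModule ℚ (sp g) (H g) :=
  inferInstanceAs (LieModule ℚ (LieAlgebra.Symplectic.sp (Fin g) ℚ) (H g))

theorem lie_eq_mulVec {g : ℕ} (X : sp g) (v : H g) : ⁅X, v⁆ = Matrix.mulVec X.1 v := rfl

theorem lie_basisVec {g : ℕ} (X : sp g) (q : Fin g ⊕ Fin g) :
    ⁅X, (basisVec q : H g)⁆ = ∑ k, (X.1 (Sum.inl k) q • xVec k + X.1 (Sum.inr k) q • yVec k) := by
  rw [lie_eq_mulVec, basisVec, Matrix.mulVec_single_one]
  funext p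
  rw [Finset.sum_apply]
  rcases p with p | p <;> simp [basisVec, Pi.single_apply]

/-- The element `∑ x_i ⊗ y_i - y_i ⊗ x_i` is invariant: its image under every bilinear map is
killed by the Leibniz action of the symplectic Lie algebra. -/
theorem sum_lie_symplectic {g : ℕ} {V : Type*} [AddCommGroup V] [Module ℚ V]
    (B : H g →ₗ[ℚ] H g →ₗ[ℚ] V) (X : sp g) :
    ∑ i, (B ⁅X, xVec i⁆ (yVec i) + B (xVec i) ⁅X, yVec i⁆ -
      B ⁅X, yVec i⁆ (xVec i) - B (yVec i) ⁅X, xVec i⁆) = 0 := by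
  have hX : X.1.transpose * Matrix.J (Fin g) ℚ = Matrix.J (Fin g) ℚ * (-X.1) :=
    (mem_skewAdjointMatricesSubmodule _ _).1 ((mem_skewAdjointMatricesLieSubalgebra _ _).1 X.2)
  have h1 : ∀ i j, X.1 (Sum.inr j) (Sum.inl i) = X.1 (Sum.inr i) (Sum.inl j) := fun i j => by
    simpa [Matrix.mul_apply, Matrix.J, Matrix.one_apply] using
      congrFun (congrFun hX (Sum.inl i)) (Sum.inl j)
  have h2 : ∀ i j, X.1 (Sum.inr i) (Sum.inr j) = - X.1 (Sum.inl j) (Sum.inl i) := fun i j => by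
    simpa [Matrix.mul_apply, Matrix.J, Matrix.one_apply] using
      (congrFun (congrFun hX (Sum.inl i)) (Sum.inr j)).symm
  have h3 : ∀ i j, X.1 (Sum.inl j) (Sum.inr i) = X.1 (Sum.inl i) (Sum.inr j) := fun i j => by
    simpa [Matrix.mul_apply, Matrix.J, Matrix.one_apply] using
      congrFun (congrFun hX (Sum.inr i)) (Sum.inr j)
  simp only [lie_basisVec, map_sum, LinearMap.sum_apply, map_add, map_smul, LinearMap.add_apply,
    LinearMap.smul_apply, Finset.sum_add_distrib, Finset.sum_sub_distrib]
  rw [Finset.sum_comm (f := fun i k => X.1 (Sum.inl k) (Sum.inl i) • B (xVec k) (yVec i)),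
    Finset.sum_comm (f := fun i k => X.1 (Sum.inr k) (Sum.inl i) • B (yVec k) (yVec i)),
    Finset.sum_comm (f := fun i k => X.1 (Sum.inl k) (Sum.inr i) • B (xVec k) (xVec i)),
    Finset.sum_comm (f := fun i k => X.1 (Sum.inr k) (Sum.inr i) • B (yVec k) (xVec i))]
  simp only [h2]
  simp only [neg_smul, Finset.sum_neg_distrib]
  have k1 : ∑ j, ∑ i, X.1 (Sum.inr j) (Sum.inl i) • B (yVec j) (yVec i) =
      ∑ j, ∑ i, X.1 (Sum.inr i) (Sum.inl j) • B (yVec j) (yVec i) :=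
    Finset.sum_congr rfl fun j _ => Finset.sum_congr rfl fun i _ => by rw [h1]
  have k3 : ∑ j, ∑ i, X.1 (Sum.inl j) (Sum.inr i) • B (xVec j) (xVec i) =
      ∑ j, ∑ i, X.1 (Sum.inl i) (Sum.inr j) • B (xVec j) (xVec i) :=
    Finset.sum_congr rfl fun j _ => Finset.sum_congr rfl fun i _ => by rw [h3]
  rw [k1, k3]
  abel

/-- The element `u ∧ v ∧ w` of the third exterior power. -/
def wedge₃ {M : Type*} [AddCommGroup M] [Module ℚ M] (u v w : M) : ⋀[ℚ]^3 M :=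
  exteriorPower.ιMulti ℚ 3 ![u, v, w]

theorem coe_wedge₃ {M : Type*} [AddCommGroup M] [Module ℚ M] (u v w : M) :
    (wedge₃ u v w : ExteriorAlgebra ℚ M) =
      ExteriorAlgebra.ι ℚ u * (ExteriorAlgebra.ι ℚ v * ExteriorAlgebra.ι ℚ w) := by
  simp [wedge₃, ExteriorAlgebra.ιMulti_apply]

section Wedge

variable {M : Type*} [AddCommGroup M] [Module ℚ M]

theorem wedge₃_add₁ (u u' v w : M) : wedge₃ (u + u') v w = wedge₃ u v w + wedge₃ u' v w :=
  Subtype.ext (by simp [coe_wedge₃, add_mul])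

theorem wedge₃_add₂ (u v v' w : M) : wedge₃ u (v + v') w = wedge₃ u v w + wedge₃ u v' w :=
  Subtype.ext (by simp [coe_wedge₃, add_mul, mul_add])

theorem wedge₃_add₃ (u v w w' : M) : wedge₃ u v (w + w') = wedge₃ u v w + wedge₃ u v w' :=
  Subtype.ext (by simp [coe_wedge₃, mul_add])

theorem wedge₃_smul₁ (r : ℚ) (u v w : M) : wedge₃ (r • u) v w = r • wedge₃ u v w :=
  Subtype.ext (by simp [coe_wedge₃])

theorem wedge₃_smul₂ (r : ℚ) (u v w : M) : wedge₃ u (r • v) w = r • wedge₃ u v w :=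
  Subtype.ext (by simp [coe_wedge₃])

theorem wedge₃_smul₃ (r : ℚ) (u v w : M) : wedge₃ u v (r • w) = r • wedge₃ u v w :=
  Subtype.ext (by simp [coe_wedge₃])

theorem wedge₃_swap₂₃ (u v w : M) : wedge₃ u w v = - wedge₃ u v w := by
  refine Subtype.ext ?_
  simp only [coe_wedge₃, Submodule.coe_neg]
  rw [← mul_neg, eq_neg_of_add_eq_zero_left (ExteriorAlgebra.ι_add_mul_swap w v)]

theorem lie_wedge₃ {L : Type*} [LieRing L] [LieAlgebra ℚ L] [LieRingModule L M] [LieModule ℚ L M]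
    (X : L) (u v w : M) :
    ⁅X, wedge₃ u v w⁆ = wedge₃ ⁅X, u⁆ v w + wedge₃ u ⁅X, v⁆ w + wedge₃ u v ⁅X, w⁆ := by
  refine Subtype.ext ?_
  simp only [coe_lie_exteriorPower, coe_wedge₃, Submodule.coe_add,
    ActsByDerivations.lie_mul (R := ℚ), lie_ι]
  noncomm_ring

end Wedge

/-- The submodule `H ∧ ∑ (x_i ∧ y_i)` of `Λ³H`. -/
def wedgeOmega (g : ℕ) : LieSubmodule ℚ (sp g) (⋀[ℚ]^3 (H g)) where
  carrier := {v | ∃ h : H g, v = ∑ i : Fin g, wedge₃ h (xVec i) (yVec i)}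
  add_mem' := by
    rintro _ _ ⟨h, rfl⟩ ⟨h', rfl⟩
    exact ⟨h + h', by simp only [wedge₃_add₁, Finset.sum_add_distrib]⟩
  zero_mem' := ⟨0, by
    have : ∀ v w : H g, wedge₃ 0 v w = 0 := fun v w => by
      simpa using wedge₃_smul₁ 0 (0 : H g) v w
    simp [this]⟩
  smul_mem' := by
    rintro r _ ⟨h, rfl⟩
    exact ⟨r • h, by simp only [wedge₃_smul₁, Finset.smul_sum]⟩
  lie_mem := by
    rintro X _ ⟨h, rfl⟩
    refine ⟨⁅X, h⁆, ?_⟩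
    let B : H g →ₗ[ℚ] H g →ₗ[ℚ] ⋀[ℚ]^3 (H g) := LinearMap.mk₂ ℚ (fun v w => wedge₃ h v w)
      (fun v v' w => wedge₃_add₂ h v v' w) (fun r v w => wedge₃_smul₂ r h v w)
      (fun v w w' => wedge₃_add₃ h v w w') (fun r v w => wedge₃_smul₃ r h v w)
    have key := sum_lie_symplectic B X
    have h2 : (2 : ℚ) • ∑ i : Fin g, (wedge₃ h ⁅X, xVec i⁆ (yVec i) +
        wedge₃ h (xVec i) ⁅X, yVec i⁆) = 0 := by
      rw [← key, Finset.smul_sum]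
      refine Finset.sum_congr rfl fun i _ => ?_
      simp only [B, LinearMap.mk₂_apply]
      rw [wedge₃_swap₂₃ h (xVec i) ⁅X, yVec i⁆, wedge₃_swap₂₃ h ⁅X, xVec i⁆ (yVec i), two_smul]
      abel
    have h3 := (smul_eq_zero.1 h2).resolve_left two_ne_zero
    rw [lie_sum]
    simp only [lie_wedge₃, add_assoc]
    rw [Finset.sum_add_distrib, h3, add_zero]

/-- The `sp_g`-module `U = Λ³H / (H ∧ ∑ (x_i ∧ y_i))`. -/
abbrev U (g : ℕ) : Type := ⋀[ℚ]^3 (H g) ⧸ wedgeOmega g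

/-- The algebra `Λ Λ³H`. -/
abbrev LambdaH (g : ℕ) : Type := ExteriorAlgebra ℚ (⋀[ℚ]^3 (H g))

/-- The algebra `Λ U`. -/
abbrev LambdaU (g : ℕ) : Type := ExteriorAlgebra ℚ (U g)

/-- The projection `Λ Λ³H → Λ U` induced by `Λ³H → U`. -/
def projU (g : ℕ) : LambdaH g →ₐ[ℚ] LambdaU g :=
  ExteriorAlgebra.map (LieSubmodule.Quotient.mk' (wedgeOmega g) : ⋀[ℚ]^3 (H g) →ₗ[ℚ] U g)

theorem lie_projU {g : ℕ} (X : sp g) (a : LambdaH g) : ⁅X, projU g a⁆ = projU g ⁅X, a⁆ := by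
  induction a using ExteriorAlgebra.induction with
  | algebraMap r =>
    rw [AlgHom.commutes, lie_def, lie_def, exteriorDerivation_algebraMap,
      exteriorDerivation_algebraMap, map_zero]
  | ι v =>
    rw [lie_ι, projU, ExteriorAlgebra.map_apply_ι, ExteriorAlgebra.map_apply_ι, lie_ι]
    exact congrArg _ ((LieSubmodule.Quotient.mk' (wedgeOmega g)).map_lie X v).symm
  | mul a b ha hb =>
    rw [ActsByDerivations.lie_mul (R := ℚ), map_mul, ActsByDerivations.lie_mul (R := ℚ), ha, hb,
      map_add, map_mul, map_mul]
  | add a b ha hb => rw [map_add, lie_add, lie_add, map_add, ha, hb]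

/-- The element `∑ (u ∧ v ∧ x_i) ∧ (w ∧ z ∧ y_i) - (u ∧ v ∧ y_i) ∧ (w ∧ z ∧ x_i)`
of `Λ²Λ³H`. -/
def edgeSum {g : ℕ} (u v w z : H g) : LambdaH g :=
  ∑ i : Fin g,
    (ExteriorAlgebra.ι ℚ (wedge₃ u v (xVec i)) * ExteriorAlgebra.ι ℚ (wedge₃ w z (yVec i)) -
      ExteriorAlgebra.ι ℚ (wedge₃ u v (yVec i)) * ExteriorAlgebra.ι ℚ (wedge₃ w z (xVec i)))

theorem lie_edgeSum {g : ℕ} (X : sp g) (u v w z : H g) :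
    ⁅X, edgeSum u v w z⁆ = edgeSum ⁅X, u⁆ v w z + edgeSum u ⁅X, v⁆ w z +
      edgeSum u v ⁅X, w⁆ z + edgeSum u v w ⁅X, z⁆ := by
  let B : H g →ₗ[ℚ] H g →ₗ[ℚ] LambdaH g := LinearMap.mk₂ ℚ
    (fun p q => ExteriorAlgebra.ι ℚ (wedge₃ u v p) * ExteriorAlgebra.ι ℚ (wedge₃ w z q))
    (fun p p' q => by simp only [wedge₃_add₃, map_add, add_mul])
    (fun r p q => by simp only [wedge₃_smul₃, map_smul, smul_mul_assoc])
    (fun p q q' => by simp only [wedge₃_add₃, map_add, mul_add])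
    (fun r p q => by simp only [wedge₃_smul₃, map_smul, mul_smul_comm])
  have key := sum_lie_symplectic B X
  rw [← add_zero (_ + _ + _ + _), ← key]
  simp only [edgeSum, lie_sum, ← Finset.sum_add_distrib]
  refine Finset.sum_congr rfl fun i _ => ?_
  simp only [B, LinearMap.mk₂_apply, lie_sub, ActsByDerivations.lie_mul (R := ℚ), lie_ι,
    lie_wedge₃, map_add]
  noncomm_ring

/-- `f_I : H^{⊗4} → Λ²Λ³H`, as a multilinear map:
`t₁ ⊗ t₂ ⊗ t₃ ⊗ t₄ ↦ ∑ (t₁ ∧ t₂ ∧ x_i) ∧ (t₃ ∧ t₄ ∧ y_i) - (t₁ ∧ t₂ ∧ y_i) ∧ (t₃ ∧ t₄ ∧ x_i)`. -/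
def fI (g : ℕ) : MultilinearMap ℚ (fun _ : Fin 4 => H g) (LambdaH g) where
  toFun t := edgeSum (t 0) (t 1) (t 2) (t 3)
  map_update_add' {d} t j u v := by
    obtain rfl : d = instDecidableEqFin 4 := Subsingleton.elim _ _
    rw [edgeSum, edgeSum, edgeSum, ← Finset.sum_add_distrib]
    refine Finset.sum_congr rfl fun i _ => ?_
    fin_cases j <;> simp [wedge₃_add₁, wedge₃_add₂, add_mul, mul_add] <;> abel
  map_update_smul' {d} t j r u := by
    obtain rfl : d = instDecidableEqFin 4 := Subsingleton.elim _ _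
    rw [edgeSum, edgeSum, Finset.smul_sum]
    refine Finset.sum_congr rfl fun i _ => ?_
    fin_cases j <;> simp [wedge₃_smul₁, wedge₃_smul₂, smul_sub]

/-- `f_H : H^{⊗4} → Λ²Λ³H`, as a multilinear map; see `fH_apply`. -/
def fH (g : ℕ) : MultilinearMap ℚ (fun _ : Fin 4 => H g) (LambdaH g) :=
  (fI g).domDomCongr ⟨![0, 2, 3, 1], ![0, 3, 1, 2], by decide, by decide⟩

/-- `f_X : H^{⊗4} → Λ²Λ³H`, as a multilinear map; see `fX_apply`. -/
def fX (g : ℕ) : MultilinearMap ℚ (fun _ : Fin 4 => H g) (LambdaH g) :=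
  (fI g).domDomCongr ⟨![0, 3, 1, 2], ![0, 2, 3, 1], by decide, by decide⟩

theorem fI_apply {g : ℕ} (t : Fin 4 → H g) : fI g t = edgeSum (t 0) (t 1) (t 2) (t 3) := rfl

theorem fH_apply {g : ℕ} (t : Fin 4 → H g) : fH g t = edgeSum (t 0) (t 2) (t 3) (t 1) := rfl

theorem fX_apply {g : ℕ} (t : Fin 4 → H g) : fX g t = edgeSum (t 0) (t 3) (t 1) (t 2) := rfl

open scoped TensorProduct in
/-- The homomorphism `f_{a,b,c} = a f_I + b f_H + c f_X : H^{⊗4} → Λ Λ³H`. -/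
def fABC (g : ℕ) (a b c : ℚ) : (⨂[ℚ] _ : Fin 4, H g) →ₗ[ℚ] LambdaH g :=
  PiTensorProduct.lift (a • fI g + b • fH g + c • fX g)

open scoped TensorProduct in
/-- The homomorphism `f̄_{a,b,c} : H^{⊗4} → Λ U`. -/
def fABCbar (g : ℕ) (a b c : ℚ) : (⨂[ℚ] _ : Fin 4, H g) →ₗ[ℚ] LambdaU g :=
  (projU g).toLinearMap ∘ₗ fABC g a b c

theorem lie_fABC_mem {g : ℕ} (a b c : ℚ) (X : sp g) (z) :
    ⁅X, fABC g a b c z⁆ ∈ LinearMap.range (fABC g a b c) := by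
  induction z using PiTensorProduct.induction_on with
  | smul_tprod r t =>
    have key : ⁅X, fABC g a b c (PiTensorProduct.tprod ℚ t)⁆ =
        ∑ j : Fin 4, fABC g a b c (PiTensorProduct.tprod ℚ (Function.update t j ⁅X, t j⁆)) := by
      simp only [fABC, PiTensorProduct.lift.tprod, add_apply,
        smul_apply, fI_apply, fH_apply, fX_apply, lie_add, lie_smul, lie_edgeSum,
        Fin.sum_univ_four]
      simp [smul_add]
      abel
    rw [map_smul, lie_smul, key]
    exact Submodule.smul_mem _ _ (Submodule.sum_mem _ fun j _ => LinearMap.mem_range_self _ _)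
  | add z w hz hw =>
    rw [map_add, lie_add]
    exact Submodule.add_mem _ hz hw

/-- The ideal `(Im f_{a,b,c})` of `Λ Λ³H`. -/
def idealF (g : ℕ) (a b c : ℚ) : Ideal (LambdaH g) :=
  (TwoSidedIdeal.span (LinearMap.range (fABC g a b c) : Set (LambdaH g))).asIdeal

/-- The ideal `(Im f̄_{a,b,c})` of `Λ U`. -/
def idealFbar (g : ℕ) (a b c : ℚ) : Ideal (LambdaU g) :=
  (TwoSidedIdeal.span (LinearMap.range (fABCbar g a b c) : Set (LambdaU g))).asIdeal

instance (g : ℕ) (a b c : ℚ) : (idealF g a b c).IsTwoSided :=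
  inferInstanceAs (TwoSidedIdeal.asIdeal _).IsTwoSided

instance (g : ℕ) (a b c : ℚ) : (idealFbar g a b c).IsTwoSided :=
  inferInstanceAs (TwoSidedIdeal.asIdeal _).IsTwoSided

instance (g : ℕ) (a b c : ℚ) : IsLieStable (sp g) (idealF g a b c) :=
  isLieStable_span ℚ (sp g) (by
    rintro X _ ⟨z, rfl⟩
    exact TwoSidedIdeal.subset_span (lie_fABC_mem a b c X z))

instance (g : ℕ) (a b c : ℚ) : IsLieStable (sp g) (idealFbar g a b c) :=
  isLieStable_span ℚ (sp g) (by
    rintro X _ ⟨z, rfl⟩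
    obtain ⟨w, hw⟩ := lie_fABC_mem a b c X z
    refine TwoSidedIdeal.subset_span ⟨w, ?_⟩
    change projU g (fABC g a b c w) = ⁅X, projU g (fABC g a b c z)⁆
    rw [hw, lie_projU])

end Symplectic

/-! ## Trivalent graphs -/

/-- A finite trivalent graph, possibly empty or disconnected, possibly with multiple edges and
1-loops. It is given by its vertices, its flags (half-edges), the vertex of each flag, and the
fixed-point free involution `opp` that sends a flag to the other flag on the same edge. -/
structure TrivalentGraph : Type 1 where
  Vert : Type
  Flag : Type
  [fintypeVert : Fintype Vert]
  [fintypeFlag : Fintype Flag]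
  vert : Flag → Vert
  opp : Flag → Flag
  opp_opp : ∀ f, opp (opp f) = f
  opp_ne : ∀ f, opp f ≠ f
  card_flags : ∀ v, Nat.card {f : Flag // vert f = v} = 3

namespace TrivalentGraph

attribute [instance] TrivalentGraph.fintypeVert TrivalentGraph.fintypeFlag

/-- An isomorphism of trivalent graphs. -/
structure Iso (Γ Δ : TrivalentGraph) where
  onVert : Γ.Vert ≃ Δ.Vert
  onFlag : Γ.Flag ≃ Δ.Flag
  vert_comm : ∀ f, Δ.vert (onFlag f) = onVert (Γ.vert f)
  opp_comm : ∀ f, Δ.opp (onFlag f) = onFlag (Γ.opp f)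

/-- Two trivalent graphs are equivalent if they are isomorphic. -/
instance setoid : Setoid TrivalentGraph where
  r Γ Δ := Nonempty (Iso Γ Δ)
  iseqv :=
    { refl := fun Γ => ⟨⟨Equiv.refl _, Equiv.refl _, fun _ => rfl, fun _ => rfl⟩⟩
      symm := by
        rintro Γ Δ ⟨φ⟩
        refine ⟨⟨φ.onVert.symm, φ.onFlag.symm, fun f => ?_, fun f => ?_⟩⟩
        · rw [Equiv.eq_symm_apply, ← φ.vert_comm, Equiv.apply_symm_apply]
        · rw [Equiv.eq_symm_apply, ← φ.opp_comm, Equiv.apply_symm_apply]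
      trans := by
        rintro Γ Δ Θ ⟨φ⟩ ⟨ψ⟩
        refine ⟨⟨φ.onVert.trans ψ.onVert, φ.onFlag.trans ψ.onFlag, fun f => ?_, fun f => ?_⟩⟩
        · simp [ψ.vert_comm, φ.vert_comm]
        · simp [ψ.opp_comm, φ.opp_comm] }

/-- The degree of a trivalent graph: half the number of its vertices. -/
def degree (Γ : TrivalentGraph) : ℕ := Nat.card Γ.Vert / 2

/-- Disjoint union of trivalent graphs. -/
def disjUnion (Γ Δ : TrivalentGraph) : TrivalentGraph where
  Vert := Γ.Vert ⊕ Δ.Vert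
  Flag := Γ.Flag ⊕ Δ.Flag
  vert := Sum.map Γ.vert Δ.vert
  opp := Sum.map Γ.opp Δ.opp
  opp_opp := by rintro (f | f) <;> simp [opp_opp]
  opp_ne := by rintro (f | f) <;> simp [opp_ne]
  card_flags := by
    rintro (v | v)
    · rw [← Γ.card_flags v]
      refine (Nat.card_congr (Equiv.ofBijective
        (fun f : {f // Γ.vert f = v} => ⟨Sum.inl f.1, congrArg Sum.inl f.2⟩) ⟨?_, ?_⟩)).symm
      · rintro ⟨f, hf⟩ ⟨f', hf'⟩ h
        exact Subtype.ext (Sum.inl_injective (congrArg Subtype.val h))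
      · rintro ⟨f | f, hf⟩
        · exact ⟨⟨f, Sum.inl_injective hf⟩, rfl⟩
        · exact absurd hf Sum.inr_ne_inl
    · rw [← Δ.card_flags v]
      refine (Nat.card_congr (Equiv.ofBijective
        (fun f : {f // Δ.vert f = v} => ⟨Sum.inr f.1, congrArg Sum.inr f.2⟩) ⟨?_, ?_⟩)).symm
      · rintro ⟨f, hf⟩ ⟨f', hf'⟩ h
        exact Subtype.ext (Sum.inr_injective (congrArg Subtype.val h))
      · rintro ⟨f | f, hf⟩
        · exact absurd hf Sum.inl_ne_inr
        · exact ⟨⟨f, Sum.inr_injective hf⟩, rfl⟩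

/-- The empty graph. -/
def empty : TrivalentGraph where
  Vert := Empty
  Flag := Empty
  vert := id
  opp := id
  opp_opp := fun f => f.elim
  opp_ne := fun f => f.elim
  card_flags := fun v => v.elim

/-- The graph obtained from `Γ` by permuting the flags among the vertices while keeping the
edges: the flag `f` is now attached to the vertex to which `σ f` was attached. -/
def reattach (Γ : TrivalentGraph) (σ : Equiv.Perm Γ.Flag) : TrivalentGraph where
  Vert := Γ.Vert
  Flag := Γ.Flag
  vert := fun f => Γ.vert (σ f)
  opp := Γ.opp
  opp_opp := Γ.opp_opp
  opp_ne := Γ.opp_ne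
  card_flags := fun v => by
    rw [← Γ.card_flags v]
    exact Nat.card_congr (σ.subtypeEquiv fun f => Iff.rfl)

/-- `Γ` contains a 1-loop, i.e. an edge that begins and ends at the same vertex. -/
def HasLoop (Γ : TrivalentGraph) : Prop := ∃ f, Γ.vert (Γ.opp f) = Γ.vert f

/-- An embedding of the graph `I` into `Γ`: the middle edge of `I` goes to the edge of `Γ` with the
flags `mid` and `opp mid`, which joins two distinct vertices; the legs `1, 2` of `I` go to the
other two flags at the vertex of `mid`, and the legs `3, 4` to the other two flags at the vertex
of `opp mid`. -/
structure IEmbedding (Γ : TrivalentGraph) where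
  mid : Γ.Flag
  leg₁ : Γ.Flag
  leg₂ : Γ.Flag
  leg₃ : Γ.Flag
  leg₄ : Γ.Flag
  vert_ne : Γ.vert mid ≠ Γ.vert (Γ.opp mid)
  vert₁ : Γ.vert leg₁ = Γ.vert mid
  vert₂ : Γ.vert leg₂ = Γ.vert mid
  vert₃ : Γ.vert leg₃ = Γ.vert (Γ.opp mid)
  vert₄ : Γ.vert leg₄ = Γ.vert (Γ.opp mid)
  leg₁_ne_mid : leg₁ ≠ mid
  leg₂_ne_mid : leg₂ ≠ mid
  leg₁_ne_leg₂ : leg₁ ≠ leg₂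
  leg₃_ne_opp : leg₃ ≠ Γ.opp mid
  leg₄_ne_opp : leg₄ ≠ Γ.opp mid
  leg₃_ne_leg₄ : leg₃ ≠ leg₄

open Classical in
/-- The graph `Γ_H`: the ends of the middle edge carry the legs `1, 3` and `4, 2`. -/
def graphH (Γ : TrivalentGraph) (E : Γ.IEmbedding) : TrivalentGraph :=
  Γ.reattach (Equiv.swap E.leg₂ E.leg₃)

open Classical in
/-- The graph `Γ_X`: the ends of the middle edge carry the legs `1, 4` and `2, 3`. -/
def graphX (Γ : TrivalentGraph) (E : Γ.IEmbedding) : TrivalentGraph :=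
  Γ.reattach (Equiv.swap E.leg₂ E.leg₄)

/-- A total ordering of `Γ`: a linear ordering of the vertices, a linear ordering of the three
flags at each vertex, and an ordering `(f₊, f₋)` of the two flags of each edge. The last datum is
recorded as the set `pos` of the flags `f₊`, which contains exactly one flag of each edge. -/
structure TotalOrdering (Γ : TrivalentGraph) where
  vertex : Fin (2 * Γ.degree) ≃ Γ.Vert
  flagAt : ∀ v : Γ.Vert, Fin 3 ≃ {f : Γ.Flag // Γ.vert f = v}
  pos : Finset Γ.Flag
  pos_iff : ∀ f, Γ.opp f ∈ pos ↔ f ∉ pos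

namespace TotalOrdering

variable {Γ : TrivalentGraph} (τ : Γ.TotalOrdering)

/-- The flag `f_j(v_i)`. -/
def flag (i : Fin (2 * Γ.degree)) (j : Fin 3) : Γ.Flag := (τ.flagAt (τ.vertex i) j).1

/-- The listing `(i, j) ↦ f_j(v_i)` of all flags by vertices. -/
def byVertex : Fin (2 * Γ.degree) × Fin 3 ≃ Γ.Flag :=
  (Equiv.prodCongr τ.vertex (Equiv.refl (Fin 3))).trans <|
    (Equiv.sigmaEquivProd Γ.Vert (Fin 3)).symm.trans <|
      (Equiv.sigmaCongrRight τ.flagAt).trans (Equiv.sigmaFiberEquiv Γ.vert)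

theorem byVertex_apply (i : Fin (2 * Γ.degree)) (j : Fin 3) :
    τ.byVertex (i, j) = τ.flag i j := rfl

/-- The listing `(e, 0) ↦ f₊(e)`, `(e, 1) ↦ f₋(e)` of all flags by edges, where an edge is
represented by its positive flag. -/
def byEdge : τ.pos × Fin 2 ≃ Γ.Flag :=
  Equiv.ofBijective (fun p => if p.2 = 0 then p.1.1 else Γ.opp p.1.1) <| by
    constructor
    · rintro ⟨⟨f, hf⟩, i⟩ ⟨⟨f', hf'⟩, i'⟩ h
      have h1 : Γ.opp f ∉ τ.pos := fun h => (τ.pos_iff f).1 h hf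
      have h2 : Γ.opp f' ∉ τ.pos := fun h => (τ.pos_iff f').1 h hf'
      fin_cases i <;> fin_cases i' <;> simp at h ⊢
      · exact h
      · exact h2 (h ▸ hf)
      · exact h1 (h ▸ hf')
      · rw [← Γ.opp_opp f, h, Γ.opp_opp]
    · intro f
      by_cases hf : f ∈ τ.pos
      · exact ⟨(⟨f, hf⟩, 0), by simp⟩
      · exact ⟨(⟨Γ.opp f, (τ.pos_iff f).2 hf⟩, 1), by simp [Γ.opp_opp]⟩

/-- For a linear ordering `ε` of the edges, the permutation of `{1, …, 6m}` that compares the list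
`f₁(v₁), f₂(v₁), f₃(v₁), f₁(v₂), …, f₃(v_{2m})` with the list
`f₊(e₁), f₋(e₁), f₊(e₂), f₋(e₂), …, f₋(e_{3m})`. -/
def comparison (ε : Fin (3 * Γ.degree) ≃ τ.pos) : Equiv.Perm (Fin (2 * Γ.degree * 3)) :=
  finProdFinEquiv.symm.trans <| τ.byVertex.trans <| τ.byEdge.symm.trans <|
    (Equiv.prodCongr ε.symm (Equiv.refl (Fin 2))).trans <|
      finProdFinEquiv.trans (finCongr (by omega))

/-- The total ordering is `∧`-admissible. -/
def IsAdmissible : Prop :=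
  ∀ ε : Fin (3 * Γ.degree) ≃ τ.pos, Equiv.Perm.sign (τ.comparison ε) = 1

/-- The sign of an index: `sgn(x_i) = 1` and `sgn(y_i) = -1`. -/
def indexSign {g : ℕ} : Fin g ⊕ Fin g → ℚ := Sum.elim (fun _ => 1) (fun _ => -1)

open Classical in
/-- The image in `Λ^{2m} Λ³H` of the invariant tensor `α_{(Γ,τ)}`. The sum is over all labelings of
the flags by basis vectors of `H` such that the two flags on each edge carry dual labels `x_i`, `y_i`
(in some order); the sign is the product of the signs of the labels of the positive flags;
the word `x_{i_1} ⋯ x_{i_{6m}}` goes to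
`(x_{i_1} ∧ x_{i_2} ∧ x_{i_3}) ∧ (x_{i_4} ∧ x_{i_5} ∧ x_{i_6}) ∧ ⋯`. -/
def alpha (g : ℕ) : LambdaH g :=
  ∑ i : Γ.Flag → Fin g ⊕ Fin g with ∀ f, i (Γ.opp f) = (i f).swap,
    (∏ f ∈ τ.pos, indexSign (i f)) •
      ExteriorAlgebra.ιMulti ℚ (2 * Γ.degree) (fun k =>
        wedge₃ (basisVec (i (τ.flag k 0)) : H g) (basisVec (i (τ.flag k 1)))
          (basisVec (i (τ.flag k 2))))

end TotalOrdering

end TrivalentGraph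

/-- Isomorphism classes of trivalent graphs. -/
def GraphClass : Type 1 := Quotient TrivalentGraph.setoid

open TrivalentGraph in
/-- Isomorphism classes of trivalent graphs form a commutative monoid under disjoint union. -/
instance : CommMonoid GraphClass where
  mul := Quotient.map₂ disjUnion <| by
    rintro Γ Γ' ⟨φ⟩ Δ Δ' ⟨ψ⟩
    refine ⟨⟨Equiv.sumCongr φ.onVert ψ.onVert, Equiv.sumCongr φ.onFlag ψ.onFlag, ?_, ?_⟩⟩
    · rintro (f | f)
      · exact congrArg Sum.inl (φ.vert_comm f)
      · exact congrArg Sum.inr (ψ.vert_comm f)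
    · rintro (f | f)
      · exact congrArg Sum.inl (φ.opp_comm f)
      · exact congrArg Sum.inr (ψ.opp_comm f)
  one := Quotient.mk _ TrivalentGraph.empty
  mul_assoc := by
    rintro ⟨Γ⟩ ⟨Δ⟩ ⟨Θ⟩
    refine Quotient.sound ⟨⟨Equiv.sumAssoc _ _ _, Equiv.sumAssoc _ _ _, ?_, ?_⟩⟩ <;>
      rintro ((f | f) | f) <;> rfl
  mul_comm := by
    rintro ⟨Γ⟩ ⟨Δ⟩
    refine Quotient.sound ⟨⟨Equiv.sumComm _ _, Equiv.sumComm _ _, ?_, ?_⟩⟩ <;>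
      rintro (f | f) <;> rfl
  one_mul := by
    rintro ⟨Γ⟩
    refine Quotient.sound ⟨⟨Equiv.emptySum Empty _, Equiv.emptySum Empty _, ?_, ?_⟩⟩ <;>
      rintro (f | f) <;> first | exact f.elim | rfl
  mul_one := by
    rintro ⟨Γ⟩
    refine Quotient.sound ⟨⟨Equiv.sumEmpty _ Empty, Equiv.sumEmpty _ Empty, ?_, ?_⟩⟩ <;>
      rintro (f | f) <;> first | exact f.elim | rfl

/-- The commutative algebra `C(φ)` of trivalent graphs over the rationals: the vector space on the
isomorphism classes of trivalent graphs, multiplied by disjoint union. -/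
abbrev GraphAlgebra : Type 1 := MonoidAlgebra ℚ GraphClass

/-- The element of `C(φ)` given by a trivalent graph. -/
def graph (Γ : TrivalentGraph) : GraphAlgebra :=
  MonoidAlgebra.of ℚ GraphClass (Quotient.mk _ Γ)

/-- The homogeneous part of `C(φ)` of degree `m`. -/
def graphDegree (m : ℕ) : Submodule ℚ GraphAlgebra :=
  Submodule.span ℚ {z | ∃ Γ : TrivalentGraph, Γ.degree = m ∧ z = graph Γ}

/-- The ideal `loop` generated by the graphs that contain a 1-loop. -/
def loopIdeal : Ideal GraphAlgebra :=
  Ideal.span {z | ∃ Γ : TrivalentGraph, Γ.HasLoop ∧ z = graph Γ}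

/-- The ideal `I_{a,b,c}` generated by `a Γ_I + b Γ_H + c Γ_X` for all embeddings `I ↪ Γ = Γ_I`. -/
def relationIdeal (a b c : ℚ) : Ideal GraphAlgebra :=
  Ideal.span {z | ∃ (Γ : TrivalentGraph) (E : Γ.IEmbedding),
    z = a • graph Γ + b • graph (Γ.graphH E) + c • graph (Γ.graphX E)}

/-! ## Gradings and stable isomorphisms -/

section Graded

variable {A B : Type*} [Ring A] [Algebra ℚ A] [Ring B] [Algebra ℚ B]

/-- The grading induced on a quotient algebra. -/
def quotientDegree (𝒜 : ℕ → Submodule ℚ A) (J : Ideal A) [J.IsTwoSided] (n : ℕ) :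
    Submodule ℚ (A ⧸ J) :=
  (𝒜 n).map (Ideal.Quotient.mkₐ ℚ J).toLinearMap

/-- The grading induced on a subalgebra. -/
def subalgebraDegree (𝒜 : ℕ → Submodule ℚ A) (S : Subalgebra ℚ A) (n : ℕ) : Submodule ℚ S :=
  (𝒜 n).comap S.val.toLinearMap

/-- The grading of the exterior algebra of `M`. -/
def exteriorDegree (M : Type*) [AddCommGroup M] [Module ℚ M] (n : ℕ) :
    Submodule ℚ (ExteriorAlgebra ℚ M) := ⋀[ℚ]^n M

/-- The algebra homomorphism `Ψ : A → B`, for the genus `g`, belongs to a stable isomorphism of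
graded algebras that multiplies degrees by `2`: it maps degree `m` to degree `2m`, it is a bijection
from degree `m` onto degree `2m` whenever `g ≥ 3m`, and `B` vanishes in odd degrees. -/
structure IsStableIso (g : ℕ) (𝒜 : ℕ → Submodule ℚ A) (ℬ : ℕ → Submodule ℚ B)
    (Ψ : A →ₐ[ℚ] B) : Prop where
  map_degree : ∀ m, ∀ z ∈ 𝒜 m, Ψ z ∈ ℬ (2 * m)
  bijOn : ∀ m, 3 * m ≤ g → Set.BijOn Ψ (𝒜 m) (ℬ (2 * m))
  odd_degree : ∀ n, Odd n → ℬ n = ⊥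

end Graded

end TrivalentSymplectic

end

open TrivalentSymplectic

noncomputable section

namespace TrivalentSymplectic

open TrivalentSymplectic.TrivalentGraph.TotalOrdering (indexSign)

/-! ## Tensors as functions of words -/

section Tensors

/-! An element of `Λ^n Λ³H` is a combination of words: a word puts a basis letter at each of the
`3n` positions `Fin n × Fin 3`, `vertexWedge` turns it into a product of triple wedges, and
`realize` extends such a family of vectors linearly to coefficient functions. A trivalent graph with
listed flags is a matching of the positions, and the product of symplectic pairings along the
matching (`matchingTensor`) is an invariant tensor.

Signs. A permutation of the vertices and of the flags at each vertex changes `vertexWedge` by its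
sign, because `3` is odd; a permutation of the edges and of the two flags of each edge changes
`matchingTensor` by its sign, because `2` is even. Multiplied by the sign that compares the two
listings, the realized tensor depends on the graph alone (`matchingValue_trans`). For an admissible
ordering the comparison sign is `1`, so this invariant is `α`. Comparison signs multiply under
disjoint union, which gives the homomorphism `graphHom`.

Surjectivity rests on two facts about `sp`. Invariants lift along equivariant maps out of a tensor
space (`IsEquivariant.exists_isInvariant`); this follows from an inner product for which
transposition of matrices is the adjoint. Invariant tensors with `k` pairs of positions, `k ≤ g`,
are combinations of matchings (`IsInvariant.mem_span_matchingTensor`); this follows from one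
identity for coefficients, obtained from the elementary symplectic matrices.

Injectivity. If `3m ≤ g`, the edges of a graph of degree `m` can carry distinct pairs `x_i, y_i`.
The coefficient of the resulting word is nonzero in the value of that graph and zero in the value of
every non-isomorphic graph of the same degree (`exists_detecting`).

Quotients. In degree `2m` the ideal `(Im f)` and the kernel of `Λ Λ³H → Λ U` are spanned by words in
the flags left over when one edge is removed (`relationFamily`, `loopFamily`). The same two facts
write an invariant in these spans through matchings of the remaining flags. Reinserting the edge
produces a relation `aΓ_I + bΓ_H + cΓ_X`, or a graph with a loop. So every invariant relation is the
value of a relation between graphs, which is what `isStableIso_of_relations` needs. -/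

/-- The elementary symplectic matrix `E_{ab} - ε_a ε_b E_{b'a'}`. -/
theorem elementary_mem_sp {g : ℕ} (a b : Fin g ⊕ Fin g) :
    Matrix.single a b (1 : ℚ) - Matrix.single b.swap a.swap (indexSign a * indexSign b) ∈
      LieAlgebra.Symplectic.sp (Fin g) ℚ := by
  refine (mem_skewAdjointMatricesLieSubalgebra _ _).2
    ((mem_skewAdjointMatricesSubmodule _ _).2 ?_)
  change _ * _ = _ * _
  ext p q
  rcases a with a | a <;> rcases b with b | b <;> rcases p with p | p <;> rcases q with q | q <;>
    simp [Matrix.mul_apply, Matrix.J, Matrix.one_apply, Matrix.single_apply, indexSign,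
      ite_and, Finset.sum_ite_eq] <;> split_ifs <;> simp_all

/-- The elementary symplectic matrix `E_{ab} - ε_a ε_b E_{b'a'}` as an element of `sp g`. -/
def elementary {g : ℕ} (a b : Fin g ⊕ Fin g) : sp g :=
  ⟨Matrix.single a b (1 : ℚ) - Matrix.single b.swap a.swap (indexSign a * indexSign b),
    elementary_mem_sp a b⟩

theorem sp_transpose_mul {g : ℕ} (X : sp g) :
    X.1.transpose * Matrix.J (Fin g) ℚ = Matrix.J (Fin g) ℚ * (-X.1) :=
  (mem_skewAdjointMatricesSubmodule _ _).1 ((mem_skewAdjointMatricesLieSubalgebra _ _).1 X.2)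

/-- Multiplying the defining relation by `J` on both sides and using `J² = -1` moves the transpose
to the other side. This is what makes the Lie algebra closed under transposition. -/
theorem sp_mul_transpose {g : ℕ} (X : sp g) :
    X.1 * Matrix.J (Fin g) ℚ = - (Matrix.J (Fin g) ℚ * X.1.transpose) := by
  have h := sp_transpose_mul X
  have hJ := Matrix.J_squared (Fin g) ℚ
  have h1 : Matrix.J (Fin g) ℚ * (X.1.transpose * Matrix.J (Fin g) ℚ) * Matrix.J (Fin g) ℚ =
      Matrix.J (Fin g) ℚ * (Matrix.J (Fin g) ℚ * (-X.1)) * Matrix.J (Fin g) ℚ := by rw [h]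
  rw [← mul_assoc, mul_assoc _ (Matrix.J (Fin g) ℚ) (Matrix.J (Fin g) ℚ),
    ← mul_assoc (Matrix.J (Fin g) ℚ) (Matrix.J (Fin g) ℚ) (-X.1), hJ] at h1
  simpa [neg_eq_iff_eq_neg] using h1.symm

/-- The transpose of a symplectic matrix. -/
def spTranspose {g : ℕ} (X : sp g) : sp g :=
  ⟨X.1.transpose, by
    refine (mem_skewAdjointMatricesLieSubalgebra _ _).2
      ((mem_skewAdjointMatricesSubmodule _ _).2 ?_)
    change X.1.transpose.transpose * _ = _ * (-X.1.transpose)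
    rw [Matrix.transpose_transpose, sp_mul_transpose, mul_neg]⟩

variable {g : ℕ} {F : Type*} [Fintype F] [DecidableEq F]

/-- The action of a symplectic matrix on the tensor with coefficients `t`. -/
def tensorAction (X : sp g) : Module.End ℚ ((F → Fin g ⊕ Fin g) → ℚ) where
  toFun t := fun l => ∑ p, ∑ a, X.1 (l p) a * t (Function.update l p a)
  map_add' s t := by
    funext l
    simp [mul_add, Finset.sum_add_distrib]
  map_smul' r t := by
    funext l
    simp only [Pi.smul_apply, smul_eq_mul, Finset.mul_sum, mul_left_comm, RingHom.id_apply]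

theorem tensorAction_apply (X : sp g) (t : (F → Fin g ⊕ Fin g) → ℚ) (l : F → Fin g ⊕ Fin g) :
    tensorAction X t l = ∑ p, ∑ a, X.1 (l p) a * t (Function.update l p a) := rfl

/-- The substitution of a letter at a position is an involution on pairs of a word and a letter. -/
def updateEquiv (A : Type*) (p : F) : Equiv.Perm ((F → A) × A) where
  toFun x := (Function.update x.1 p x.2, x.1 p)
  invFun x := (Function.update x.1 p x.2, x.1 p)
  left_inv x := by simp
  right_inv x := by simp

/-- The linear extension of a family of vectors indexed by words. -/
def realize {V : Type*} [AddCommGroup V] [Module ℚ V] (f : (F → Fin g ⊕ Fin g) → V) :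
    ((F → Fin g ⊕ Fin g) → ℚ) →ₗ[ℚ] V := Fintype.linearCombination ℚ f

theorem realize_apply {V : Type*} [AddCommGroup V] [Module ℚ V] (f : (F → Fin g ⊕ Fin g) → V)
    (t : (F → Fin g ⊕ Fin g) → ℚ) : realize f t = ∑ l, t l • f l := rfl

theorem range_realize {V : Type*} [AddCommGroup V] [Module ℚ V] (f : (F → Fin g ⊕ Fin g) → V) :
    LinearMap.range (realize f) = Submodule.span ℚ (Set.range f) :=
  Fintype.range_linearCombination ℚ f

/-- A family of vectors indexed by words transforms like the basic tensors. -/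
def IsEquivariant {V : Type*} [AddCommGroup V] [Module ℚ V] [LieRingModule (sp g) V]
    (f : (F → Fin g ⊕ Fin g) → V) : Prop :=
  ∀ (X : sp g) (l : F → Fin g ⊕ Fin g),
    ⁅X, f l⁆ = ∑ p, ∑ a, X.1 a (l p) • f (Function.update l p a)

/-- Exchanging the letter at `p` with the substituted letter is an involution (`updateEquiv`);
reindexing by it moves `X` from the coefficients to the vectors. For scalar families this is the
adjunction `sum_tensorAction_mul`. -/
theorem sum_update_swap {V : Type*} [AddCommGroup V] [Module ℚ V] (X : sp g)
    (s : (F → Fin g ⊕ Fin g) → ℚ) (f : (F → Fin g ⊕ Fin g) → V) :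
    ∑ l, tensorAction X s l • f l =
      ∑ l, s l • ∑ p, ∑ a, X.1 a (l p) • f (Function.update l p a) := by
  simp only [tensorAction_apply, Finset.sum_smul, Finset.smul_sum]
  rw [Finset.sum_comm, Finset.sum_comm (s := (Finset.univ : Finset (F → Fin g ⊕ Fin g)))]
  refine Finset.sum_congr rfl fun p _ => ?_
  rw [← Fintype.sum_prod_type', ← Fintype.sum_prod_type']
  refine Fintype.sum_equiv (updateEquiv _ p) _ _ fun x => ?_
  simp [updateEquiv, smul_smul, mul_comm]

theorem IsEquivariant.lie_realize {V : Type*} [AddCommGroup V] [Module ℚ V]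
    [LieRingModule (sp g) V] [LieModule ℚ (sp g) V] {f : (F → Fin g ⊕ Fin g) → V}
    (hf : IsEquivariant f) (X : sp g) (t : (F → Fin g ⊕ Fin g) → ℚ) :
    ⁅X, realize f t⁆ = realize f (tensorAction X t) := by
  rw [realize_apply, realize_apply, sum_update_swap, lie_sum]
  exact Finset.sum_congr rfl fun l _ => by rw [lie_smul, hf]

theorem sum_tensorAction_mul (X : sp g) (s t : (F → Fin g ⊕ Fin g) → ℚ) :
    ∑ l, tensorAction X s l * t l = ∑ l, s l * tensorAction (spTranspose X) t l :=
  sum_update_swap X s t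

/-- Invariant tensors. -/
def IsInvariant (t : (F → Fin g ⊕ Fin g) → ℚ) : Prop := ∀ X : sp g, tensorAction X t = 0

/-- Complete reducibility of tensor representations: invariants lift along equivariant maps out of
a space of tensors. -/
theorem IsEquivariant.exists_isInvariant {V : Type*} [AddCommGroup V] [Module ℚ V]
    [LieRingModule (sp g) V] [LieModule ℚ (sp g) V] {f : (F → Fin g ⊕ Fin g) → V}
    (hf : IsEquivariant f) {v : V} (hv : v ∈ Submodule.span ℚ (Set.range f))
    (hinv : ∀ X : sp g, ⁅X, v⁆ = 0) : ∃ t, IsInvariant t ∧ realize f t = v := by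
  -- The dot product is positive definite over `ℚ`, and the adjoint of the action of `X` is the
  -- action of its transpose. The component `r` of a preimage orthogonal to the kernel will be
  -- invariant.
  set B : LinearMap.BilinForm ℚ ((F → Fin g ⊕ Fin g) → ℚ) := dotProductBilin ℚ ℚ with hB
  have hBa : ∀ s t, B s t = ∑ l, s l * t l := fun s t => rfl
  have hself : ∀ t, B t t = 0 → t = 0 := fun t ht => by
    rw [hBa] at ht
    exact dotProduct_self_eq_zero.1 ht
  set K := LinearMap.ker (realize f)
  have hcompl : IsCompl K (B.orthogonal K) := by
    refine (LinearMap.BilinForm.isCompl_orthogonal_iff_disjoint ?_).2 ?_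
    · intro s t h
      rw [hBa] at h ⊢
      rw [← h]
      exact Finset.sum_congr rfl fun _ _ => mul_comm _ _
    · rw [Submodule.disjoint_def]
      exact fun t h1 h2 => hself t (h2 t h1)
  rw [← range_realize] at hv
  obtain ⟨t, rfl⟩ := hv
  obtain ⟨s, hs, r, hr, rfl⟩ := Submodule.mem_sup.1
    (hcompl.sup_eq_top.symm ▸ Submodule.mem_top : t ∈ K ⊔ B.orthogonal K)
  have hsr : realize f (s + r) = realize f r := by
    rw [map_add, LinearMap.mem_ker.1 hs, zero_add]
  refine ⟨r, fun X => ?_, hsr.symm⟩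
  refine hself _ ?_
  -- `X r` lies in the kernel because its image is `⁅X, v⁆ = 0`. Then `Xᵀ X r` lies there too, so
  -- `⟨X r, X r⟩ = ⟨r, Xᵀ X r⟩ = 0`.
  have hK : tensorAction X r ∈ K := by
    rw [LinearMap.mem_ker, ← hf.lie_realize, ← hsr, hinv]
  have : tensorAction (spTranspose X) (tensorAction X r) ∈ K := by
    rw [LinearMap.mem_ker, ← hf.lie_realize, LinearMap.mem_ker.1 hK, lie_zero]
  have h := hr _ this
  rw [hBa, sum_tensorAction_mul]
  rw [hBa] at h
  rw [← h]
  exact Finset.sum_congr rfl fun _ _ => mul_comm _ _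

/-- The basic identity satisfied by the coefficients of an invariant tensor. -/
theorem IsInvariant.sum_update {t : (F → Fin g ⊕ Fin g) → ℚ} (ht : IsInvariant t)
    (a b : Fin g ⊕ Fin g) (l : F → Fin g ⊕ Fin g) :
    ∑ p with l p = a, t (Function.update l p b) =
      indexSign a * indexSign b * ∑ p with l p = b.swap, t (Function.update l p a.swap) := by
  -- In the coefficient at `l`, the unit matrix `E_ab` contributes the left side and the other unit
  -- matrix the right side.
  have h := congrFun (ht (elementary a b)) l
  rw [tensorAction_apply] at h
  simp only [elementary, Matrix.sub_apply, Matrix.single_apply, sub_mul, ite_mul, zero_mul,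
    one_mul, Finset.sum_sub_distrib, ite_and, Pi.zero_apply] at h
  rw [sub_eq_zero] at h
  simp only [Finset.sum_filter, Finset.mul_sum, mul_ite, mul_zero]
  convert h using 2 with p _ p _
  · simp [eq_comm]
  · by_cases hp : l p = b.swap
    · simp [hp]
    · simp [hp, Ne.symm hp]

end Tensors

/-! ### Matching tensors, and the weights of invariant tensors -/

section FirstFundamentalTheorem

variable {g : ℕ} {F : Type*} [Fintype F] [DecidableEq F]

theorem indexSign_mul_self (a : Fin g ⊕ Fin g) : indexSign a * indexSign a = 1 := by
  rcases a with a | a <;> simp [indexSign]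

theorem indexSign_swap (a : Fin g ⊕ Fin g) : indexSign a.swap = - indexSign a := by
  rcases a with a | a <;> simp [indexSign]

theorem swap_ne (a : Fin g ⊕ Fin g) : a.swap ≠ a := by
  rcases a with a | a <;> simp

theorem swap_eq_iff {a b : Fin g ⊕ Fin g} : a.swap = b ↔ a = b.swap := by
  rcases a with a | a <;> rcases b with b | b <;> simp

/-- The coefficients of the symplectic form. -/
def pairing (a b : Fin g ⊕ Fin g) : ℚ := if b = a.swap then indexSign a else 0

/-- The product of the symplectic pairings of the letters at the positions `e (i, 0)`, `e (i, 1)`. -/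
def matchingTensor {K : Type*} [Fintype K] {F : Type*} (e : K × Fin 2 → F)
    (l : F → Fin g ⊕ Fin g) : ℚ := ∏ i, pairing (l (e (i, 0))) (l (e (i, 1)))

theorem pairing_ne_zero {a b : Fin g ⊕ Fin g} : pairing a b ≠ 0 ↔ b = a.swap := by
  unfold pairing
  split_ifs with h
  · simp only [h, iff_true]
    rcases a with a | a <;> simp [indexSign]
  · simp [h]

theorem matchingTensor_ne_zero {K : Type*} [Fintype K] {F : Type*} {e : K × Fin 2 → F}
    {l : F → Fin g ⊕ Fin g} :
    matchingTensor e l ≠ 0 ↔ ∀ i, l (e (i, 1)) = (l (e (i, 0))).swap := by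
  simp [matchingTensor, Finset.prod_ne_zero_iff, pairing_ne_zero]

/-- These are the entries of `X J = -J Xᵀ`, since `pairing` is `J` up to sign. -/
theorem sum_mul_pairing (X : sp g) (a b : Fin g ⊕ Fin g) :
    ∑ c, X.1 a c * pairing c b + ∑ c, X.1 b c * pairing a c = 0 := by
  have h : X.1 * Matrix.J (Fin g) ℚ = - (Matrix.J (Fin g) ℚ * X.1.transpose) :=
    sp_mul_transpose X
  have hab := congrFun (congrFun h a) b
  rcases a with a | a <;> rcases b with b | b <;>
    simp [Matrix.mul_apply, Matrix.J, Matrix.one_apply] at hab <;>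
    simp [pairing, indexSign] <;> linarith

/-- Matching tensors are invariant. -/
theorem isInvariant_matchingTensor {K : Type*} [Fintype K] [DecidableEq K] (e : K × Fin 2 ≃ F) :
    IsInvariant (matchingTensor (g := g) e) := by
  intro X
  funext l
  -- The Leibniz sum is grouped by pairs. Within a pair the other factors are untouched, and the two
  -- terms cancel by `sum_mul_pairing`.
  rw [tensorAction_apply, ← Equiv.sum_comp e, Fintype.sum_prod_type]
  refine Finset.sum_eq_zero fun i _ => ?_
  have key : ∀ (j : Fin 2) (a : Fin g ⊕ Fin g),
      matchingTensor e (Function.update l (e (i, j)) a) =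
        pairing (Function.update l (e (i, j)) a (e (i, 0)))
          (Function.update l (e (i, j)) a (e (i, 1))) *
          ∏ i' ∈ Finset.univ.erase i, pairing (l (e (i', 0))) (l (e (i', 1))) := fun j a => by
    rw [matchingTensor, ← Finset.mul_prod_erase _ _ (Finset.mem_univ i)]
    congr 1
    refine Finset.prod_congr rfl fun i' hi' => ?_
    have hne := (Finset.mem_erase.1 hi').1
    rw [Function.update_of_ne (by simp [hne]), Function.update_of_ne (by simp [hne])]
  simp only [key, ← mul_assoc, ← Finset.sum_mul, Fin.sum_univ_two]
  refine mul_eq_zero_of_left ?_ _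
  have h01 : e (i, 0) ≠ e (i, 1) := by simp
  simp only [Function.update_self, Function.update_of_ne h01, Function.update_of_ne h01.symm]
  exact sum_mul_pairing X _ _

theorem IsInvariant.smul {t : (F → Fin g ⊕ Fin g) → ℚ} (r : ℚ) (ht : IsInvariant t) :
    IsInvariant (r • t) := fun X => by rw [map_smul, ht, smul_zero]

theorem IsInvariant.sub {s t : (F → Fin g ⊕ Fin g) → ℚ} (hs : IsInvariant s)
    (ht : IsInvariant t) : IsInvariant (s - t) := fun X => by rw [map_sub, hs, ht, sub_zero]

theorem IsInvariant.sum {ι : Type*} (s : Finset ι) {t : ι → (F → Fin g ⊕ Fin g) → ℚ}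
    (ht : ∀ i ∈ s, IsInvariant (t i)) : IsInvariant (∑ i ∈ s, t i) := fun X => by
  rw [map_sum]
  exact Finset.sum_eq_zero fun i hi => ht i hi X

/-- Words in the support of an invariant tensor contain dual letters equally often. -/
theorem IsInvariant.card_eq {t : (F → Fin g ⊕ Fin g) → ℚ} (ht : IsInvariant t)
    {l : F → Fin g ⊕ Fin g} (hl : t l ≠ 0) (a : Fin g ⊕ Fin g) :
    (Finset.univ.filter fun p => l p = a).card = (Finset.univ.filter fun p => l p = a.swap).card := by
  -- For equal letters the elementary matrix is the diagonal `E_aa - E_a'a'`, whose weight on `l` is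
  -- the difference of the two counts.
  have h := ht.sum_update a a l
  rw [indexSign_mul_self, one_mul] at h
  have h1 : ∀ b : Fin g ⊕ Fin g, ∑ p with l p = b, t (Function.update l p b) =
      (Finset.univ.filter fun p => l p = b).card * t l := fun b => by
    rw [← nsmul_eq_mul]
    refine Finset.sum_eq_card_nsmul fun p hp => ?_
    rw [← (Finset.mem_filter.1 hp).2, Function.update_eq_self]
  rw [h1, h1] at h
  exact_mod_cast mul_right_cancel₀ hl h

theorem IsInvariant.exists_swap {t : (F → Fin g ⊕ Fin g) → ℚ} (ht : IsInvariant t)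
    {l : F → Fin g ⊕ Fin g} (hl : t l ≠ 0) (p : F) : ∃ q, l q = (l p).swap := by
  have h := ht.card_eq hl (l p)
  have : 0 < (Finset.univ.filter fun q => l q = l p).card := Finset.card_pos.2 ⟨p, by simp⟩
  rw [h] at this
  obtain ⟨q, hq⟩ := Finset.card_pos.1 this
  exact ⟨q, (Finset.mem_filter.1 hq).2⟩

/-- Invariant tensors of odd order vanish. -/
theorem IsInvariant.eq_zero_of_odd {t : (F → Fin g ⊕ Fin g) → ℚ} (ht : IsInvariant t)
    (hF : Odd (Fintype.card F)) : t = 0 := by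
  funext l
  by_contra hl
  have h : Fintype.card F = ∑ a, (Finset.univ.filter fun p => l p = a).card := by
    rw [← Finset.card_univ]
    exact Finset.card_eq_sum_card_fiberwise fun _ _ => Finset.mem_univ _
  rw [Fintype.sum_sum_type] at h
  have h2 : ∀ i : Fin g, (Finset.univ.filter fun p => l p = Sum.inl i).card =
      (Finset.univ.filter fun p => l p = Sum.inr i).card := fun i => ht.card_eq hl (Sum.inl i)
  simp only [h2, ← two_mul] at h
  exact (Nat.not_even_iff_odd.2 hF) (h ▸ even_two_mul _)

/-- Moving a pair of dual letters to an unused pair of dual letters. -/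
theorem IsInvariant.eq_sum_unused {t : (F → Fin g ⊕ Fin g) → ℚ} (ht : IsInvariant t)
    (l : F → Fin g ⊕ Fin g) (p : F) (b : Fin g ⊕ Fin g) (hb : ∀ q, l q ≠ b)
    (hb' : ∀ q, l q ≠ b.swap) :
    t l = indexSign (l p) * indexSign b *
      ∑ q with l q = (l p).swap, t (Function.update (Function.update l p b) q b.swap) := by
  -- In the word with `b` put at `p`, the letter `b` occurs only there, so one side of the identity
  -- is the single coefficient `t l`.
  have h := ht.sum_update b (l p) (Function.update l p b)
  have h1 : (Finset.univ.filter fun q => Function.update l p b q = b) = {p} := by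
    ext q
    by_cases hq : q = p
    · simp [hq]
    · simp [hq, hb]
  have h2 : (Finset.univ.filter fun q => Function.update l p b q = (l p).swap) =
      Finset.univ.filter fun q => l q = (l p).swap := by
    ext q
    by_cases hq : q = p
    · subst hq
      have : b ≠ (l q).swap := fun hh => hb' q (by rw [hh, Sum.swap_swap])
      simp [this, (swap_ne (l q)).symm]
    · simp [hq]
  rw [h1, h2, Finset.sum_singleton, Function.update_idem, Function.update_eq_self] at h
  rw [h, mul_comm (indexSign b)]

/-- In the stable range, an invariant tensor is determined by its coefficients at words without
repeated letters. -/
theorem IsInvariant.eq_zero_of_injective {t : (F → Fin g ⊕ Fin g) → ℚ} (ht : IsInvariant t)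
    (hF : Fintype.card F ≤ 2 * g) (h0 : ∀ l : F → Fin g ⊕ Fin g, Function.Injective l → t l = 0) :
    t = 0 := by
  -- Induction on the number of unused letters. A word with a repeated letter leaves some `b` unused
  -- because `card F ≤ 2g`, and in the support `b.swap` is then unused too. Moving one dual pair of
  -- a repeated letter to `b, b.swap` keeps the old letters, at `p'` and `q'`, and adds new ones.
  have main : ∀ (n : ℕ) (l : F → Fin g ⊕ Fin g),
      2 * g - (Finset.univ.image l).card = n → t l = 0 := by
    intro n
    induction n using Nat.strong_induction_on with
    | _ n ih =>
      intro l hn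
      by_contra hl
      by_cases hinj : Function.Injective l
      · exact hl (h0 l hinj)
      obtain ⟨p, p', hpp, hne⟩ : ∃ p p', l p = l p' ∧ p ≠ p' := by
        simpa [Function.Injective] using hinj
      have hlt : (Finset.univ.image l).card < 2 * g := lt_of_lt_of_le
        (lt_of_le_of_ne Finset.card_image_le fun h => hinj fun x y hxy =>
          Finset.card_image_iff.1 h (by simp) (by simp) hxy) hF
      obtain ⟨b, hb⟩ : ∃ b, b ∉ Finset.univ.image l := by
        by_contra! h
        have : Finset.univ.image l = Finset.univ := Finset.eq_univ_of_forall h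
        rw [this] at hlt
        simp [two_mul] at hlt
      have hb1 : ∀ q, l q ≠ b := fun q hq => hb (by simp [← hq])
      have hb2 : ∀ q, l q ≠ b.swap := fun q hq => by
        obtain ⟨r, hr⟩ := ht.exists_swap hl q
        exact hb1 r (by rw [hr, hq, Sum.swap_swap])
      refine hl ?_
      rw [ht.eq_sum_unused l p b hb1 hb2]
      refine mul_eq_zero_of_right _ (Finset.sum_eq_zero fun q hq => ?_)
      have hq : l q = (l p).swap := (Finset.mem_filter.1 hq).2
      have hqp : q ≠ p := fun h => swap_ne (l p) (by rw [← hq, h])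
      have hqp' : q ≠ p' := fun h => swap_ne (l p) (by rw [← hq, h, hpp])
      obtain ⟨q', hq', hqq'⟩ : ∃ q', l q' = (l p).swap ∧ q' ≠ q := by
        have h := ht.card_eq hl (l p)
        have h1 : 1 < (Finset.univ.filter fun r => l r = l p).card :=
          Finset.one_lt_card.2 ⟨p, by simp, p', by simp [hpp], hne⟩
        rw [h] at h1
        obtain ⟨q', hq', hh⟩ := Finset.exists_mem_ne h1 q
        exact ⟨q', (Finset.mem_filter.1 hq').2, hh⟩
      have hq'p : q' ≠ p := fun h => swap_ne (l p) (by rw [← hq', h])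
      refine ih _ ?_ _ rfl
      have hsub : insert b (Finset.univ.image l) ⊆
          Finset.univ.image (Function.update (Function.update l p b) q b.swap) := by
        intro c hc
        rw [Finset.mem_insert, Finset.mem_image] at hc
        rw [Finset.mem_image]
        rcases hc with rfl | ⟨r, -, rfl⟩
        · exact ⟨p, Finset.mem_univ _, by simp [hqp.symm]⟩
        · by_cases hrp : r = p
          · exact ⟨p', Finset.mem_univ _, by simp [hqp'.symm, hne.symm, hrp, hpp]⟩
          · by_cases hrq : r = q
            · exact ⟨q', Finset.mem_univ _, by simp [hqq', hq'p, hrq, hq, hq']⟩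
            · exact ⟨r, Finset.mem_univ _, by simp [hrp, hrq]⟩
      have hcard := Finset.card_le_card hsub
      rw [Finset.card_insert_of_notMem hb] at hcard
      omega
  funext l
  exact main _ l rfl

end FirstFundamentalTheorem

/-! ### Listing a set by the orbits of an involution -/

section Pairs

/-- A fixed point free involution of a finite set is a matching of its elements. -/
theorem exists_equiv_of_involution {F : Type*} [Fintype F] (s : F → F) (hs : ∀ p, s (s p) = p)
    (hne : ∀ p, s p ≠ p) : ∃ (k : ℕ) (e : Fin k × Fin 2 ≃ F), ∀ i, e (i, 1) = s (e (i, 0)) := by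
  classical
  -- A numbering singles out the smaller element of each orbit, which is listed first.
  let o : F ≃ Fin (Fintype.card F) := Fintype.equivFin F
  let K := {p : F // o p < o (s p)}
  have hK : ∀ p, ¬ o p < o (s p) → o (s p) < o (s (s p)) := fun p hp => by
    rw [hs]
    exact lt_of_le_of_ne (not_lt.1 hp) fun h => hne p (o.injective h)
  let e : K × Fin 2 ≃ F :=
    { toFun := fun x => if x.2 = 0 then x.1.1 else s x.1.1
      invFun := fun p => if h : o p < o (s p) then (⟨p, h⟩, 0) else (⟨s p, hK p h⟩, 1)
      left_inv := by
        rintro ⟨⟨p, hp⟩, j⟩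
        have hp' : ¬ o (s p) < o p := hp.asymm
        fin_cases j
        · simp [hp]
        · simp [hs, hp']
      right_inv := by
        intro p
        by_cases h : o p < o (s p)
        · simp [h]
        · simp [h, hs] }
  refine ⟨Fintype.card K, (Equiv.prodCongr (Fintype.equivFin K).symm (Equiv.refl _)).trans e, ?_⟩
  intro i
  simp [e]

end Pairs

/-! ### The first fundamental theorem in the stable range -/

section FirstFundamentalTheorem

variable {g : ℕ} {F : Type*} [Fintype F] [DecidableEq F]

/-- With the letter at `p` replaced by its dual, `p` and `p'` carry the same letter. There the basic
identity has the same two-term sum on both sides, with sign `-1`, so the sum vanishes. -/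
theorem IsInvariant.flip {t : (F → Fin g ⊕ Fin g) → ℚ} (ht : IsInvariant t)
    {l : F → Fin g ⊕ Fin g} (hl : Function.Injective l) {p p' : F} (hp : l p' = (l p).swap) :
    t (Equiv.swap (l p) (l p).swap ∘ l) = - t l := by
  have hne : p ≠ p' := fun h => swap_ne (l p) (by rw [← hp, ← h])
  have h := ht.sum_update (l p).swap (l p) (Function.update l p (l p).swap)
  have h1 : (Finset.univ.filter fun q => Function.update l p (l p).swap q = (l p).swap) =
      {p, p'} := by
    ext q
    by_cases hq : q = p
    · simp [hq]
    · simp [hq, ← hp, hl.eq_iff]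
  rw [Sum.swap_swap, h1, Finset.sum_pair hne, indexSign_swap, neg_mul, indexSign_mul_self,
    Function.update_idem, Function.update_eq_self] at h
  have h2 : Function.update (Function.update l p (l p).swap) p' (l p) =
      Equiv.swap (l p) (l p).swap ∘ l := by
    funext q
    by_cases hq : q = p'
    · simp [hq, hp]
    · by_cases hq' : q = p
      · simp [hq', hne]
      · have h3 : l q ≠ (l p).swap := fun h => hq (hl (h.trans hp.symm))
        have h4 : l q ≠ l p := fun h => hq' (hl h)
        simp [hq, hq', Equiv.swap_apply_of_ne_of_ne h4 h3]
  rw [h2] at h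
  linarith

/-- When no letter repeats, the sum in `IsInvariant.eq_sum_unused` has one term, at `p'`. -/
theorem IsInvariant.relabel {t : (F → Fin g ⊕ Fin g) → ℚ} (ht : IsInvariant t)
    {l : F → Fin g ⊕ Fin g} (hl : Function.Injective l) {p p' : F} (hp : l p' = (l p).swap)
    {b : Fin g ⊕ Fin g} (hb : ∀ q, l q ≠ b) (hb' : ∀ q, l q ≠ b.swap) :
    t ((Equiv.swap (l p) b * Equiv.swap (l p).swap b.swap) ∘ l) =
      indexSign (l p) * indexSign b * t l := by
  have hne : p ≠ p' := fun h => swap_ne (l p) (by rw [← hp, ← h])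
  have h := ht.eq_sum_unused l p b hb hb'
  have h1 : (Finset.univ.filter fun q => l q = (l p).swap) = {p'} := by
    ext q
    simp [← hp, hl.eq_iff]
  have h2 : Function.update (Function.update l p b) p' b.swap =
      (Equiv.swap (l p) b * Equiv.swap (l p).swap b.swap) ∘ l := by
    funext q
    have hbp : l p ≠ b.swap := hb' p
    by_cases hq : q = p'
    · simp [hq, hp, Equiv.swap_apply_of_ne_of_ne hbp.symm (swap_ne b)]
    · by_cases hq' : q = p
      · simp [hq', hne, Equiv.swap_apply_of_ne_of_ne (swap_ne (l p)).symm hbp]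
      · have h3 : l q ≠ (l p).swap := fun h => hq (hl (h.trans hp.symm))
        have h4 : l q ≠ l p := fun h => hq' (hl h)
        simp [hq, hq', Equiv.swap_apply_of_ne_of_ne h3 (hb' q),
          Equiv.swap_apply_of_ne_of_ne h4 (hb q)]
  rw [h1, Finset.sum_singleton, h2] at h
  rw [h, ← mul_assoc]
  have : indexSign (l p) * indexSign b * (indexSign (l p) * indexSign b) =
      (indexSign (l p) * indexSign (l p)) * (indexSign b * indexSign b) := by ring
  rw [this, indexSign_mul_self, indexSign_mul_self, one_mul, one_mul]

/-- Write words by their letters at `p, p', q, q'`. The basic identity at `b b' b a'` and at `a b' b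
b'` gives two equations that share the terms `a b' b a'` and `b b' b b'`; eliminating these equates
the coefficients at `a a' b b'` and `b b' a a'`. -/
theorem IsInvariant.transpose {t : (F → Fin g ⊕ Fin g) → ℚ} (ht : IsInvariant t)
    {l : F → Fin g ⊕ Fin g} (hl : Function.Injective l) {p p' q q' : F}
    (hp : l p' = (l p).swap) (hq : l q' = (l q).swap) (hpq : p ≠ q) (hpq' : p ≠ q') :
    t ((Equiv.swap (l p) (l q) * Equiv.swap (l p).swap (l q).swap) ∘ l) = t l := by
  obtain ⟨a, ha⟩ : ∃ a, a = l p := ⟨_, rfl⟩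
  obtain ⟨b, hb⟩ : ∃ b, b = l q := ⟨_, rfl⟩
  rw [← ha] at hp
  rw [← hb] at hq
  rw [← ha, ← hb]
  have hab : a ≠ b := fun h => hpq (hl (by rw [← ha, ← hb, h]))
  have hab' : a ≠ b.swap := fun h => hpq' (hl (by rw [← ha, hq, h]))
  have ha'b : a.swap ≠ b := fun h => hab' (by rw [← h, Sum.swap_swap])
  have ha'b' : a.swap ≠ b.swap := fun h => hab (by rw [← Sum.swap_swap a, h, Sum.swap_swap])
  have hpp' : p ≠ p' := fun h => swap_ne a (by rw [← hp, ← h, ha])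
  have hqq' : q ≠ q' := fun h => swap_ne b (by rw [← hq, ← h, hb])
  have hp'q : p' ≠ q := fun h => ha'b (by rw [← hp, h, hb])
  have hp'q' : p' ≠ q' := fun h => ha'b' (by rw [← hp, h, hq])
  let W : Fin g ⊕ Fin g → Fin g ⊕ Fin g → Fin g ⊕ Fin g → Fin g ⊕ Fin g → F → Fin g ⊕ Fin g :=
    fun x y z w r => if r = p then x else if r = p' then y else if r = q then z
      else if r = q' then w else l r
  have hW : ∀ x y z w, W x y z w = fun r => if r = p then x else if r = p' then y else
      if r = q then z else if r = q' then w else l r := fun x y z w => rfl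
  have u1 : ∀ x y z w c, Function.update (W x y z w) p c = W c y z w := by
    intro x y z w c; funext r; rw [hW, hW, Function.update_apply]; grind
  have u2 : ∀ x y z w c, Function.update (W x y z w) p' c = W x c z w := by
    intro x y z w c; funext r; rw [hW, hW, Function.update_apply]; grind
  have u3 : ∀ x y z w c, Function.update (W x y z w) q c = W x y c w := by
    intro x y z w c; funext r; rw [hW, hW, Function.update_apply]; grind
  have u4 : ∀ x y z w c, Function.update (W x y z w) q' c = W x y z c := by
    intro x y z w c; funext r; rw [hW, hW, Function.update_apply]; grind
  have ne : ∀ r, r ≠ p → r ≠ p' → r ≠ q → r ≠ q' →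
      l r ≠ a ∧ l r ≠ a.swap ∧ l r ≠ b ∧ l r ≠ b.swap := fun r h1 h2 h3 h4 =>
    ⟨fun h => h1 (hl (by rw [h, ha])), fun h => h2 (hl (by rw [h, hp])),
      fun h => h3 (hl (by rw [h, hb])), fun h => h4 (hl (by rw [h, hq]))⟩
  have hbb := swap_ne b
  have haa := swap_ne a
  have f1 : (Finset.univ.filter fun r => W b b.swap b a.swap r = b) = {p, q} := by
    ext r; simp only [hW, Finset.mem_filter, Finset.mem_univ, true_and, Finset.mem_insert,
      Finset.mem_singleton]; grind
  have f2 : (Finset.univ.filter fun r => W b b.swap b a.swap r = a.swap) = {q'} := by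
    ext r; simp only [hW, Finset.mem_filter, Finset.mem_univ, true_and,
      Finset.mem_singleton]; grind
  have f3 : (Finset.univ.filter fun r => W a b.swap b b.swap r = b.swap) = {p', q'} := by
    ext r; simp only [hW, Finset.mem_filter, Finset.mem_univ, true_and, Finset.mem_insert,
      Finset.mem_singleton]; grind
  have f4 : (Finset.univ.filter fun r => W a b.swap b b.swap r = a) = {p} := by
    ext r; simp only [hW, Finset.mem_filter, Finset.mem_univ, true_and,
      Finset.mem_singleton]; grind
  have h2 := ht.sum_update b a (W b b.swap b a.swap)
  have h3 := ht.sum_update b.swap a.swap (W a b.swap b b.swap)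
  rw [f1, f2, Finset.sum_pair hpq, Finset.sum_singleton, u1, u3, u4] at h2
  rw [Sum.swap_swap, Sum.swap_swap, f3, f4, Finset.sum_pair hp'q', Finset.sum_singleton,
    u1, u2, u4, indexSign_swap, indexSign_swap, neg_mul_neg] at h3
  have e1 : W a a.swap b b.swap = l := by
    funext r; rw [hW]; grind
  have e2 : W b b.swap a a.swap = (Equiv.swap a b * Equiv.swap a.swap b.swap) ∘ l := by
    funext r
    simp only [hW, Function.comp_apply, Equiv.Perm.mul_apply]
    by_cases r1 : r = p
    · rw [if_pos r1, r1, ← ha, Equiv.swap_apply_of_ne_of_ne haa.symm hab', Equiv.swap_apply_left]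
    rw [if_neg r1]
    by_cases r2 : r = p'
    · rw [if_pos r2, r2, hp, Equiv.swap_apply_left, Equiv.swap_apply_of_ne_of_ne hab'.symm hbb]
    rw [if_neg r2]
    by_cases r3 : r = q
    · rw [if_pos r3, r3, ← hb, Equiv.swap_apply_of_ne_of_ne ha'b.symm hbb.symm,
        Equiv.swap_apply_right]
    rw [if_neg r3]
    by_cases r4 : r = q'
    · rw [if_pos r4, r4, hq, Equiv.swap_apply_right, Equiv.swap_apply_of_ne_of_ne haa ha'b]
    obtain ⟨h1, h2, h3, h4⟩ := ne r r1 r2 r3 r4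
    rw [if_neg r4, Equiv.swap_apply_of_ne_of_ne h2 h4, Equiv.swap_apply_of_ne_of_ne h1 h3]
  rw [← e2, ← e1]
  linarith

/-- The word `(i, 0) ↦ x_i`, `(i, 1) ↦ y_i`. -/
def standardWord {k : ℕ} (hk : k ≤ g) (p : Fin k × Fin 2) : Fin g ⊕ Fin g :=
  if p.2 = 0 then Sum.inl (p.1.castLE hk) else Sum.inr (p.1.castLE hk)

theorem standardWord_injective {k : ℕ} (hk : k ≤ g) :
    Function.Injective (standardWord (g := g) hk) := by
  rintro ⟨i, j⟩ ⟨i', j'⟩ h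
  fin_cases j <;> fin_cases j' <;> simp_all [standardWord]

theorem standardWord_one {k : ℕ} (hk : k ≤ g) (i : Fin k) :
    standardWord (g := g) hk (i, 1) = (standardWord hk (i, 0)).swap := by
  simp [standardWord]

theorem indexSign_standardWord {k : ℕ} (hk : k ≤ g) (i : Fin k) :
    indexSign (standardWord (g := g) hk (i, 0)) = 1 := by
  simp [standardWord, indexSign]

theorem swap_equivSwap (a b c : Fin g ⊕ Fin g) :
    (Equiv.swap a b c).swap = Equiv.swap a.swap b.swap c.swap := by
  have := (Equiv.sumComm (Fin g) (Fin g)).symm_trans_swap_trans a b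
  have h := congrArg (fun f => f c.swap) this
  simpa using h

/-- The coefficients of an invariant tensor at words without repeated letters depend, up to sign,
only on the matching of dual letters. -/
theorem IsInvariant.apply_eq_standardWord {k : ℕ} (hk : k ≤ g)
    {t : (F → Fin g ⊕ Fin g) → ℚ} (ht : IsInvariant t)
    (e : Fin k × Fin 2 ≃ F) (c : Fin k × Fin 2 → Fin g ⊕ Fin g) (hc : Function.Injective c)
    (hdual : ∀ i, c (i, 1) = (c (i, 0)).swap) :
    t (c ∘ e.symm) = (∏ i, indexSign (c (i, 0))) * t (standardWord hk ∘ e.symm) := by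
  -- Induction on the number of pairs whose first letter is not yet the standard one.
  obtain ⟨n, hn⟩ : ∃ n, (Finset.univ.filter fun i => c (i, 0) ≠ standardWord hk (i, 0)).card = n :=
    ⟨_, rfl⟩
  induction n using Nat.strong_induction_on generalizing c with
  | _ n ih =>
    by_cases hall : ∀ i, c (i, 0) = standardWord hk (i, 0)
    · have : c = standardWord hk := by
        funext ⟨i, j⟩
        fin_cases j
        · exact hall i
        · exact (hdual i).trans ((congrArg Sum.swap (hall i)).trans (standardWord_one hk i).symm)
      simp [this, indexSign_standardWord]
    obtain ⟨i, hi⟩ := not_forall.1 hall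
    set a := c (i, 0) with ha
    set b := standardWord (g := g) hk (i, 0) with hb
    -- A permutation of letters that commutes with duality, corrects the pair `i` and keeps the
    -- correct pairs lowers this number. It remains to see that the coefficient changes as the
    -- product of signs does, in three cases: `b` dual to `a` (`flip`), `b` unused (`relabel`), `b`
    -- used by another pair (`transpose`).
    have step : ∀ w : Equiv.Perm (Fin g ⊕ Fin g), (∀ x, (w x).swap = w x.swap) →
        w a = b → (∀ j, j ≠ i → c (j, 0) = standardWord hk (j, 0) → w (c (j, 0)) = c (j, 0)) →
        t (w ∘ c ∘ e.symm) * ∏ j, indexSign (w (c (j, 0))) =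
          t (c ∘ e.symm) * ∏ j, indexSign (c (j, 0)) →
        t (c ∘ e.symm) = (∏ i, indexSign (c (i, 0))) * t (standardWord hk ∘ e.symm) := by
      intro w hw hwa hfix heq
      have hlt : (Finset.univ.filter fun j => (w ∘ c) (j, 0) ≠ standardWord hk (j, 0)).card < n := by
        rw [← hn]
        refine Finset.card_lt_card ((Finset.ssubset_iff_of_subset ?_).2 ⟨i, ?_, ?_⟩)
        · intro j hj
          simp only [Finset.mem_filter, Finset.mem_univ, true_and, Function.comp_apply] at hj ⊢
          intro hj'
          refine hj ?_
          by_cases hji : j = i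
          · rw [hji, ← ha, hwa]
          · rw [hfix j hji hj', hj']
        · simpa using hi
        · simp [← ha, hwa, ← hb]
      have h := ih _ hlt (w ∘ c) (w.injective.comp hc)
        (fun j => by simp only [Function.comp_apply, hdual, hw]) rfl
      have hsq : ∀ d : Fin k × Fin 2 → Fin g ⊕ Fin g,
          (∏ j, indexSign (d (j, 0))) * ∏ j, indexSign (d (j, 0)) = 1 := fun d => by
        rw [← Finset.prod_mul_distrib]
        exact Finset.prod_eq_one fun j _ => indexSign_mul_self _
      rw [Function.comp_assoc] at h
      rw [h, mul_comm, ← mul_assoc] at heq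
      have h2 := hsq (w ∘ c)
      simp only [Function.comp_apply] at heq h2
      rw [h2, one_mul] at heq
      rw [heq, mul_comm, mul_assoc, hsq, mul_one]
    have hprod : ∀ (w : Equiv.Perm (Fin g ⊕ Fin g)),
        (∀ j, j ≠ i → indexSign (w (c (j, 0))) = indexSign (c (j, 0))) →
        ∏ j, indexSign (w (c (j, 0))) = indexSign (w a) * indexSign a * ∏ j, indexSign (c (j, 0)) := by
      intro w hw
      rw [← Finset.mul_prod_erase _ _ (Finset.mem_univ i),
        ← Finset.mul_prod_erase _ (fun j => indexSign (c (j, 0))) (Finset.mem_univ i), ← ha,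
        mul_assoc (indexSign (w a)), ← mul_assoc (indexSign a), indexSign_mul_self, one_mul]
      congr 1
      exact Finset.prod_congr rfl fun j hj => hw j (Finset.mem_erase.1 hj).1
    have hinj : Function.Injective (c ∘ e.symm) := hc.comp e.symm.injective
    have hap : (c ∘ e.symm) (e (i, 0)) = a := by simp [ha]
    have hap' : (c ∘ e.symm) (e (i, 1)) = ((c ∘ e.symm) (e (i, 0))).swap := by simp [hdual]
    have hne : ∀ j, j ≠ i → ∀ s, c (j, s) ≠ a ∧ c (j, s) ≠ a.swap := fun j hj s => by
      refine ⟨fun h => hj ?_, fun h => hj ?_⟩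
      · exact congrArg Prod.fst (hc h)
      · exact congrArg Prod.fst (hc (h.trans (hdual i).symm))
    have hbi : ∀ j, j ≠ i → c (j, 0) = standardWord hk (j, 0) →
        c (j, 0) ≠ b ∧ c (j, 0) ≠ b.swap := fun j hj h => by
      rw [h, hb, ← standardWord_one]
      exact ⟨fun h' => hj (congrArg Prod.fst (standardWord_injective hk h')),
        fun h' => hj (congrArg Prod.fst (standardWord_injective hk h'))⟩
    by_cases h1 : b = a.swap
    · have hflip := ht.flip hinj hap'
      rw [hap] at hflip
      refine step (Equiv.swap a a.swap) (fun x => ?_) (by rw [Equiv.swap_apply_left, h1])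
        (fun j hj _ => Equiv.swap_apply_of_ne_of_ne (hne j hj 0).1 (hne j hj 0).2) ?_
      · rw [swap_equivSwap, Sum.swap_swap, Equiv.swap_comm]
      · rw [hflip, hprod _ fun j hj => by
          rw [Equiv.swap_apply_of_ne_of_ne (hne j hj 0).1 (hne j hj 0).2],
          Equiv.swap_apply_left, indexSign_swap]
        linear_combination (t (c ∘ e.symm) * ∏ j, indexSign (c (j, 0))) * indexSign_mul_self a
    have hba : b ≠ a := Ne.symm hi
    have hab' : a ≠ b.swap := fun h => h1 (by rw [h, Sum.swap_swap])
    have ha'b' : a.swap ≠ b.swap := fun h => hba (by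
      rw [← Sum.swap_swap a, h, Sum.swap_swap])
    have hw : ∀ x, ((Equiv.swap a b * Equiv.swap a.swap b.swap) x).swap =
        (Equiv.swap a b * Equiv.swap a.swap b.swap) x.swap := fun x => by
      have hdisj : Equiv.swap a b * Equiv.swap a.swap b.swap =
          Equiv.swap a.swap b.swap * Equiv.swap a b := by
        refine (Equiv.Perm.Disjoint.commute fun y => ?_).eq
        by_cases hy : y = a ∨ y = b
        · right
          rcases hy with rfl | rfl
          · exact Equiv.swap_apply_of_ne_of_ne (swap_ne _).symm hab'
          · exact Equiv.swap_apply_of_ne_of_ne h1 (swap_ne _).symm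
        · left
          exact Equiv.swap_apply_of_ne_of_ne (fun h => hy (Or.inl h)) (fun h => hy (Or.inr h))
      rw [Equiv.Perm.mul_apply, swap_equivSwap, swap_equivSwap, Sum.swap_swap, Sum.swap_swap,
        ← Equiv.Perm.mul_apply, ← hdisj]
    have hwa : (Equiv.swap a b * Equiv.swap a.swap b.swap) a = b := by
      rw [Equiv.Perm.mul_apply, Equiv.swap_apply_of_ne_of_ne (swap_ne a).symm hab',
        Equiv.swap_apply_left]
    have hwb : (Equiv.swap a b * Equiv.swap a.swap b.swap) b = a := by
      rw [Equiv.Perm.mul_apply, Equiv.swap_apply_of_ne_of_ne h1 (swap_ne b).symm,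
        Equiv.swap_apply_right]
    have hwfix : ∀ x, x ≠ a → x ≠ a.swap → x ≠ b → x ≠ b.swap →
        (Equiv.swap a b * Equiv.swap a.swap b.swap) x = x := fun x h1 h2 h3 h4 => by
      rw [Equiv.Perm.mul_apply, Equiv.swap_apply_of_ne_of_ne h2 h4,
        Equiv.swap_apply_of_ne_of_ne h1 h3]
    by_cases h2 : ∀ p, c p ≠ b
    · have h3 : ∀ p, c p ≠ b.swap := by
        rintro ⟨j, s⟩ h
        fin_cases s
        · exact h2 (j, 1) (by rw [hdual]; exact (congrArg Sum.swap h).trans (Sum.swap_swap b))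
        · refine h2 (j, 0) ?_
          have := hdual j
          rw [← Sum.swap_swap b, ← h]
          exact (Sum.swap_swap _).symm.trans (congrArg Sum.swap this.symm)
      have hrel := ht.relabel hinj hap' (b := b) (fun q => h2 _) (fun q => h3 _)
      rw [hap] at hrel
      refine step _ hw hwa (fun j hj _ =>
        hwfix _ (hne j hj 0).1 (hne j hj 0).2 (h2 _) (h3 _)) ?_
      rw [hrel, hprod _ fun j hj => by rw [hwfix _ (hne j hj 0).1 (hne j hj 0).2 (h2 _) (h3 _)],
        hwa]
      linear_combination (t (c ∘ e.symm) * ∏ j, indexSign (c (j, 0))) *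
        (indexSign b * indexSign b * indexSign_mul_self a + indexSign_mul_self b)
    · push Not at h2
      obtain ⟨⟨j, s⟩, hjs⟩ := h2
      have hji : j ≠ i := by
        rintro rfl
        fin_cases s
        · exact hba hjs.symm
        · exact h1 (hjs.symm.trans (hdual j))
      obtain ⟨s', hs'⟩ : ∃ s', c (j, s') = b.swap := by
        fin_cases s
        · exact ⟨1, (hdual j).trans (congrArg Sum.swap hjs)⟩
        · refine ⟨0, ?_⟩
          rw [← hjs]
          exact (Sum.swap_swap _).symm.trans (congrArg Sum.swap (hdual j).symm)
      have hfix2 : ∀ j', j' ≠ j → c (j', 0) ≠ b ∧ c (j', 0) ≠ b.swap := fun j' hj' =>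
        ⟨fun h => hj' (congrArg Prod.fst (hc (h.trans hjs.symm))),
          fun h => hj' (congrArg Prod.fst (hc (h.trans hs'.symm)))⟩
      have htr := ht.transpose hinj (p := e (i, 0)) (p' := e (i, 1)) (q := e (j, s))
        (q' := e (j, s')) hap' (by simp [hjs, hs']) (by simp [hji.symm]) (by simp [hji.symm])
      have hbq : (c ∘ e.symm) (e (j, s)) = b := by simp [hjs]
      rw [hap, hbq] at htr
      refine step _ hw hwa (fun j' hj' h => hwfix _ (hne j' hj' 0).1 (hne j' hj' 0).2
        (hbi j' hj' h).1 (hbi j' hj' h).2) ?_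
      rw [htr]
      congr 1
      -- The pair `j` receives `a` or `a.swap`. Its change of sign `ε_a ε_b` cancels that of the
      -- pair `i`, in agreement with the invariance of the coefficient under `transpose`.
      have hcj : indexSign ((Equiv.swap a b * Equiv.swap a.swap b.swap) (c (j, 0))) =
          indexSign a * indexSign b * indexSign (c (j, 0)) := by
        have : c (j, 0) = b ∨ c (j, 0) = b.swap := by
          fin_cases s
          · exact Or.inl hjs
          · right
            rw [← hjs]
            exact (Sum.swap_swap _).symm.trans (congrArg Sum.swap (hdual j).symm)
        rcases this with h | h
        · rw [h, hwb, mul_assoc, indexSign_mul_self, mul_one]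
        · rw [h, ← hw, hwb, indexSign_swap, indexSign_swap, mul_neg, mul_assoc,
            indexSign_mul_self, mul_one]
      rw [← Finset.mul_prod_erase _ _ (Finset.mem_univ i),
        ← Finset.mul_prod_erase _ (fun j => indexSign (c (j, 0))) (Finset.mem_univ i),
        ← Finset.mul_prod_erase _ _ (Finset.mem_erase.2 ⟨hji, Finset.mem_univ j⟩),
        ← Finset.mul_prod_erase _ (fun j => indexSign (c (j, 0)))
          (Finset.mem_erase.2 ⟨hji, Finset.mem_univ j⟩), ← ha, hwa, hcj]
      have hrest : ∏ x ∈ (Finset.univ.erase i).erase j,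
          indexSign ((Equiv.swap a b * Equiv.swap a.swap b.swap) (c (x, 0))) =
          ∏ x ∈ (Finset.univ.erase i).erase j, indexSign (c (x, 0)) := by
        refine Finset.prod_congr rfl fun x hx => ?_
        have hxj := (Finset.mem_erase.1 hx).1
        have hxi := (Finset.mem_erase.1 (Finset.mem_erase.1 hx).2).1
        rw [hwfix _ (hne x hxi 0).1 (hne x hxi 0).2 (hfix2 x hxj).1 (hfix2 x hxj).2]
      rw [hrest]
      linear_combination (indexSign a * indexSign (c (j, 0)) *
        ∏ x ∈ (Finset.univ.erase i).erase j, indexSign (c (x, 0))) * indexSign_mul_self b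

/-- The first fundamental theorem in the stable range: invariant tensors are combinations of
matching tensors. -/
theorem IsInvariant.mem_span_matchingTensor {k : ℕ} (hk : k ≤ g)
    {t : (F → Fin g ⊕ Fin g) → ℚ} (ht : IsInvariant t) (hF : Fintype.card F = k * 2) :
    t ∈ Submodule.span ℚ (Set.range fun e : Fin k × Fin 2 ≃ F => matchingTensor (g := g) e) := by
  classical
  let M : Finset (F → F) := Finset.univ.filter fun s => (∀ p, s (s p) = p) ∧ ∀ p, s p ≠ p
  have hM : ∀ s : M, ∃ e : Fin k × Fin 2 ≃ F, ∀ i, e (i, 1) = s.1 (e (i, 0)) := by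
    rintro ⟨s, hs⟩
    obtain ⟨h1, h2⟩ := (Finset.mem_filter.1 hs).2
    obtain ⟨k', e, he⟩ := exists_equiv_of_involution s h1 h2
    obtain rfl : k' = k := by
      have := Fintype.card_congr e
      simp only [Fintype.card_prod, Fintype.card_fin] at this
      omega
    exact ⟨e, he⟩
  choose e he using hM
  -- One listing is fixed for each matching, and its coefficient is read off at the standard word.
  -- An injective word in the support of `t - u` determines its matching of dual letters, and the
  -- tensors of all other matchings vanish on it; so `t - u` vanishes on injective words.
  set u : (F → Fin g ⊕ Fin g) → ℚ :=
    ∑ s : M, t (standardWord hk ∘ (e s).symm) • matchingTensor (g := g) (e s) with hu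
  have huinv : IsInvariant u :=
    IsInvariant.sum _ fun s _ => (isInvariant_matchingTensor (e s)).smul _
  have h0 : t - u = 0 := by
    refine (ht.sub huinv).eq_zero_of_injective (by omega) fun l hl => ?_
    by_contra hne
    choose s hs using (ht.sub huinv).exists_swap hne
    have hs1 : ∀ p, s (s p) = p := fun p => hl (by rw [hs, hs, Sum.swap_swap])
    have hs2 : ∀ p, s p ≠ p := fun p h => swap_ne (l p) (by rw [← hs, h])
    have hsM : s ∈ M := Finset.mem_filter.2 ⟨Finset.mem_univ _, hs1, hs2⟩
    refine hne ?_
    rw [Pi.sub_apply, sub_eq_zero, hu, Finset.sum_apply]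
    rw [Finset.sum_eq_single (⟨s, hsM⟩ : M)]
    · have h := ht.apply_eq_standardWord hk (e ⟨s, hsM⟩) (l ∘ e ⟨s, hsM⟩)
        (hl.comp (e ⟨s, hsM⟩).injective) (fun i => by
          simp only [Function.comp_apply, he, hs])
      have h1 : (l ∘ e ⟨s, hsM⟩) ∘ (e ⟨s, hsM⟩).symm = l := by
        funext p; simp
      rw [h1] at h
      rw [h, Pi.smul_apply, smul_eq_mul, mul_comm]
      congr 1
      refine Finset.prod_congr rfl fun i _ => ?_
      rw [he, pairing, if_pos (hs _)]
      rfl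
    · rintro ⟨s', hs'⟩ - hne'
      rw [Pi.smul_apply, smul_eq_mul]
      refine mul_eq_zero_of_right _ ?_
      by_contra hz
      rw [← ne_eq, matchingTensor_ne_zero] at hz
      refine hne' (Subtype.ext (funext fun p => ?_))
      obtain ⟨⟨i, j⟩, rfl⟩ := (e ⟨s', hs'⟩).surjective p
      have h1 := he ⟨s', hs'⟩ i
      have h2 := (Finset.mem_filter.1 hs').2.1
      have h3 : s (e ⟨s', hs'⟩ (i, 0)) = e ⟨s', hs'⟩ (i, 1) := hl (by rw [hs, hz])
      fin_cases j
      · exact h1.symm.trans h3.symm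
      · change s' (e ⟨s', hs'⟩ (i, 1)) = s (e ⟨s', hs'⟩ (i, 1))
        rw [← h3, hs1, h3, h1, h2]
    · intro h
      exact absurd (Finset.mem_univ _) h
  rw [sub_eq_zero] at h0
  rw [h0]
  exact Submodule.sum_mem _ fun s _ => Submodule.smul_mem _ _
    (Submodule.subset_span ⟨e s, rfl⟩)

end FirstFundamentalTheorem

/-! ### Signs of permutations that preserve blocks -/

section WreathPermutations

/-- A permutation of a product that permutes the fibres of the first projection. -/
theorem exists_wreath {N J : Type*} [Fintype N] [Fintype J] [DecidableEq N] [DecidableEq J]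
    [Nonempty J] (d : Equiv.Perm (N × J)) (hd : ∀ p q, (d p).1 = (d q).1 ↔ p.1 = q.1) :
    ∃ (π : Equiv.Perm N) (τ : N → Equiv.Perm J), (∀ i j, d (i, j) = (π i, τ i j)) ∧
      Equiv.Perm.sign d = Equiv.Perm.sign π ^ Fintype.card J * ∏ i, Equiv.Perm.sign (τ i) := by
  obtain ⟨j0⟩ := ‹Nonempty J›
  have hπ : Function.Bijective fun i => (d (i, j0)).1 := Finite.injective_iff_bijective.1
    fun i i' h => (hd (i, j0) (i', j0)).1 h
  have h1 : ∀ i j, (d (i, j)).1 = (d (i, j0)).1 := fun i j => (hd _ _).2 rfl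
  have hτ : ∀ i, Function.Bijective fun j => (d (i, j)).2 := fun i =>
    Finite.injective_iff_bijective.1 fun j j' h => by
      have : d (i, j) = d (i, j') := Prod.ext ((hd _ _).2 rfl) h
      simpa using this
  let π := Equiv.ofBijective _ hπ
  let τ := fun i => Equiv.ofBijective _ (hτ i)
  have hdd : ∀ i j, d (i, j) = (π i, τ i j) := fun i j => Prod.ext (h1 i j) rfl
  refine ⟨π, τ, hdd, ?_⟩
  -- `π` acts on `card J` copies of `N`, hence the exponent. It is odd for the three flags of a
  -- vertex and even for the two flags of an edge.
  have : d = Equiv.prodCongrLeft (fun _ => π) * Equiv.prodCongrRight τ := by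
    ext1 ⟨i, j⟩
    rw [hdd]
    rfl
  rw [this, Equiv.Perm.sign_mul, Equiv.Perm.sign_prodCongrLeft, Equiv.Perm.sign_prodCongrRight,
    Finset.prod_const, Finset.card_univ]

end WreathPermutations

/-! ### Words in `Λ Λ³H` and their symmetries -/

section Wedges

variable {g : ℕ}

theorem sum_smul_basisVec (X : sp g) (q : Fin g ⊕ Fin g) :
    ⁅X, (basisVec q : H g)⁆ = ∑ a, X.1 a q • basisVec a := by
  rw [lie_basisVec, Fintype.sum_sum_type, Finset.sum_add_distrib]

/-- Expanding `⁅X, basisVec (l p)⁆` in the basis turns the Leibniz rule into the substitution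
formula. -/
theorem isEquivariant_of_multilinear {F : Type*} [Fintype F] [DecidableEq F] {V : Type*}
    [AddCommGroup V] [Module ℚ V] [LieRingModule (sp g) V]
    (m : MultilinearMap ℚ (fun _ : F => H g) V)
    (hm : ∀ (X : sp g) w, ⁅X, m w⁆ = ∑ p, m (Function.update w p ⁅X, w p⁆)) :
    IsEquivariant fun l : F → Fin g ⊕ Fin g => m fun p => basisVec (l p) := by
  intro X l
  rw [hm]
  refine Finset.sum_congr rfl fun p _ => ?_
  rw [sum_smul_basisVec, MultilinearMap.map_update_sum]
  refine Finset.sum_congr rfl fun a _ => ?_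
  rw [MultilinearMap.map_update_smul]
  congr 2
  exact (Function.comp_update basisVec l p a).symm

theorem span_range_basisVec : Submodule.span ℚ (Set.range (basisVec (g := g))) = ⊤ := by
  have : (basisVec (g := g)) = Pi.basisFun ℚ (Fin g ⊕ Fin g) := by
    funext p
    simp [basisVec]
  rw [this]
  exact (Pi.basisFun ℚ _).span_eq

/-- The element `l(1) ∧ l(2) ∧ l(3)` of `Λ³H`. -/
def tripleWedge (l : Fin 3 → Fin g ⊕ Fin g) : ⋀[ℚ]^3 (H g) :=
  exteriorPower.ιMulti ℚ 3 fun j => basisVec (l j)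

theorem wedge₃_eq_ιMulti {M : Type*} [AddCommGroup M] [Module ℚ M] (f : Fin 3 → M) :
    wedge₃ (f 0) (f 1) (f 2) = exteriorPower.ιMulti ℚ 3 f := by
  rw [wedge₃]
  congr 1
  funext j
  fin_cases j <;> rfl

theorem span_range_tripleWedge : Submodule.span ℚ (Set.range (tripleWedge (g := g))) = ⊤ := by
  rw [← exteriorPower.ιMulti_span_of_span ℚ 3 (H g) (span_range_basisVec (g := g))]
  congr 1
  ext z
  constructor
  · rintro ⟨l, rfl⟩
    exact ⟨_, Set.range_subset_iff.2 fun j => ⟨l j, rfl⟩, rfl⟩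
  · rintro ⟨f, hf, rfl⟩
    choose l hl using Set.range_subset_iff.1 hf
    exact ⟨l, by rw [tripleWedge]; congr 1; exact funext hl⟩

theorem lie_triple {M : Type*} [AddCommGroup M] [Module ℚ M]
    {L : Type*} [LieRing L] [LieAlgebra ℚ L] [LieRingModule L M] [LieModule ℚ L M]
    (X : L) (w : Fin 3 → M) : ⁅X, exteriorPower.ιMulti ℚ 3 w⁆ =
      ∑ p, exteriorPower.ιMulti ℚ 3 (Function.update w p ⁅X, w p⁆) := by
  simp only [← wedge₃_eq_ιMulti, lie_wedge₃, Fin.sum_univ_three]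
  rfl

theorem isEquivariant_tripleWedge : IsEquivariant (tripleWedge (g := g)) :=
  isEquivariant_of_multilinear (exteriorPower.ιMulti ℚ 3).toMultilinearMap fun X w => lie_triple X w

theorem lie_ιMulti {M : Type*} [AddCommGroup M] [Module ℚ M]
    {L : Type*} [LieRing L] [LieAlgebra ℚ L] [LieRingModule L M] [LieModule ℚ L M]
    (X : L) {n : ℕ} (v : Fin n → M) : ⁅X, ExteriorAlgebra.ιMulti ℚ n v⁆ =
      ∑ k, ExteriorAlgebra.ιMulti ℚ n (Function.update v k ⁅X, v k⁆) := by
  induction n with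
  | zero =>
    rw [ExteriorAlgebra.ιMulti_zero_apply]
    have := exteriorDerivation_algebraMap (R := ℚ) (LieModule.toEnd ℚ L M X) 1
    simpa [lie_def] using this
  | succ n ih =>
    rw [Fin.sum_univ_succ]
    simp only [ExteriorAlgebra.ιMulti_succ_apply, ActsByDerivations.lie_mul (R := ℚ), lie_ι, ih,
      Finset.mul_sum, Function.update_self]
    congr 1
    refine Finset.sum_congr rfl fun k _ => ?_
    rw [Function.update_of_ne (Fin.succ_ne_zero k).symm]
    congr 2
    funext i
    simp only [Matrix.vecTail, Function.comp_apply, Function.update_apply, Fin.succ_inj]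

/-- The product over the vertices `k` of `l(k,1) ∧ l(k,2) ∧ l(k,3)`. -/
def vertexWedge {n : ℕ} (l : Fin n × Fin 3 → Fin g ⊕ Fin g) : LambdaH g :=
  ExteriorAlgebra.ιMulti ℚ n fun k => tripleWedge fun j => l (k, j)

theorem vertexWedge_mem {n : ℕ} (l : Fin n × Fin 3 → Fin g ⊕ Fin g) :
    vertexWedge l ∈ ⋀[ℚ]^n (⋀[ℚ]^3 (H g)) :=
  ExteriorAlgebra.ιMulti_range ℚ n ⟨_, rfl⟩

theorem span_range_vertexWedge (n : ℕ) :
    Submodule.span ℚ (Set.range (vertexWedge (g := g) (n := n))) = ⋀[ℚ]^n (⋀[ℚ]^3 (H g)) := by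
  rw [← exteriorPower.ιMulti_span_fixedDegree_of_span_eq_top ℚ n _
    (span_range_tripleWedge (g := g))]
  congr 1
  ext z
  constructor
  · rintro ⟨l, rfl⟩
    exact ⟨_, Set.range_subset_iff.2 fun k => ⟨_, rfl⟩, rfl⟩
  · rintro ⟨f, hf, rfl⟩
    choose l hl using Set.range_subset_iff.1 hf
    exact ⟨fun p => l p.1 p.2, by rw [vertexWedge]; congr 1; exact funext hl⟩

theorem isEquivariant_vertexWedge (n : ℕ) : IsEquivariant (vertexWedge (g := g) (n := n)) := by
  intro X l
  rw [vertexWedge, lie_ιMulti, Fintype.sum_prod_type]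
  refine Finset.sum_congr rfl fun k _ => ?_
  rw [isEquivariant_tripleWedge X fun j => l (k, j), AlternatingMap.map_update_sum]
  refine Finset.sum_congr rfl fun j _ => ?_
  rw [AlternatingMap.map_update_sum]
  refine Finset.sum_congr rfl fun a _ => ?_
  rw [AlternatingMap.map_update_smul, vertexWedge]
  congr 2
  funext k'
  by_cases hk : k' = k
  · subst hk
    rw [Function.update_self]
    congr 1
    funext j'
    simp [Function.update_apply]
  · rw [Function.update_of_ne hk]
    congr 1
    funext j'
    rw [Function.update_of_ne (by simp [hk])]

/-- Both levels are alternating: flags at the vertex `k` contribute the sign of `τ k`, vertices the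
sign of `π`. Since `sign π ^ 3 = sign π`, the total is the sign of `d` as a permutation of flags. -/
theorem vertexWedge_comp {n : ℕ} (l : Fin n × Fin 3 → Fin g ⊕ Fin g)
    (d : Equiv.Perm (Fin n × Fin 3)) (hd : ∀ p q, (d p).1 = (d q).1 ↔ p.1 = q.1) :
    vertexWedge (l ∘ d) = ((Equiv.Perm.sign d : ℤ) : ℚ) • vertexWedge l := by
  obtain ⟨π, τ, h, hsign⟩ := exists_wreath d hd
  have h1 : (fun k => tripleWedge fun j => (l ∘ d) (k, j)) =
      fun k => ((Equiv.Perm.sign (τ k) : ℤ) : ℚ) • ((fun k => tripleWedge fun j => l (k, j)) ∘ π) k := by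
    funext k
    have : (fun j => (basisVec ((l ∘ d) (k, j)) : H g)) =
        (fun j => basisVec (l (π k, j))) ∘ τ k := by
      funext j
      simp [h]
    rw [tripleWedge, this, AlternatingMap.map_perm, Units.smul_def, ← Int.cast_smul_eq_zsmul ℚ]
    rfl
  rw [vertexWedge, h1, ← AlternatingMap.coe_multilinearMap, MultilinearMap.map_smul_univ,
    AlternatingMap.coe_multilinearMap, AlternatingMap.map_perm, Units.smul_def,
    ← Int.cast_smul_eq_zsmul ℚ, smul_smul, hsign, vertexWedge]
  congr 1
  have h3 : Equiv.Perm.sign π ^ 3 = Equiv.Perm.sign π := by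
    rw [pow_succ, sq, Int.units_mul_self, one_mul]
  rw [Fintype.card_fin, h3, mul_comm]
  push_cast
  rfl

/-- Reversing an edge changes the sign of its pairing, while permuting edges changes nothing. The
latter agrees with the sign on flags, where `sign π` enters squared. -/
theorem matchingTensor_comp {K F : Type*} [Fintype K] [DecidableEq K] (e : K × Fin 2 → F)
    (l : F → Fin g ⊕ Fin g) (c : Equiv.Perm (K × Fin 2))
    (hc : ∀ p q, (c p).1 = (c q).1 ↔ p.1 = q.1) :
    matchingTensor (e ∘ c) l = ((Equiv.Perm.sign c : ℤ) : ℚ) * matchingTensor e l := by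
  obtain ⟨π, τ, h, hsign⟩ := exists_wreath c hc
  have key : ∀ (σ : Equiv.Perm (Fin 2)) (f : Fin 2 → Fin g ⊕ Fin g),
      pairing (f (σ 0)) (f (σ 1)) = ((Equiv.Perm.sign σ : ℤ) : ℚ) * pairing (f 0) (f 1) := by
    intro σ f
    have hσ : σ = 1 ∨ σ = Equiv.swap 0 1 := by revert σ; decide
    rcases hσ with rfl | rfl
    · simp
    · by_cases hf : f 1 = (f 0).swap
      · simp [pairing, hf, indexSign_swap]
      · have hf' : f 0 ≠ (f 1).swap := fun h => hf (swap_eq_iff.1 h.symm)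
        simp [pairing, hf, hf']
  have h2 : ∀ i, pairing (l ((e ∘ c) (i, 0))) (l ((e ∘ c) (i, 1))) =
      ((Equiv.Perm.sign (τ i) : ℤ) : ℚ) * pairing (l (e (π i, 0))) (l (e (π i, 1))) := fun i => by
    simp only [Function.comp_apply, h]
    exact key (τ i) fun j => l (e (π i, j))
  simp only [matchingTensor, h2, Finset.prod_mul_distrib]
  rw [Equiv.prod_comp π fun i => pairing (l (e (i, 0))) (l (e (i, 1)))]
  congr 1
  rw [hsign, Fintype.card_fin, sq, Int.units_mul_self, one_mul]
  push_cast
  rfl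

theorem IsEquivariant.mul {A : Type*} [Ring A] [Algebra ℚ A] [LieRingModule (sp g) A]
    [h : ActsByDerivations ℚ (sp g) A] {F F' : Type*} [Fintype F] [DecidableEq F] [Fintype F']
    [DecidableEq F'] {f : (F → Fin g ⊕ Fin g) → A} {f' : (F' → Fin g ⊕ Fin g) → A}
    (hf : IsEquivariant f) (hf' : IsEquivariant f') :
    IsEquivariant fun l : F ⊕ F' → Fin g ⊕ Fin g => f (l ∘ Sum.inl) * f' (l ∘ Sum.inr) := by
  intro X l
  rw [h.lie_mul, hf, hf', Fintype.sum_sum_type]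
  simp only [Finset.sum_mul, Finset.mul_sum, Sum.update_inl_comp_inl, Sum.update_inr_comp_inr,
    Sum.update_inl_comp_inr, Sum.update_inr_comp_inl, smul_mul_assoc, mul_smul_comm,
    Function.comp_apply]

theorem IsEquivariant.comp_linear {V W : Type*} [AddCommGroup V] [Module ℚ V]
    [LieRingModule (sp g) V] [AddCommGroup W] [Module ℚ W]
    [LieRingModule (sp g) W] {F : Type*} [Fintype F] [DecidableEq F]
    {f : (F → Fin g ⊕ Fin g) → V} (hf : IsEquivariant f) (φ : V →ₗ[ℚ] W)
    (hφ : ∀ (X : sp g) v, ⁅X, φ v⁆ = φ ⁅X, v⁆) :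
    IsEquivariant fun l : F → Fin g ⊕ Fin g => φ (f l) := by
  intro X l
  rw [hφ, hf]
  simp only [map_sum, map_smul]

end Wedges

/-! ### Extracting coefficients of words -/

section Coefficients

variable {g : ℕ}

/-- The linear form on `Λ³H` that extracts the coefficient of `l(1) ∧ l(2) ∧ l(3)`. -/
def tripleCoefficient (l : Fin 3 → Fin g ⊕ Fin g) : ⋀[ℚ]^3 (H g) →ₗ[ℚ] ℚ :=
  exteriorPower.alternatingMapLinearEquiv
    ((Matrix.detRowAlternating (R := ℚ) (n := Fin 3)).compLinearMap (LinearMap.funLeft ℚ ℚ l))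

theorem tripleCoefficient_apply (l m : Fin 3 → Fin g ⊕ Fin g) :
    tripleCoefficient l (tripleWedge m) =
      Matrix.det (Matrix.of fun i j => if l j = m i then (1 : ℚ) else 0) := by
  rw [tripleCoefficient, tripleWedge, exteriorPower.alternatingMapLinearEquiv_apply_ιMulti]
  change Matrix.det (R := ℚ) (n := Fin 3) _ = _
  congr 1
  ext i j
  simp [LinearMap.funLeft, basisVec, Pi.single_apply]

/-- The linear form on `Λ Λ³H` that extracts the coefficient of the product of the
`l(k,1) ∧ l(k,2) ∧ l(k,3)`. -/
def vertexCoefficient {n : ℕ} (l : Fin n × Fin 3 → Fin g ⊕ Fin g) : LambdaH g →ₗ[ℚ] ℚ :=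
  ExteriorAlgebra.liftAlternating (R := ℚ) (M := ⋀[ℚ]^3 (H g)) (N := ℚ) fun i =>
    if h : i = n then h ▸ (Matrix.detRowAlternating (R := ℚ) (n := Fin n)).compLinearMap
      (LinearMap.pi fun k => tripleCoefficient fun j => l (k, j)) else 0

theorem vertexCoefficient_apply {n : ℕ} (l m : Fin n × Fin 3 → Fin g ⊕ Fin g) :
    vertexCoefficient l (vertexWedge m) = Matrix.det (Matrix.of fun i k : Fin n =>
      tripleCoefficient (fun j => l (k, j)) (tripleWedge fun j => m (i, j))) := by
  rw [vertexCoefficient, vertexWedge, ExteriorAlgebra.liftAlternating_apply_ιMulti, dif_pos rfl]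
  rfl

theorem exists_perm_of_det_ne_zero {n : ℕ} {A : Matrix (Fin n) (Fin n) ℚ} (h : A.det ≠ 0) :
    ∃ σ : Equiv.Perm (Fin n), ∀ i, A i (σ i) ≠ 0 := by
  rw [← Matrix.det_transpose, Matrix.det_apply] at h
  obtain ⟨σ, -, hσ⟩ := Finset.exists_ne_zero_of_sum_ne_zero h
  refine ⟨σ, fun i hi => hσ ?_⟩
  rw [Finset.prod_eq_zero (Finset.mem_univ i) (by simpa using hi), smul_zero]

/-- A nonzero term of the outer determinant gives a permutation of the vertices, and nonzero terms
of the inner ones give permutations of the flags at each vertex. -/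
theorem exists_wreath_of_vertexCoefficient_ne_zero {n : ℕ} {l m : Fin n × Fin 3 → Fin g ⊕ Fin g}
    (h : vertexCoefficient l (vertexWedge m) ≠ 0) :
    ∃ d : Equiv.Perm (Fin n × Fin 3), (∀ p q, (d p).1 = (d q).1 ↔ p.1 = q.1) ∧ m = l ∘ d := by
  rw [vertexCoefficient_apply] at h
  obtain ⟨π, hπ⟩ := exists_perm_of_det_ne_zero h
  have h2 : ∀ k, ∃ τ : Equiv.Perm (Fin 3), ∀ j, l (π k, τ j) = m (k, j) := fun k => by
    have := hπ k
    rw [Matrix.of_apply, tripleCoefficient_apply] at this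
    obtain ⟨τ, hτ⟩ := exists_perm_of_det_ne_zero this
    exact ⟨τ, fun j => by simpa using hτ j⟩
  choose τ hτ using h2
  refine ⟨Equiv.prodCongrLeft (fun _ => π) * Equiv.prodCongrRight τ, ?_, ?_⟩
  · rintro ⟨i, j⟩ ⟨i', j'⟩
    simp [Equiv.prodCongrLeft, Equiv.prodCongrRight]
  · funext ⟨k, j⟩
    exact (hτ k j).symm

/-- Distinct letters make the inner matrix the identity for equal vertices and zero for different
ones, so the outer matrix is the identity. -/
theorem vertexCoefficient_self {n : ℕ} {l : Fin n × Fin 3 → Fin g ⊕ Fin g}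
    (hl : Function.Injective l) : vertexCoefficient l (vertexWedge l) = 1 := by
  have h1 : ∀ i k : Fin n, tripleCoefficient (fun j => l (k, j)) (tripleWedge fun j => l (i, j)) =
      (1 : Matrix (Fin n) (Fin n) ℚ) i k := by
    intro i k
    rw [tripleCoefficient_apply]
    by_cases hik : i = k
    · subst hik
      rw [Matrix.one_apply_eq]
      convert Matrix.det_one (R := ℚ) (n := Fin 3) using 2
      ext j j'
      simp [hl.eq_iff, Matrix.one_apply, eq_comm]
    · rw [Matrix.one_apply_ne hik]
      convert Matrix.det_zero (R := ℚ) (n := Fin 3) using 2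
      ext j j'
      simp [hl.eq_iff, Ne.symm hik]
  rw [vertexCoefficient_apply]
  convert Matrix.det_one (R := ℚ) (n := Fin n) using 2
  ext i k
  exact h1 i k

end Coefficients

/-! ### The invariant attached to a matching -/

section Matchings

/-- The induced map on blocks inherits surjectivity from `d`, and is injective because `N` is
finite. -/
theorem fst_eq_iff_of_fst_eq {N J : Type*} [Finite N] [Nonempty J] (d : Equiv.Perm (N × J))
    (hd : ∀ i j j', (d (i, j)).1 = (d (i, j')).1) (p q : N × J) :
    (d p).1 = (d q).1 ↔ p.1 = q.1 := by
  obtain ⟨j0⟩ := ‹Nonempty J›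
  have hinj : Function.Injective fun i => (d (i, j0)).1 := by
    refine Finite.injective_iff_surjective.2 fun i' => ?_
    obtain ⟨⟨i, j⟩, hij⟩ := d.surjective (i', j0)
    exact ⟨i, by rw [hd i j0 j, hij]⟩
  obtain ⟨i, j⟩ := p
  obtain ⟨i', j'⟩ := q
  rw [hd i j j0, hd i' j' j0]
  exact hinj.eq_iff

/-- The comparison of two listings of the same number of positions. -/
def positionEquiv {n k : ℕ} (h : n * 3 = k * 2) : Fin n × Fin 3 ≃ Fin k × Fin 2 :=
  finProdFinEquiv.trans ((finCongr h).trans finProdFinEquiv.symm)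

variable {g n k : ℕ}

/-- The sign of a listing of the positions `(i, j)` by edges. -/
def matchingSign (h : n * 3 = k * 2) (u : Fin k × Fin 2 ≃ Fin n × Fin 3) : ℚ :=
  ((Equiv.Perm.sign ((positionEquiv h).trans u) : ℤ) : ℚ)

theorem matchingSign_mul_self (h : n * 3 = k * 2) (u : Fin k × Fin 2 ≃ Fin n × Fin 3) :
    matchingSign h u * matchingSign h u = 1 := by
  rw [matchingSign, ← Int.cast_mul, Int.units_coe_mul_self, Int.cast_one]

/-- The invariant of `Λ Λ³H` attached to a matching of the flags of `n` vertices. -/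
def matchingValue (g : ℕ) (h : n * 3 = k * 2) (u : Fin k × Fin 2 ≃ Fin n × Fin 3) : LambdaH g :=
  matchingSign h u • realize vertexWedge (matchingTensor u)

/-- Conjugation by `positionEquiv` carries `c` from edge positions to vertex positions without
changing its sign. -/
theorem matchingSign_trans (h : n * 3 = k * 2) (u : Fin k × Fin 2 ≃ Fin n × Fin 3)
    (c : Equiv.Perm (Fin k × Fin 2)) (d : Equiv.Perm (Fin n × Fin 3)) :
    matchingSign h (c.trans (u.trans d)) =
      ((Equiv.Perm.sign c : ℤ) : ℚ) * ((Equiv.Perm.sign d : ℤ) : ℚ) * matchingSign h u := by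
  have h1 : (positionEquiv h).trans (c.trans (u.trans d)) =
      d * ((positionEquiv h).trans u) *
        (((positionEquiv h).symm.symm.trans c).trans (positionEquiv h).symm) := by
    ext1 p
    simp
  rw [matchingSign, h1, Equiv.Perm.sign_mul, Equiv.Perm.sign_mul, Equiv.Perm.sign_symm_trans_trans,
    matchingSign]
  push_cast
  ring

theorem matchingTensor_trans {K F F' : Type*} [Fintype K] (u : K × Fin 2 → F) (d : F → F')
    (l : F' → Fin g ⊕ Fin g) : matchingTensor (d ∘ u) l = matchingTensor u (l ∘ d) := rfl

/-- Reindexing the words by `d` produces its sign through `vertexWedge_comp`; `c` produces its sign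
through `matchingTensor_comp`. -/
theorem realize_matchingTensor_trans (u : Fin k × Fin 2 ≃ Fin n × Fin 3)
    (c : Equiv.Perm (Fin k × Fin 2)) (hc : ∀ p q, (c p).1 = (c q).1 ↔ p.1 = q.1)
    (d : Equiv.Perm (Fin n × Fin 3)) (hd : ∀ p q, (d p).1 = (d q).1 ↔ p.1 = q.1) :
    realize (g := g) vertexWedge (matchingTensor (c.trans (u.trans d))) =
      (((Equiv.Perm.sign c : ℤ) : ℚ) * ((Equiv.Perm.sign d : ℤ) : ℚ)) •
        realize vertexWedge (matchingTensor u) := by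
  rw [realize_apply, realize_apply, Finset.smul_sum]
  refine Fintype.sum_equiv (Equiv.arrowCongr d.symm (Equiv.refl _)) _ _ fun l => ?_
  have h1 : (Equiv.arrowCongr d.symm (Equiv.refl _)) l = l ∘ d := rfl
  rw [h1, vertexWedge_comp l d hd, smul_smul, smul_smul]
  congr 1
  have h2 : (c.trans (u.trans d) : Fin k × Fin 2 → Fin n × Fin 3) = (d ∘ u) ∘ c := rfl
  have h3 : ((Equiv.Perm.sign d : ℤ) : ℚ) * ((Equiv.Perm.sign d : ℤ) : ℚ) = 1 := by
    rw [← Int.cast_mul, Int.units_coe_mul_self, Int.cast_one]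
  rw [h2, matchingTensor_comp _ _ _ hc, matchingTensor_trans]
  linear_combination (-((Equiv.Perm.sign c : ℤ) : ℚ) * matchingTensor u (l ∘ d)) * h3

/-- The comparison sign and the realized tensor change by the same factor `sign c * sign d`, whose
square is `1`. This is why graphs need no orientation here. -/
theorem matchingValue_trans (h : n * 3 = k * 2) (u : Fin k × Fin 2 ≃ Fin n × Fin 3)
    (c : Equiv.Perm (Fin k × Fin 2)) (hc : ∀ p q, (c p).1 = (c q).1 ↔ p.1 = q.1)
    (d : Equiv.Perm (Fin n × Fin 3)) (hd : ∀ p q, (d p).1 = (d q).1 ↔ p.1 = q.1) :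
    matchingValue g h (c.trans (u.trans d)) = matchingValue g h u := by
  rw [matchingValue, matchingValue, realize_matchingTensor_trans u c hc d hd, matchingSign_trans,
    smul_smul]
  congr 1
  have hs : ∀ s : ℤˣ, ((s : ℤ) : ℚ) * ((s : ℤ) : ℚ) = 1 := fun s => by
    rw [← Int.cast_mul, Int.units_coe_mul_self, Int.cast_one]
  linear_combination (matchingSign h u * ((Equiv.Perm.sign c : ℤ) : ℚ) *
    ((Equiv.Perm.sign c : ℤ) : ℚ)) * hs (Equiv.Perm.sign d) +
    matchingSign h u * hs (Equiv.Perm.sign c)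

theorem matchingValue_mem_invariants (h : n * 3 = k * 2) (u : Fin k × Fin 2 ≃ Fin n × Fin 3) :
    matchingValue g h u ∈ invariants ℚ (sp g) (LambdaH g) := by
  refine Subalgebra.smul_mem _ (fun X => ?_) _
  rw [(isEquivariant_vertexWedge n).lie_realize, isInvariant_matchingTensor u X, map_zero]

theorem realize_vertexWedge_mem (t : (Fin n × Fin 3 → Fin g ⊕ Fin g) → ℚ) :
    realize vertexWedge t ∈ ⋀[ℚ]^n (⋀[ℚ]^3 (H g)) :=
  Submodule.sum_mem _ fun l _ => Submodule.smul_mem _ _ (vertexWedge_mem l)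

theorem matchingValue_mem (h : n * 3 = k * 2) (u : Fin k × Fin 2 ≃ Fin n × Fin 3) :
    matchingValue g h u ∈ ⋀[ℚ]^n (⋀[ℚ]^3 (H g)) :=
  Submodule.smul_mem _ _ (realize_vertexWedge_mem _)

theorem matchingValue_zero (h : 0 * 3 = 0 * 2) (u : Fin 0 × Fin 2 ≃ Fin 0 × Fin 3) :
    matchingValue g h u = 1 := by
  have h1 : (positionEquiv h).trans u = 1 := Subsingleton.elim _ _
  have h2 : ∀ l : Fin 0 × Fin 3 → Fin g ⊕ Fin g, vertexWedge l = 1 := fun l =>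
    ExteriorAlgebra.ιMulti_zero_apply _
  rw [matchingValue, matchingSign, h1, Equiv.Perm.sign_one, realize_apply, Fintype.sum_unique, h2,
    matchingTensor, Fin.prod_univ_zero]
  simp

end Matchings

/-! ### Framings of trivalent graphs -/

namespace TrivalentGraph

theorem exists_vert_eq (Γ : TrivalentGraph) (v : Γ.Vert) : ∃ f, Γ.vert f = v := by
  have : Nat.card {f : Γ.Flag // Γ.vert f = v} ≠ 0 := by rw [Γ.card_flags]; norm_num
  obtain ⟨f⟩ := (Nat.card_ne_zero.1 this).1
  exact ⟨f.1, f.2⟩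

/-- A bijection of flags that respects edges and vertices comes from an isomorphism. -/
theorem nonempty_iso {Γ Δ : TrivalentGraph} (φ : Γ.Flag ≃ Δ.Flag)
    (hv : ∀ f f', Δ.vert (φ f) = Δ.vert (φ f') ↔ Γ.vert f = Γ.vert f')
    (ho : ∀ f, Δ.opp (φ f) = φ (Γ.opp f)) : Nonempty (Iso Γ Δ) := by
  choose s hs using Γ.exists_vert_eq
  have hbij : Function.Bijective fun v => Δ.vert (φ (s v)) := by
    refine ⟨fun v v' h => ?_, fun w => ?_⟩
    · rw [← hs v, ← hs v']
      exact (hv _ _).1 h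
    · obtain ⟨f, rfl⟩ := Δ.exists_vert_eq w
      refine ⟨Γ.vert (φ.symm f), ?_⟩
      conv_rhs => rw [← φ.apply_symm_apply f]
      exact (hv _ _).2 (hs _)
  exact ⟨⟨Equiv.ofBijective _ hbij, φ, fun f => (hv _ _).2 (hs _).symm, ho⟩⟩

/-- A listing of the flags of a trivalent graph by vertices and by edges. -/
structure Framing (Γ : TrivalentGraph) where
  n : ℕ
  k : ℕ
  card_eq : n * 3 = k * 2
  byVertex : Fin n × Fin 3 ≃ Γ.Flag
  byEdge : Fin k × Fin 2 ≃ Γ.Flag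
  vert_eq_iff : ∀ p q, Γ.vert (byVertex p) = Γ.vert (byVertex q) ↔ p.1 = q.1
  opp_byEdge : ∀ i, Γ.opp (byEdge (i, 0)) = byEdge (i, 1)

namespace Framing

variable {Γ Δ : TrivalentGraph}

theorem opp_byEdge_one (A : Γ.Framing) (i : Fin A.k) :
    Γ.opp (A.byEdge (i, 1)) = A.byEdge (i, 0) := by
  rw [← A.opp_byEdge, Γ.opp_opp]

theorem opp_byEdge' (A : Γ.Framing) (i : Fin A.k) (j : Fin 2) :
    Γ.opp (A.byEdge (i, j)) = A.byEdge (i, j + 1) := by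
  fin_cases j
  · exact A.opp_byEdge i
  · exact A.opp_byEdge_one i

theorem fst_eq_iff (A : Γ.Framing) (p q : Fin A.k × Fin 2) :
    p.1 = q.1 ↔ A.byEdge p = A.byEdge q ∨ A.byEdge p = Γ.opp (A.byEdge q) := by
  obtain ⟨i, j⟩ := p
  obtain ⟨i', j'⟩ := q
  rw [A.opp_byEdge', A.byEdge.injective.eq_iff, A.byEdge.injective.eq_iff, Prod.mk.injEq,
    Prod.mk.injEq, ← and_or_left]
  have : j = j' ∨ j = j' + 1 := by revert j j'; decide
  simp [this]

theorem n_eq_card (A : Γ.Framing) : A.n = Nat.card Γ.Vert := by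
  have : Function.Bijective fun i => Γ.vert (A.byVertex (i, 0)) := by
    refine ⟨fun i i' h => (A.vert_eq_iff _ _).1 h, fun v => ?_⟩
    obtain ⟨f, rfl⟩ := Γ.exists_vert_eq v
    obtain ⟨p, rfl⟩ := A.byVertex.surjective f
    exact ⟨p.1, (A.vert_eq_iff _ _).2 rfl⟩
  rw [← Nat.card_eq_of_bijective _ this, Nat.card_fin]

/-- The relation `n * 3 = k * 2` forces `n` to be even, so the halving in `degree` loses nothing. -/
theorem n_eq (A : Γ.Framing) : A.n = 2 * Γ.degree := by
  have h := A.n_eq_card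
  have h' := A.card_eq
  rw [degree, ← h]
  omega

theorem k_eq (A : Γ.Framing) : A.k = 3 * Γ.degree := by
  have h := A.n_eq
  have h' := A.card_eq
  omega

/-- The listing of the flags by edges in terms of the listing by vertices. -/
def matching (A : Γ.Framing) : Fin A.k × Fin 2 ≃ Fin A.n × Fin 3 :=
  A.byEdge.trans A.byVertex.symm

/-- The invariant of `Λ Λ³H` attached to a framed trivalent graph. -/
def value (g : ℕ) (A : Γ.Framing) : LambdaH g := matchingValue g A.card_eq A.matching

/-- The invariant does not depend on the framing. -/
theorem value_eq (g : ℕ) (A B : Γ.Framing) : A.value g = B.value g := by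
  have hn := A.n_eq.trans B.n_eq.symm
  have hk := A.k_eq.trans B.k_eq.symm
  have hA := A.fst_eq_iff
  have hB := B.fst_eq_iff
  obtain ⟨n, k, h, v, e, hv, he⟩ := A
  obtain ⟨n', k', h', v', e', hv', he'⟩ := B
  dsimp only at hn hk hA hB
  subst hn hk
  -- Two framings differ by a permutation of edge positions that preserves edges and one of vertex
  -- positions that preserves vertices.
  have := matchingValue_trans (g := g) h (e.trans v.symm) (e'.trans e.symm)
    (fun p q => by rw [hA]; simp [hB]) (v.trans v'.symm)
    (fun p q => by rw [← hv', ← hv p q]; simp)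
  change matchingValue g h (e.trans v.symm) = matchingValue g h (e'.trans v'.symm)
  rw [← this]
  congr 1
  ext1 p
  simp

/-- The transport of a framing along an isomorphism. -/
def map (φ : Iso Γ Δ) (A : Γ.Framing) : Δ.Framing where
  n := A.n
  k := A.k
  card_eq := A.card_eq
  byVertex := A.byVertex.trans φ.onFlag
  byEdge := A.byEdge.trans φ.onFlag
  vert_eq_iff p q := by simp [φ.vert_comm, A.vert_eq_iff]
  opp_byEdge i := by simp [φ.opp_comm, A.opp_byEdge]

theorem value_map (g : ℕ) (φ : Iso Γ Δ) (A : Γ.Framing) : (A.map φ).value g = A.value g := by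
  change matchingValue g A.card_eq _ = matchingValue g A.card_eq _
  congr 1
  ext1 p
  change A.byVertex.symm (φ.onFlag.symm (φ.onFlag (A.byEdge p))) = _
  rw [Equiv.symm_apply_apply]
  rfl

/-- A framing of the empty graph. -/
def empty : TrivalentGraph.empty.Framing where
  n := 0
  k := 0
  card_eq := rfl
  byVertex := Equiv.equivOfIsEmpty (Fin 0 × Fin 3) Empty
  byEdge := Equiv.equivOfIsEmpty (Fin 0 × Fin 2) Empty
  vert_eq_iff p := p.1.elim0
  opp_byEdge i := i.elim0

theorem value_empty (g : ℕ) : Framing.empty.value g = 1 :=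
  matchingValue_zero rfl Framing.empty.matching

end Framing

end TrivalentGraph

/-! ### Existence of framings, and the value of a graph -/

namespace TrivalentGraph

/-- Flags can be listed by vertices, with prescribed values at some of the vertices. -/
theorem exists_byVertex (Γ : TrivalentGraph) {n : ℕ} (hn : Nat.card Γ.Vert = n)
    (S : Finset (Fin n)) (b : Fin n → Fin 3 → Γ.Flag)
    (hinj : ∀ i ∈ S, Function.Injective (b i))
    (hvert : ∀ i ∈ S, ∀ j, Γ.vert (b i j) = Γ.vert (b i 0))
    (hS : ∀ i ∈ S, ∀ i' ∈ S, Γ.vert (b i 0) = Γ.vert (b i' 0) → i = i') :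
    ∃ v : Fin n × Fin 3 ≃ Γ.Flag, (∀ p q, Γ.vert (v p) = Γ.vert (v q) ↔ p.1 = q.1) ∧
      ∀ i ∈ S, ∀ j, v (i, j) = b i j := by
  classical
  -- The prescribed vertices extend to a numbering of all vertices; at a vertex in `S` the three
  -- prescribed flags are all its flags, by counting.
  obtain ⟨w, hw⟩ := Finset.exists_equiv_extend_of_card_eq (α := Fin n)
    (t := (Finset.univ : Finset Γ.Vert)) (by rw [Finset.card_univ, Fintype.card_fin, ← hn,
      Nat.card_eq_fintype_card]) (s := S) (f := fun i => Γ.vert (b i 0)) (Finset.subset_univ _)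
    (fun i hi i' hi' h => hS i hi i' hi' h)
  have he : ∀ i, ∃ e : Fin 3 ≃ {f : Γ.Flag // Γ.vert f = w i},
      i ∈ S → ∀ j, (e j).1 = b i j := by
    intro i
    have hc := Γ.card_flags (w i)
    by_cases hi : i ∈ S
    · have hmem : ∀ j, Γ.vert (b i j) = w i := fun j => by rw [hvert i hi, hw i hi]
      have hinj' : Function.Injective fun j =>
          (⟨b i j, hmem j⟩ : {f : Γ.Flag // Γ.vert f = w i}) := fun j j' h =>
        hinj i hi (congrArg Subtype.val h)
      refine ⟨Equiv.ofBijective _ ((Fintype.bijective_iff_injective_and_card _).2 ⟨hinj', ?_⟩),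
        fun _ j => rfl⟩
      rw [Fintype.card_fin, ← hc, Nat.card_eq_fintype_card]
    · exact ⟨(Finite.equivFinOfCardEq hc).symm, fun h => absurd h hi⟩
  choose e he using he
  have hve : ∀ i j, Γ.vert (e i j).1 = w i := fun i j => (e i j).2
  have hwinj : ∀ i i', (w i).1 = (w i').1 ↔ i = i' := fun i i' => by
    rw [Subtype.coe_inj, w.injective.eq_iff]
  have hbij : Function.Bijective fun p : Fin n × Fin 3 => (e p.1 p.2).1 := by
    refine ⟨?_, fun f => ?_⟩
    · rintro ⟨i, j⟩ ⟨i', j'⟩ h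
      obtain rfl : i = i' := by
        rw [← hwinj, ← hve i j, ← hve i' j']
        exact congrArg Γ.vert h
      exact Prod.ext rfl ((e i).injective (Subtype.ext h))
    · obtain ⟨i, hi⟩ := w.surjective ⟨Γ.vert f, Finset.mem_univ _⟩
      obtain ⟨j, hj⟩ := (e i).surjective ⟨f, by rw [hi]⟩
      exact ⟨(i, j), congrArg Subtype.val hj⟩
  refine ⟨Equiv.ofBijective _ hbij, fun p q => ?_, fun i hi j => he i hi j⟩
  rw [← hwinj, ← hve p.1 p.2, ← hve q.1 q.2]
  rfl

instance (Γ : TrivalentGraph) : Nonempty Γ.Framing := by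
  obtain ⟨b⟩ : Nonempty (Fin (Nat.card Γ.Vert) → Fin 3 → Γ.Flag) := by
    choose s _ using Γ.exists_vert_eq
    exact ⟨fun i _ => s ((Finite.equivFin Γ.Vert).symm i)⟩
  obtain ⟨v, hv, -⟩ := Γ.exists_byVertex rfl ∅ b (by simp) (by simp) (by simp)
  obtain ⟨k, e, he⟩ := exists_equiv_of_involution Γ.opp Γ.opp_opp Γ.opp_ne
  have h := Fintype.card_congr (v.trans e.symm)
  simp only [Fintype.card_prod, Fintype.card_fin] at h
  exact ⟨⟨_, k, h, v, e, hv, fun i => (he i).symm⟩⟩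

/-- The invariant of `Λ Λ³H` attached to a trivalent graph. -/
def value (g : ℕ) (Γ : TrivalentGraph) : LambdaH g := (Classical.arbitrary Γ.Framing).value g

theorem value_eq_framing (g : ℕ) {Γ : TrivalentGraph} (A : Γ.Framing) : Γ.value g = A.value g :=
  Framing.value_eq g _ _

theorem value_congr (g : ℕ) {Γ Δ : TrivalentGraph} (φ : Iso Γ Δ) : Γ.value g = Δ.value g := by
  rw [value_eq_framing g ((Classical.arbitrary Γ.Framing).map φ), Framing.value_map]
  rfl

theorem value_mem_invariants (g : ℕ) (Γ : TrivalentGraph) :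
    Γ.value g ∈ invariants ℚ (sp g) (LambdaH g) := matchingValue_mem_invariants _ _

theorem value_mem (g : ℕ) (Γ : TrivalentGraph) :
    Γ.value g ∈ ⋀[ℚ]^(2 * Γ.degree) (⋀[ℚ]^3 (H g)) := by
  rw [← (Classical.arbitrary Γ.Framing).n_eq]
  exact matchingValue_mem _ _

theorem value_empty (g : ℕ) : TrivalentGraph.empty.value g = 1 := by
  rw [value_eq_framing g Framing.empty, Framing.value_empty]

/-! ### Total orderings -/

namespace TotalOrdering

variable {Γ : TrivalentGraph} (τ : Γ.TotalOrdering)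

/-- Counting flags gives `3m` edges. Without an ordering of the edges, admissibility would be an
empty condition. -/
theorem nonempty_edge_ordering : Nonempty (Fin (3 * Γ.degree) ≃ τ.pos) := by
  obtain ⟨A⟩ := (inferInstance : Nonempty Γ.Framing)
  have h := Fintype.card_congr (A.byEdge.trans τ.byEdge.symm)
  simp only [Fintype.card_prod, Fintype.card_fin, A.k_eq] at h
  exact ⟨(Fintype.equivFinOfCardEq (by omega)).symm⟩

/-- The listing of the flags by edges for a given ordering of the edges. -/
def edgeListing (ε : Fin (3 * Γ.degree) ≃ τ.pos) : Fin (3 * Γ.degree) × Fin 2 ≃ Γ.Flag :=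
  (Equiv.prodCongr ε (Equiv.refl _)).trans τ.byEdge

theorem edgeListing_zero (ε : Fin (3 * Γ.degree) ≃ τ.pos) (i : Fin (3 * Γ.degree)) :
    τ.edgeListing ε (i, 0) = (ε i).1 := rfl

theorem edgeListing_one (ε : Fin (3 * Γ.degree) ≃ τ.pos) (i : Fin (3 * Γ.degree)) :
    τ.edgeListing ε (i, 1) = Γ.opp (ε i).1 := rfl

/-- The framing that consists of a total ordering and an ordering of the edges. -/
def framing (ε : Fin (3 * Γ.degree) ≃ τ.pos) : Γ.Framing where
  n := 2 * Γ.degree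
  k := 3 * Γ.degree
  card_eq := by omega
  byVertex := τ.byVertex
  byEdge := τ.edgeListing ε
  vert_eq_iff := by
    rintro ⟨i, j⟩ ⟨i', j'⟩
    rw [byVertex_apply, byVertex_apply, flag, flag, (τ.flagAt _ j).2, (τ.flagAt _ j').2]
    exact τ.vertex.injective.eq_iff
  opp_byEdge _ := rfl

/-- After numbering the positions, `comparison` is the inverse of the permutation that defines
`matchingSign`; neither inversion nor conjugation affects the sign. -/
theorem matchingSign_edgeListing (h : 2 * Γ.degree * 3 = 3 * Γ.degree * 2)
    (ε : Fin (3 * Γ.degree) ≃ τ.pos) :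
    matchingSign h ((τ.edgeListing ε).trans τ.byVertex.symm) =
      ((Equiv.Perm.sign (τ.comparison ε) : ℤ) : ℚ) := by
  have h1 : τ.comparison ε = (finProdFinEquiv.symm.trans (Equiv.symm ((positionEquiv h).trans
      ((τ.edgeListing ε).trans τ.byVertex.symm)))).trans finProdFinEquiv := by
    ext1 p
    exact (finProdFinEquiv.apply_symm_apply _).symm
  rw [matchingSign, h1, Equiv.Perm.sign_symm_trans_trans, Equiv.Perm.sign_symm]

/-- Labelings of flags are words, through `byVertex`. Along an edge with dual labels the pairing is
the sign of the label of the positive flag; if some edge has labels that are not dual, the matching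
tensor vanishes. -/
theorem alpha_eq (g : ℕ) (ε : Fin (3 * Γ.degree) ≃ τ.pos) :
    τ.alpha g =
      realize vertexWedge (matchingTensor ((τ.edgeListing ε).trans τ.byVertex.symm)) := by
  classical
  rw [alpha, Finset.sum_filter, realize_apply]
  refine Fintype.sum_equiv (Equiv.arrowCongr τ.byVertex.symm (Equiv.refl _)) _ _ fun l => ?_
  have h1 : (Equiv.arrowCongr τ.byVertex.symm (Equiv.refl _)) l = l ∘ τ.byVertex := rfl
  have h2 : matchingTensor ((τ.edgeListing ε).trans τ.byVertex.symm) (l ∘ τ.byVertex) =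
      matchingTensor (τ.edgeListing ε) l := by
    simp only [matchingTensor, Equiv.trans_apply, Function.comp_apply, Equiv.apply_symm_apply]
  have h3 : ExteriorAlgebra.ιMulti ℚ (2 * Γ.degree) (fun k =>
      wedge₃ (basisVec (l (τ.flag k 0)) : H g) (basisVec (l (τ.flag k 1)))
        (basisVec (l (τ.flag k 2)))) = vertexWedge (l ∘ τ.byVertex) := by
    rw [vertexWedge]
    congr 1
  rw [h1, h2, h3]
  by_cases hl : ∀ f, l (Γ.opp f) = (l f).swap
  · rw [if_pos hl, matchingTensor, ← Finset.prod_coe_sort, ← Equiv.prod_comp ε]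
    congr 1
    refine Finset.prod_congr rfl fun i _ => ?_
    rw [edgeListing_zero, edgeListing_one, hl, pairing, if_pos rfl]
  · rw [if_neg hl]
    have : matchingTensor (τ.edgeListing ε) l = 0 := by
      by_contra hne
      rw [← ne_eq, matchingTensor_ne_zero] at hne
      refine hl fun f => ?_
      obtain ⟨⟨i, j⟩, rfl⟩ := (τ.edgeListing ε).surjective f
      fin_cases j
      · exact hne i
      · change l (Γ.opp (Γ.opp _)) = (l (τ.edgeListing ε (i, 1))).swap
        rw [Γ.opp_opp, hne, Sum.swap_swap]
        rfl
    rw [this, zero_smul]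

theorem IsAdmissible.value_eq (g : ℕ) (hτ : τ.IsAdmissible) : Γ.value g = τ.alpha g := by
  obtain ⟨ε⟩ := τ.nonempty_edge_ordering
  rw [value_eq_framing g (τ.framing ε)]
  change matchingValue g (τ.framing ε).card_eq ((τ.edgeListing ε).trans τ.byVertex.symm) = _
  have h : matchingSign (τ.framing ε).card_eq ((τ.edgeListing ε).trans τ.byVertex.symm) = 1 :=
    (τ.matchingSign_edgeListing _ ε).trans (by rw [hτ]; simp)
  exact (congrArg₂ HSMul.hSMul h (τ.alpha_eq g ε).symm).trans (one_smul ℚ _)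

end TotalOrdering

end TrivalentGraph

/-! ### Disjoint unions -/

section DisjointUnion

/-- The decomposition of the positions of a list of `m + n` blocks. -/
def positionSum (J : Type*) (m n : ℕ) : Fin (m + n) × J ≃ (Fin m × J) ⊕ (Fin n × J) :=
  (Equiv.prodCongr finSumFinEquiv.symm (Equiv.refl J)).trans (Equiv.sumProdDistrib _ _ _)

theorem positionSum_symm_inr {J : Type*} {m n : ℕ} (p : Fin n × J) :
    (positionSum J m n).symm (Sum.inr p) = (Fin.natAdd m p.1, p.2) := rfl

theorem positionSum_castAdd {J : Type*} {m n : ℕ} (i : Fin m) (j : J) :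
    positionSum J m n (Fin.castAdd n i, j) = Sum.inl (i, j) :=
  (positionSum J m n).apply_symm_apply (Sum.inl (i, j))

theorem positionSum_natAdd {J : Type*} {m n : ℕ} (i : Fin n) (j : J) :
    positionSum J m n (Fin.natAdd m i, j) = Sum.inr (i, j) :=
  (positionSum J m n).apply_symm_apply (Sum.inr (i, j))

theorem positionEquiv_val {n k : ℕ} (h : n * 3 = k * 2) (p : Fin n × Fin 3) :
    ((positionEquiv h p).2 : ℕ) + 2 * (positionEquiv h p).1 = p.2 + 3 * p.1 := by
  have : finProdFinEquiv (positionEquiv h p) = finCongr h (finProdFinEquiv p) :=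
    finProdFinEquiv.apply_symm_apply _
  exact congrArg Fin.val this

theorem positionEquiv_eq {n k : ℕ} (h : n * 3 = k * 2) (p : Fin n × Fin 3) (q : Fin k × Fin 2)
    (hpq : (q.2 : ℕ) + 2 * q.1 = p.2 + 3 * p.1) : positionEquiv h p = q := by
  refine finProdFinEquiv.injective (Fin.ext ?_)
  have h1 := positionEquiv_val h p
  change ((positionEquiv h p).2 : ℕ) + 2 * (positionEquiv h p).1 = (q.2 : ℕ) + 2 * q.1
  omega

variable {g m n i k : ℕ}

/-- The disjoint union of two matchings. -/
def matchingSum (u : Fin i × Fin 2 ≃ Fin m × Fin 3) (v : Fin k × Fin 2 ≃ Fin n × Fin 3) :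
    Fin (i + k) × Fin 2 ≃ Fin (m + n) × Fin 3 :=
  (positionSum _ i k).trans ((Equiv.sumCongr u v).trans (positionSum _ m n).symm)

/-- The first `m` vertices and the first `i` edges fill the same `3m = 2i` places, so the comparison
permutation of the union is a block sum. -/
theorem matchingSign_matchingSum (h : m * 3 = i * 2) (h' : n * 3 = k * 2)
    (h'' : (m + n) * 3 = (i + k) * 2)
    (u : Fin i × Fin 2 ≃ Fin m × Fin 3) (v : Fin k × Fin 2 ≃ Fin n × Fin 3) :
    matchingSign h'' (matchingSum u v) = matchingSign h u * matchingSign h' v := by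
  have key : (positionEquiv h'').trans (matchingSum u v) =
      ((positionSum (Fin 3) m n).symm.symm.trans (Equiv.sumCongr ((positionEquiv h).trans u)
        ((positionEquiv h').trans v))).trans (positionSum (Fin 3) m n).symm := by
    ext1 p
    obtain ⟨q, rfl⟩ := (positionSum (Fin 3) m n).symm.surjective p
    rcases q with q | q
    · have := positionEquiv_eq h'' ((positionSum (Fin 3) m n).symm (Sum.inl q))
        ((positionSum (Fin 2) i k).symm (Sum.inl (positionEquiv h q)))
        (positionEquiv_val h q)
      rw [Equiv.trans_apply, this]
      simp only [matchingSum, Equiv.trans_apply, Equiv.apply_symm_apply, Equiv.symm_symm,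
        Equiv.sumCongr_apply, Sum.map_inl]
    · have := positionEquiv_eq h'' ((positionSum (Fin 3) m n).symm (Sum.inr q))
        ((positionSum (Fin 2) i k).symm (Sum.inr (positionEquiv h' q)))
        (by
          have := positionEquiv_val h' q
          simp only [positionSum_symm_inr, Fin.val_natAdd]
          omega)
      rw [Equiv.trans_apply, this]
      simp only [matchingSum, Equiv.trans_apply, Equiv.apply_symm_apply, Equiv.symm_symm,
        Equiv.sumCongr_apply, Sum.map_inr]
  rw [matchingSign, key, Equiv.Perm.sign_symm_trans_trans, Equiv.Perm.sign_sumCongr, matchingSign,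
    matchingSign]
  push_cast
  rfl

theorem vertexWedge_positionSum (l : Fin m × Fin 3 → Fin g ⊕ Fin g)
    (l' : Fin n × Fin 3 → Fin g ⊕ Fin g) :
    vertexWedge (Sum.elim l l' ∘ positionSum (Fin 3) m n) = vertexWedge l * vertexWedge l' := by
  rw [vertexWedge, vertexWedge, vertexWedge, ExteriorAlgebra.ιMulti_mul_ιMulti]
  congr 1
  funext j
  refine Fin.addCases (fun j => ?_) (fun j => ?_) j
  · simp [positionSum]
  · simp [positionSum]

theorem matchingTensor_matchingSum (u : Fin i × Fin 2 ≃ Fin m × Fin 3)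
    (v : Fin k × Fin 2 ≃ Fin n × Fin 3) (l : Fin m × Fin 3 → Fin g ⊕ Fin g)
    (l' : Fin n × Fin 3 → Fin g ⊕ Fin g) :
    matchingTensor (matchingSum u v) (Sum.elim l l' ∘ positionSum (Fin 3) m n) =
      matchingTensor u l * matchingTensor v l' := by
  rw [matchingTensor, Fin.prod_univ_add, matchingTensor, matchingTensor]
  congr 1 <;> refine Finset.prod_congr rfl fun j _ => ?_ <;> simp [matchingSum, positionSum]

theorem matchingValue_matchingSum (h : m * 3 = i * 2) (h' : n * 3 = k * 2)
    (h'' : (m + n) * 3 = (i + k) * 2)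
    (u : Fin i × Fin 2 ≃ Fin m × Fin 3) (v : Fin k × Fin 2 ≃ Fin n × Fin 3) :
    matchingValue g h'' (matchingSum u v) = matchingValue g h u * matchingValue g h' v := by
  rw [matchingValue, matchingValue, matchingValue, matchingSign_matchingSum h h', smul_mul_smul_comm]
  congr 1
  rw [realize_apply, realize_apply, realize_apply, Finset.sum_mul_sum, ← Fintype.sum_prod_type']
  refine (Fintype.sum_equiv ((Equiv.sumArrowEquivProdArrow _ _ _).symm.trans
    (Equiv.arrowCongr (positionSum (Fin 3) m n).symm (Equiv.refl _))) _ _ ?_).symm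
  rintro ⟨l, l'⟩
  change _ = matchingTensor (matchingSum u v) (Sum.elim l l' ∘ positionSum (Fin 3) m n) •
    vertexWedge (Sum.elim l l' ∘ positionSum (Fin 3) m n)
  rw [matchingTensor_matchingSum, vertexWedge_positionSum, smul_mul_smul_comm]

namespace TrivalentGraph

/-- The framing of a disjoint union. -/
def Framing.disjUnion {Γ Δ : TrivalentGraph} (A : Γ.Framing) (B : Δ.Framing) :
    (Γ.disjUnion Δ).Framing where
  n := A.n + B.n
  k := A.k + B.k
  card_eq := by rw [add_mul, A.card_eq, B.card_eq, add_mul]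
  byVertex := (positionSum _ _ _).trans (Equiv.sumCongr A.byVertex B.byVertex)
  byEdge := (positionSum _ _ _).trans (Equiv.sumCongr A.byEdge B.byEdge)
  vert_eq_iff := by
    rintro ⟨i, j⟩ ⟨i', j'⟩
    change Sum.map Γ.vert Δ.vert (Sum.map A.byVertex B.byVertex (positionSum _ _ _ _)) =
      Sum.map Γ.vert Δ.vert (Sum.map A.byVertex B.byVertex (positionSum _ _ _ _)) ↔ i = i'
    refine Fin.addCases (fun i => ?_) (fun i => ?_) i <;>
      refine Fin.addCases (fun i' => ?_) (fun i' => ?_) i' <;>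
        simp only [positionSum_castAdd, positionSum_natAdd, Sum.map_inl, Sum.map_inr,
          Sum.inl.injEq, Sum.inr.injEq, A.vert_eq_iff, B.vert_eq_iff, Fin.ext_iff,
          Fin.val_castAdd, Fin.val_natAdd, reduceCtorEq, false_iff] <;> omega
  opp_byEdge j := by
    change Sum.map Γ.opp Δ.opp (Sum.map A.byEdge B.byEdge (positionSum _ _ _ _)) =
      Sum.map A.byEdge B.byEdge (positionSum _ _ _ _)
    refine Fin.addCases (fun j => ?_) (fun j => ?_) j <;>
      simp only [positionSum_castAdd, positionSum_natAdd, Sum.map_inl, Sum.map_inr, A.opp_byEdge,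
        B.opp_byEdge]

theorem value_disjUnion (g : ℕ) (Γ Δ : TrivalentGraph) :
    (Γ.disjUnion Δ).value g = Γ.value g * Δ.value g := by
  obtain ⟨A⟩ := (inferInstance : Nonempty Γ.Framing)
  obtain ⟨B⟩ := (inferInstance : Nonempty Δ.Framing)
  rw [value_eq_framing g A, value_eq_framing g B, value_eq_framing g (A.disjUnion B)]
  refine Eq.trans ?_ (matchingValue_matchingSum A.card_eq B.card_eq (A.disjUnion B).card_eq
    A.matching B.matching)
  change matchingValue g _ _ = matchingValue g _ _
  congr 1
  ext1 p
  obtain ⟨p, rfl⟩ := (positionSum (Fin 2) A.k B.k).symm.surjective p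
  change (positionSum _ _ _).symm ((Equiv.sumCongr A.byVertex B.byVertex).symm
    ((Equiv.sumCongr A.byEdge B.byEdge) (positionSum _ _ _ _))) =
      (positionSum _ _ _).symm ((Equiv.sumCongr A.matching B.matching) (positionSum _ _ _ _))
  rw [Equiv.apply_symm_apply]
  rcases p with p | p <;> rfl

end TrivalentGraph

end DisjointUnion

/-! ### The homomorphism from the graph algebra to the invariants -/

section Hom

open TrivalentSymplectic.TrivalentGraph

/-- The invariant of `Λ Λ³H` attached to an isomorphism class of trivalent graphs. -/
def GraphClass.value (g : ℕ) (x : GraphClass) : invariants ℚ (sp g) (LambdaH g) :=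
  Quotient.lift (fun Γ : TrivalentGraph => (⟨Γ.value g, Γ.value_mem_invariants g⟩ :
    invariants ℚ (sp g) (LambdaH g))) (fun _ _ h => Subtype.ext (Nonempty.elim h (value_congr g))) x

/-- The invariant of trivalent graphs is multiplicative. -/
def GraphClass.valueHom (g : ℕ) : GraphClass →* invariants ℚ (sp g) (LambdaH g) where
  toFun := GraphClass.value g
  map_one' := Subtype.ext (value_empty g)
  map_mul' := by
    rintro ⟨Γ⟩ ⟨Δ⟩
    exact Subtype.ext (value_disjUnion g Γ Δ)

/-- The homomorphism from `C(φ)` to the invariants of `Λ Λ³H`. -/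
def graphHom (g : ℕ) : GraphAlgebra →ₐ[ℚ] invariants ℚ (sp g) (LambdaH g) :=
  MonoidAlgebra.lift ℚ (invariants ℚ (sp g) (LambdaH g)) GraphClass (GraphClass.valueHom g)

theorem graphHom_graph (g : ℕ) (Γ : TrivalentGraph) :
    (graphHom g (graph Γ) : LambdaH g) = Γ.value g :=
  congrArg Subtype.val (MonoidAlgebra.lift_of (GraphClass.valueHom g) (Quotient.mk _ Γ))

theorem graphHom_mem {g m : ℕ} {z : GraphAlgebra} (hz : z ∈ graphDegree m) :
    (graphHom g z : LambdaH g) ∈ ⋀[ℚ]^(2 * m) (⋀[ℚ]^3 (H g)) := by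
  induction hz using Submodule.span_induction with
  | mem z hz =>
    obtain ⟨Γ, rfl, rfl⟩ := hz
    rw [graphHom_graph]
    exact Γ.value_mem g
  | zero => rw [map_zero]; exact Submodule.zero_mem _
  | add x y _ _ hx hy => rw [map_add]; exact Submodule.add_mem _ hx hy
  | smul r x _ hx => rw [map_smul]; exact Submodule.smul_mem _ _ hx

end Hom

/-! ### Linear independence of graph invariants in the stable range -/

section Injectivity

open TrivalentSymplectic.TrivalentGraph

variable {g n k : ℕ}

theorem standardWord_swap (hk : k ≤ g) (i : Fin k) (j : Fin 2) :
    (standardWord (g := g) hk (i, j)).swap = standardWord hk (i, j + 1) := by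
  fin_cases j <;> simp [standardWord]

/-- The word whose coefficient detects the matching `u`. -/
def detectingWord (hk : k ≤ g) (u : Fin k × Fin 2 ≃ Fin n × Fin 3) :
    Fin n × Fin 3 → Fin g ⊕ Fin g := standardWord hk ∘ u.symm

theorem detectingWord_injective (hk : k ≤ g) (u : Fin k × Fin 2 ≃ Fin n × Fin 3) :
    Function.Injective (detectingWord hk u) :=
  (standardWord_injective hk).comp u.symm.injective

theorem vertexCoefficient_realize (l : Fin n × Fin 3 → Fin g ⊕ Fin g)
    (t : (Fin n × Fin 3 → Fin g ⊕ Fin g) → ℚ) :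
    vertexCoefficient l (realize vertexWedge t) =
      ∑ w, t w * vertexCoefficient l (vertexWedge w) := by
  rw [realize_apply, map_sum]
  exact Finset.sum_congr rfl fun w _ => by rw [map_smul, smul_eq_mul]

/-- The conjugate permutation of edge positions attached to a permutation of vertex positions that
carries one matching to another one. -/
theorem exists_conj_of_ne_zero (hk : k ≤ g) (u v : Fin k × Fin 2 ≃ Fin n × Fin 3)
    (d : Equiv.Perm (Fin n × Fin 3)) (h : matchingTensor v (detectingWord hk u ∘ d) ≠ 0)
    (i : Fin k) : u.symm (d (v (i, 1))) =
      ((u.symm (d (v (i, 0)))).1, (u.symm (d (v (i, 0)))).2 + 1) := by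
  rw [matchingTensor_ne_zero] at h
  refine standardWord_injective hk ?_
  rw [← standardWord_swap]
  exact h i

/-- There is no cancellation. A word that contributes is `detectingWord hk u ∘ d` with `d`
preserving the vertices and conjugate through `u` to a permutation `c` preserving the edges. The
wedge gives `sign d` and the matching tensor gives `sign c = sign d`, so each nonzero contribution
is `1`. -/
theorem vertexCoefficient_pos (hk : k ≤ g) (u : Fin k × Fin 2 ≃ Fin n × Fin 3) :
    0 < vertexCoefficient (detectingWord hk u) (realize vertexWedge (matchingTensor u)) := by
  have hone : ∀ w : Fin n × Fin 3 → Fin g ⊕ Fin g,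
      matchingTensor u w * vertexCoefficient (detectingWord hk u) (vertexWedge w) ≠ 0 →
      matchingTensor u w * vertexCoefficient (detectingWord hk u) (vertexWedge w) = 1 := by
    intro w hw
    obtain ⟨d, hd, rfl⟩ := exists_wreath_of_vertexCoefficient_ne_zero (right_ne_zero_of_mul hw)
    have h1 := exists_conj_of_ne_zero hk u u d (left_ne_zero_of_mul hw)
    rw [vertexWedge_comp _ d hd, map_smul, vertexCoefficient_self (detectingWord_injective hk u)]
    let c : Equiv.Perm (Fin k × Fin 2) := (u.trans d).trans u.symm
    have hc : ∀ p q, (c p).1 = (c q).1 ↔ p.1 = q.1 := by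
      refine fst_eq_iff_of_fst_eq c fun i j j' => ?_
      have h2 : (c (i, 1)).1 = (c (i, 0)).1 := by
        have h2 := h1 i
        exact (Prod.ext_iff.1 h2).1
      fin_cases j <;> fin_cases j'
      · rfl
      · exact h2.symm
      · exact h2
      · rfl
    have h3 : matchingTensor u (detectingWord hk u ∘ d) =
        matchingTensor (_root_.id ∘ c) (standardWord (g := g) hk) := rfl
    have h4 : matchingTensor _root_.id (standardWord (g := g) hk) = 1 := by
      refine Finset.prod_eq_one fun i _ => ?_
      exact (if_pos (standardWord_one hk i)).trans (indexSign_standardWord hk i)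
    have h5 : Equiv.Perm.sign c = Equiv.Perm.sign d := Equiv.Perm.sign_trans_trans_symm d u
    rw [h3, matchingTensor_comp _ _ c hc, h4, h5, smul_eq_mul, mul_one, ← Int.cast_mul,
      Int.units_coe_mul_self, Int.cast_one]
  rw [vertexCoefficient_realize]
  refine Finset.sum_pos' (fun w _ => ?_) ⟨detectingWord hk u, Finset.mem_univ _, ?_⟩
  · by_cases hw : matchingTensor u w * vertexCoefficient (detectingWord hk u) (vertexWedge w) = 0
    · exact hw.ge
    · exact (hone w hw).symm ▸ zero_le_one
  · rw [hone _ (mul_ne_zero ?_ ?_)]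
    · exact zero_lt_one
    · rw [matchingTensor_ne_zero]
      intro i
      simp [detectingWord, standardWord_one]
    · rw [vertexCoefficient_self (detectingWord_injective hk u)]
      exact one_ne_zero

theorem exists_perm_of_vertexCoefficient_ne_zero (hk : k ≤ g)
    (u v : Fin k × Fin 2 ≃ Fin n × Fin 3)
    (h : vertexCoefficient (detectingWord hk u) (realize vertexWedge (matchingTensor v)) ≠ 0) :
    ∃ d : Equiv.Perm (Fin n × Fin 3), (∀ p q, (d p).1 = (d q).1 ↔ p.1 = q.1) ∧
      ∀ i, u.symm (d (v (i, 1))) = ((u.symm (d (v (i, 0)))).1, (u.symm (d (v (i, 0)))).2 + 1) := by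
  rw [vertexCoefficient_realize] at h
  obtain ⟨w, -, hw⟩ := Finset.exists_ne_zero_of_sum_ne_zero h
  obtain ⟨d, hd, rfl⟩ := exists_wreath_of_vertexCoefficient_ne_zero (right_ne_zero_of_mul hw)
  exact ⟨d, hd, exists_conj_of_ne_zero hk u v d (left_ne_zero_of_mul hw)⟩

/-- In the stable range, there is a linear form that detects a given trivalent graph. -/
theorem TrivalentGraph.exists_detecting (Γ : TrivalentGraph) (hg : 3 * Γ.degree ≤ g) :
    ∃ φ : LambdaH g →ₗ[ℚ] ℚ, φ (Γ.value g) ≠ 0 ∧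
      ∀ Δ : TrivalentGraph, Δ.degree = Γ.degree → φ (Δ.value g) ≠ 0 → Nonempty (Iso Δ Γ) := by
  obtain ⟨A⟩ := (inferInstance : Nonempty Γ.Framing)
  have hk : A.k ≤ g := A.k_eq.trans_le hg
  refine ⟨vertexCoefficient (detectingWord hk A.matching), ?_, fun Δ hΔ h => ?_⟩
  · rw [value_eq_framing g A, Framing.value, matchingValue, map_smul, smul_eq_mul]
    refine mul_ne_zero (fun h0 => ?_) (vertexCoefficient_pos hk A.matching).ne'
    have := matchingSign_mul_self A.card_eq A.matching
    rw [h0, zero_mul] at this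
    exact zero_ne_one this
  · obtain ⟨B⟩ := (inferInstance : Nonempty Δ.Framing)
    have hn : B.n = A.n := B.n_eq.trans ((congrArg (2 * ·) hΔ).trans A.n_eq.symm)
    have hk' : B.k = A.k := B.k_eq.trans ((congrArg (3 * ·) hΔ).trans A.k_eq.symm)
    rw [value_eq_framing g B] at h
    have hA := A.opp_byEdge'
    have hAv := A.vert_eq_iff
    have hB := B.opp_byEdge
    have hBv := B.vert_eq_iff
    obtain ⟨n, k, hc, v, e, _, _⟩ := A
    obtain ⟨n', k', hc', v', e', _, _⟩ := B
    dsimp only at hn hk' hA hAv hB hBv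
    subst hn
    subst hk'
    change vertexCoefficient (detectingWord hk (e.trans v.symm))
      (matchingValue g hc' (e'.trans v'.symm)) ≠ 0 at h
    rw [matchingValue, map_smul, smul_eq_mul] at h
    obtain ⟨d, hd, hde⟩ := exists_perm_of_vertexCoefficient_ne_zero hk _ _ (right_ne_zero_of_mul h)
    -- The permutation `d` preserves vertices and carries the matching of `Δ` to that of `Γ`, so it
    -- becomes an isomorphism on flags.
    let φ : Δ.Flag ≃ Γ.Flag := (v'.symm.trans d).trans v
    have h0 : ∀ i, Γ.opp (φ (e' (i, 0))) = φ (e' (i, 1)) := by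
      intro i
      have h1 := hde i
      simp only [Equiv.symm_trans_apply, Equiv.trans_apply, Equiv.symm_symm] at h1
      have h2 := congrArg e h1
      rw [e.apply_symm_apply, ← hA, Prod.mk.eta, e.apply_symm_apply] at h2
      exact h2.symm
    refine nonempty_iso φ (fun f f' => ?_) fun f => ?_
    · change Γ.vert (v (d (v'.symm f))) = Γ.vert (v (d (v'.symm f'))) ↔ _
      rw [hAv, hd, ← hBv, v'.apply_symm_apply, v'.apply_symm_apply]
    · obtain ⟨⟨i, j⟩, rfl⟩ := e'.surjective f
      fin_cases j
      · change Γ.opp (φ (e' (i, 0))) = φ (Δ.opp (e' (i, 0)))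
        rw [h0, hB]
      · change Γ.opp (φ (e' (i, 1))) = φ (Δ.opp (e' (i, 1)))
        rw [← h0, ← hB, Γ.opp_opp, Δ.opp_opp]

theorem TrivalentGraph.degree_congr {Γ Δ : TrivalentGraph} (φ : Iso Γ Δ) : Γ.degree = Δ.degree := by
  rw [degree, degree, Nat.card_congr φ.onVert]

/-- The isomorphism class of a trivalent graph. -/
def GraphClass.mk (Γ : TrivalentGraph) : GraphClass := Quotient.mk _ Γ

/-- In the stable range, trivalent graphs have linearly independent invariants. -/
theorem graphHom_injOn {m : ℕ} (hm : 3 * m ≤ g) {z : GraphAlgebra} (hz : z ∈ graphDegree m)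
    (h0 : graphHom g z = 0) : z = 0 := by
  classical
  have hcoeff : ∀ Γ Δ : TrivalentGraph,
      (graph Δ).coeff (GraphClass.mk Γ) = if Nonempty (Iso Δ Γ) then 1 else 0 := by
    intro Γ Δ
    change (MonoidAlgebra.single (GraphClass.mk Δ) (1 : ℚ)).coeff (GraphClass.mk Γ) = _
    rw [MonoidAlgebra.coeff_single, Finsupp.single_apply]
    exact if_congr Quotient.eq rfl rfl
  refine MonoidAlgebra.ext (Finsupp.ext fun x => ?_)
  obtain ⟨Γ, rfl⟩ := Quotient.exists_rep x
  change z.coeff (GraphClass.mk Γ) = (0 : ℚ)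
  by_cases hΓ : Γ.degree = m
  · subst hΓ
    obtain ⟨φ, hφ, hiso⟩ := Γ.exists_detecting hm
    -- Among the classes of this degree, `φ` sees only that of `Γ`.
    have key : φ (graphHom g z) = z.coeff (GraphClass.mk Γ) * φ (Γ.value g) := by
      clear h0
      induction hz using Submodule.span_induction with
      | mem z hz =>
        obtain ⟨Δ, hΔ, rfl⟩ := hz
        rw [graphHom_graph, hcoeff]
        by_cases hi : Nonempty (Iso Δ Γ)
        · rw [if_pos hi, one_mul, value_congr g hi.some]
        · rw [if_neg hi, zero_mul]
          by_contra hne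
          exact hi (hiso Δ hΔ hne)
      | zero => simp
      | add x y _ _ hx hy =>
        simp only [map_add, Subalgebra.coe_add, hx, hy, MonoidAlgebra.coeff_add, Finsupp.add_apply]
        ring
      | smul r x _ hx =>
        simp only [map_smul, Subalgebra.coe_smul, hx, MonoidAlgebra.coeff_smul, Finsupp.smul_apply,
          smul_eq_mul]
        ring
    rw [h0, Subalgebra.coe_zero, map_zero] at key
    exact (mul_eq_zero.1 key.symm).resolve_right hφ
  · clear h0
    induction hz using Submodule.span_induction with
    | mem z hz =>
      obtain ⟨Δ, hΔ, rfl⟩ := hz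
      rw [hcoeff, if_neg]
      rintro ⟨φ⟩
      exact hΓ ((degree_congr φ).symm.trans hΔ)
    | zero => rfl
    | add x y _ _ hx hy => rw [MonoidAlgebra.coeff_add, Finsupp.add_apply, hx, hy, add_zero]
    | smul r x _ hx => rw [MonoidAlgebra.coeff_smul, Finsupp.smul_apply, hx, smul_zero]

end Injectivity

/-! ### Contracting one edge of a matching -/

section ExposedEdge

variable {g n k : ℕ} {ι F : Type*}

/-- The list of edges that starts with the edge `(inl 0, inl 1)` and goes on with `e`. -/
def consEdge (e : Fin k × Fin 2 ≃ ι) : Fin (k + 1) × Fin 2 ≃ Fin 2 ⊕ ι where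
  toFun p := Fin.cases (Sum.inl p.2) (fun i => Sum.inr (e (i, p.2))) p.1
  invFun := Sum.elim (fun j => (0, j)) fun x => ((e.symm x).1.succ, (e.symm x).2)
  left_inv := by
    rintro ⟨i, j⟩
    refine Fin.cases ?_ (fun i => ?_) i
    · rfl
    · simp
  right_inv := by
    rintro (j | x)
    · rfl
    · simp

theorem consEdge_succ (e : Fin k × Fin 2 ≃ ι) (i : Fin k) (j : Fin 2) :
    consEdge e (i.succ, j) = Sum.inr (e (i, j)) := rfl

theorem matchingTensor_consEdge (e : Fin k × Fin 2 ≃ ι) (s : Fin 2 → Fin g ⊕ Fin g)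
    (m : ι → Fin g ⊕ Fin g) :
    matchingTensor (consEdge e) (Sum.elim s m) = pairing (s 0) (s 1) * matchingTensor e m := by
  rw [matchingTensor, Fin.prod_univ_succ]
  rfl

theorem sum_pairing_smul {V : Type*} [AddCommGroup V] [Module ℚ V]
    (f : (Fin 2 → Fin g ⊕ Fin g) → V) :
    ∑ s, pairing (s 0) (s 1) • f s = ∑ a, indexSign a • f ![a, a.swap] := by
  rw [← (finTwoArrowEquiv (Fin g ⊕ Fin g)).symm.sum_comp, Fintype.sum_prod_type]
  refine Finset.sum_congr rfl fun a _ => ?_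
  rw [Finset.sum_eq_single a.swap]
  · simp [pairing, finTwoArrowEquiv]
  · intro b _ hb
    simp [pairing, finTwoArrowEquiv, hb]
  · simp

variable [Fintype ι] [DecidableEq ι] [Fintype F] [DecidableEq F]

/-- The contraction of the first edge in the evaluation of a matching. -/
theorem realize_consEdge {V : Type*} [AddCommGroup V] [Module ℚ V]
    (f : (F → Fin g ⊕ Fin g) → V) (e : Fin k × Fin 2 ≃ ι) (ρ : Fin 2 ⊕ ι ≃ F) :
    realize f (matchingTensor ((consEdge e).trans ρ)) =
      realize (fun m => ∑ a, indexSign a • f (Sum.elim ![a, a.swap] m ∘ ρ.symm))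
        (matchingTensor e) := by
  rw [realize_apply, realize_apply]
  have h1 : ∑ l, matchingTensor ((consEdge e).trans ρ) l • f l =
      ∑ x : (Fin 2 → Fin g ⊕ Fin g) × (ι → Fin g ⊕ Fin g),
        (pairing (x.1 0) (x.1 1) * matchingTensor e x.2) • f (Sum.elim x.1 x.2 ∘ ρ.symm) := by
    refine (Fintype.sum_equiv ((Equiv.sumArrowEquivProdArrow _ _ _).symm.trans
      (Equiv.arrowCongr ρ (Equiv.refl _))) _ _ ?_).symm
    rintro ⟨s, m⟩
    change _ = matchingTensor ((consEdge e).trans ρ) (Sum.elim s m ∘ ρ.symm) •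
      f (Sum.elim s m ∘ ρ.symm)
    rw [← matchingTensor_consEdge]
    congr 1
    simp only [matchingTensor, Equiv.trans_apply, Function.comp_apply, Equiv.symm_apply_apply]
  rw [h1, Fintype.sum_prod_type_right]
  refine Finset.sum_congr rfl fun m _ => ?_
  rw [← sum_pairing_smul fun s => f (Sum.elim s m ∘ ρ.symm), Finset.smul_sum]
  exact Finset.sum_congr rfl fun s _ => by rw [smul_smul, mul_comm]

theorem realize_matchingTensor_perm {V : Type*} [AddCommGroup V] [Module ℚ V]
    (f : (F → Fin g ⊕ Fin g) → V) (u : Fin k × Fin 2 ≃ F) (d : Equiv.Perm F) :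
    realize f (matchingTensor (u.trans d)) =
      realize (fun l => f (l ∘ d.symm)) (matchingTensor u) := by
  rw [realize_apply, realize_apply]
  refine Fintype.sum_equiv (Equiv.arrowCongr d.symm (Equiv.refl _)) _ _ fun l => ?_
  change _ = matchingTensor u (l ∘ d) • f ((l ∘ d) ∘ d.symm)
  rw [Function.comp_assoc, Equiv.self_comp_symm, Function.comp_id]
  rfl

end ExposedEdge

/-! ### Words near an edge and near a loop -/

section VertexWedge

variable {g n : ℕ}

theorem vertexWedge_succ (l : Fin (n + 1) × Fin 3 → Fin g ⊕ Fin g) :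
    vertexWedge l = ExteriorAlgebra.ι ℚ (wedge₃ (basisVec (l (0, 0))) (basisVec (l (0, 1)))
      (basisVec (l (0, 2)))) * vertexWedge fun p : Fin n × Fin 3 => l (p.1.succ, p.2) := by
  rw [vertexWedge, ExteriorAlgebra.ιMulti_succ_apply]
  congr 2

/-- The positions at two vertices joined by an edge: first the two flags of this edge, then the
four other flags at the two vertices, then the flags at the other vertices. -/
def edgePositions (n : ℕ) : Fin 2 ⊕ (Fin 4 ⊕ Fin n × Fin 3) ≃ Fin (n + 2) × Fin 3 :=
  Equiv.ofBijective (Sum.elim ![(0, 2), (1, 2)] (Sum.elim ![(0, 0), (0, 1), (1, 0), (1, 1)]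
    fun p => (p.1.succ.succ, p.2))) <| by
    refine (Fintype.bijective_iff_surjective_and_card _).2 ⟨?_, by simp; ring⟩
    rintro ⟨i, j⟩
    refine Fin.cases ?_ (fun i => Fin.cases ?_ (fun i => ?_) i) i
    · fin_cases j
      exacts [⟨Sum.inr (Sum.inl 0), rfl⟩, ⟨Sum.inr (Sum.inl 1), rfl⟩, ⟨Sum.inl 0, rfl⟩]
    · fin_cases j
      exacts [⟨Sum.inr (Sum.inl 2), rfl⟩, ⟨Sum.inr (Sum.inl 3), rfl⟩, ⟨Sum.inl 1, rfl⟩]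
    · exact ⟨Sum.inr (Sum.inr (i, j)), rfl⟩

/-- The positions at a vertex with a loop: first the two flags of this loop, then the other flag at
the vertex, then the flags at the other vertices. -/
def loopPositions (n : ℕ) : Fin 2 ⊕ (Unit ⊕ Fin n × Fin 3) ≃ Fin (n + 1) × Fin 3 :=
  Equiv.ofBijective (Sum.elim ![(0, 1), (0, 2)] (Sum.elim (fun _ => (0, 0))
    fun p => (p.1.succ, p.2))) <| by
    refine (Fintype.bijective_iff_surjective_and_card _).2 ⟨?_, by simp; ring⟩
    rintro ⟨i, j⟩
    refine Fin.cases ?_ (fun i => ?_) i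
    · fin_cases j
      exacts [⟨Sum.inr (Sum.inl ()), rfl⟩, ⟨Sum.inl 0, rfl⟩, ⟨Sum.inl 1, rfl⟩]
    · exact ⟨Sum.inr (Sum.inr (i, j)), rfl⟩

theorem edgeSum_eq_sum (p q r s : H g) :
    edgeSum p q r s = ∑ a : Fin g ⊕ Fin g, indexSign a •
      (ExteriorAlgebra.ι ℚ (wedge₃ p q (basisVec a)) *
        ExteriorAlgebra.ι ℚ (wedge₃ r s (basisVec a.swap))) := by
  rw [Fintype.sum_sum_type, edgeSum, Finset.sum_sub_distrib]
  simp [indexSign, sub_eq_add_neg]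

theorem wedge₃_swap₁₂ {M : Type*} [AddCommGroup M] [Module ℚ M] (u v w : M) :
    wedge₃ v u w = - wedge₃ u v w := by
  refine Subtype.ext ?_
  simp only [coe_wedge₃, Submodule.coe_neg]
  rw [← mul_assoc, ← mul_assoc, ← neg_mul,
    eq_neg_of_add_eq_zero_left (ExteriorAlgebra.ι_add_mul_swap v u)]

theorem edgeSum_swap₃₄ (p q r s : H g) : edgeSum p q s r = - edgeSum p q r s := by
  simp only [edgeSum, wedge₃_swap₁₂ r s, map_neg, mul_neg]
  rw [← Finset.sum_neg_distrib]
  exact Finset.sum_congr rfl fun _ _ => by abel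

/-- The family of products of a basic tensor of the image of `f_{a,b,c}` and of a word of
`Λ Λ³H`. -/
def relationFamily (g n : ℕ) (a b c : ℚ) (m : Fin 4 ⊕ Fin n × Fin 3 → Fin g ⊕ Fin g) : LambdaH g :=
  (a • fI g + b • fH g + c • fX g) (fun j => basisVec (m (Sum.inl j))) * vertexWedge (m ∘ Sum.inr)

/-- The family of products of a basic element of `H ∧ ω` and of a word of `Λ Λ³H`. -/
def loopFamily (g n : ℕ) (m : Unit ⊕ Fin n × Fin 3 → Fin g ⊕ Fin g) : LambdaH g :=
  ExteriorAlgebra.ι ℚ (∑ i, wedge₃ (basisVec (m (Sum.inl ()))) (xVec i) (yVec i)) *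
    vertexWedge (m ∘ Sum.inr)

/-- The word on the positions at two vertices joined by an edge. -/
theorem sum_vertexWedge_edgePositions (m : Fin 4 ⊕ Fin n × Fin 3 → Fin g ⊕ Fin g)
    (d : Equiv.Perm (Fin (n + 2) × Fin 3)) (t : Fin 4 → Fin 4)
    (h2 : d (0, 2) = (0, 2)) (h2' : d (1, 2) = (1, 2))
    (h : ∀ p : Fin n × Fin 3, d (p.1.succ.succ, p.2) = (p.1.succ.succ, p.2))
    (ht : ∀ j, d (edgePositions n (Sum.inr (Sum.inl j))) =
      edgePositions n (Sum.inr (Sum.inl (t j)))) :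
    ∑ a, indexSign a • vertexWedge ((Sum.elim ![a, a.swap] m ∘ (edgePositions n).symm) ∘ d) =
      fI g (fun j => basisVec (m (Sum.inl (t j)))) * vertexWedge (m ∘ Sum.inr) := by
  rw [fI_apply, edgeSum_eq_sum, Finset.sum_mul]
  refine Finset.sum_congr rfl fun a _ => ?_
  rw [smul_mul_assoc, vertexWedge_succ, vertexWedge_succ, mul_assoc]
  have e0 : (0, 2) = edgePositions n (Sum.inl 0) := rfl
  have e1 : (1, 2) = edgePositions n (Sum.inl 1) := rfl
  have er : ∀ p : Fin n × Fin 3, (p.1.succ.succ, p.2) = edgePositions n (Sum.inr (Sum.inr p)) :=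
    fun _ => rfl
  have k0 : d (0, 0) = edgePositions n (Sum.inr (Sum.inl (t 0))) := ht 0
  have k1 : d (0, 1) = edgePositions n (Sum.inr (Sum.inl (t 1))) := ht 1
  have k2 : d (1, 0) = edgePositions n (Sum.inr (Sum.inl (t 2))) := ht 2
  have k3 : d (1, 1) = edgePositions n (Sum.inr (Sum.inl (t 3))) := ht 3
  have kr : (fun p : Fin n × Fin 3 => ((Sum.elim ![a, a.swap] m ∘ (edgePositions n).symm) ∘ d)
      (p.1.succ.succ, p.2)) = m ∘ Sum.inr := by
    funext p
    change Sum.elim ![a, a.swap] m ((edgePositions n).symm (d (p.1.succ.succ, p.2))) = _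
    rw [h p, er p, Equiv.symm_apply_apply]
    rfl
  simp only [Fin.succ_zero_eq_one]
  rw [kr]
  simp only [Function.comp_apply, h2, h2', k0, k1, k2, k3]
  simp only [e0, e1, Equiv.symm_apply_apply, Sum.elim_inl, Sum.elim_inr]
  rfl

/-- The two swaps produce `edgeSum` with legs `1, 3, 2, 4` and `1, 4, 3, 2`, whereas `f_H` and `f_X`
have the last two legs exchanged; this accounts for the minus signs. In `value_relation` they are
supplied by the sign of a transposition. -/
theorem sum_vertexWedge_relation (a b c : ℚ) (m : Fin 4 ⊕ Fin n × Fin 3 → Fin g ⊕ Fin g) :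
    ∑ s, indexSign s • ((fun l : Fin (n + 2) × Fin 3 → Fin g ⊕ Fin g => a • vertexWedge l -
        b • vertexWedge (l ∘ Equiv.swap (0, 1) (1, 0)) -
        c • vertexWedge (l ∘ Equiv.swap (0, 1) (1, 1)))
      (Sum.elim ![s, s.swap] m ∘ (edgePositions n).symm)) = relationFamily g n a b c m := by
  have hI := sum_vertexWedge_edgePositions m 1 _root_.id rfl rfl (fun _ => rfl) fun _ => rfl
  have hH := sum_vertexWedge_edgePositions m (Equiv.swap (0, 1) (1, 0)) ![0, 2, 1, 3]
    (Equiv.swap_apply_of_ne_of_ne (by simp) (by simp))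
    (Equiv.swap_apply_of_ne_of_ne (by simp) (by simp))
    (fun p => Equiv.swap_apply_of_ne_of_ne (by simp) fun h => by
      have := congrArg (fun q : Fin (n + 2) × Fin 3 => (q.1 : ℕ)) h
      simp at this)
    (fun j => by
      fin_cases j
      · exact Equiv.swap_apply_of_ne_of_ne (by simp [edgePositions]) (by simp [edgePositions])
      · exact Equiv.swap_apply_left _ _
      · exact Equiv.swap_apply_right _ _
      · exact Equiv.swap_apply_of_ne_of_ne (by simp [edgePositions]) (by simp [edgePositions]))
  have hX := sum_vertexWedge_edgePositions m (Equiv.swap (0, 1) (1, 1)) ![0, 3, 2, 1]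
    (Equiv.swap_apply_of_ne_of_ne (by simp) (by simp))
    (Equiv.swap_apply_of_ne_of_ne (by simp) (by simp))
    (fun p => Equiv.swap_apply_of_ne_of_ne (by simp) fun h => by
      have := congrArg (fun q : Fin (n + 2) × Fin 3 => (q.1 : ℕ)) h
      simp at this)
    (fun j => by
      fin_cases j
      · exact Equiv.swap_apply_of_ne_of_ne (by simp [edgePositions]) (by simp [edgePositions])
      · exact Equiv.swap_apply_left _ _
      · exact Equiv.swap_apply_of_ne_of_ne (by simp [edgePositions]) (by simp [edgePositions])
      · exact Equiv.swap_apply_right _ _)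
  simp only [smul_sub, Finset.sum_sub_distrib, smul_comm _ a, smul_comm _ b, smul_comm _ c,
    ← Finset.smul_sum]
  rw [hH, hX]
  rw [show ∑ s, indexSign s • vertexWedge (Sum.elim ![s, s.swap] m ∘ (edgePositions n).symm) = _
    from hI]
  rw [relationFamily, add_apply, add_apply, smul_apply, smul_apply, smul_apply, fI_apply, fI_apply,
    fI_apply, fH_apply, fX_apply, add_mul, add_mul, smul_mul_assoc, smul_mul_assoc, smul_mul_assoc]
  have key : ∀ (p q r s : H g) (z : LambdaH g) (x : ℚ),
      -(x • (edgeSum p q s r * z)) = x • (edgeSum p q r s * z) := fun p q r s z x => by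
    rw [edgeSum_swap₃₄, neg_mul, smul_neg, neg_neg]
  rw [sub_eq_add_neg, sub_eq_add_neg, key, key]
  rfl

/-- The letters `x_i` and `y_i` give equal terms, since the wedge and `indexSign` both change sign;
hence the factor `2`. -/
theorem sum_vertexWedge_loop (m : Unit ⊕ Fin n × Fin 3 → Fin g ⊕ Fin g) :
    ∑ a, indexSign a • vertexWedge (Sum.elim ![a, a.swap] m ∘ (loopPositions n).symm) =
      (2 : ℚ) • loopFamily g n m := by
  have key : ∀ a, vertexWedge (Sum.elim ![a, a.swap] m ∘ (loopPositions n).symm) =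
      ExteriorAlgebra.ι ℚ (wedge₃ (basisVec (m (Sum.inl ()))) (basisVec a) (basisVec a.swap)) *
        vertexWedge (m ∘ Sum.inr) := by
    intro a
    have e0 : (0, 1) = loopPositions n (Sum.inl 0) := rfl
    have e1 : (0, 2) = loopPositions n (Sum.inl 1) := rfl
    have e2 : (0, 0) = loopPositions n (Sum.inr (Sum.inl ())) := rfl
    have er : ∀ p : Fin n × Fin 3, (p.1.succ, p.2) = loopPositions n (Sum.inr (Sum.inr p)) :=
      fun _ => rfl
    rw [vertexWedge_succ]
    simp only [Function.comp_apply, er]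
    simp only [e0, e1, e2, Equiv.symm_apply_apply, Sum.elim_inl, Sum.elim_inr]
    rfl
  simp only [key, loopFamily]
  rw [Fintype.sum_sum_type]
  simp only [indexSign, Sum.elim_inl, Sum.elim_inr, Sum.swap_inl, Sum.swap_inr, one_smul]
  rw [map_sum, Finset.sum_mul, two_smul]
  congr 1
  refine Finset.sum_congr rfl fun i _ => ?_
  rw [wedge₃_swap₂₃, map_neg, neg_mul, smul_neg, neg_smul, one_smul, neg_neg]

end VertexWedge

/-! ### Graph relations and loops expressed through words -/

namespace TrivalentGraph

variable {g n k : ℕ}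

theorem value_eq_matchingValue (g : ℕ) {Γ : TrivalentGraph} (h : n * 3 = k * 2)
    (u : Fin k × Fin 2 ≃ Fin n × Fin 3) (v : Fin n × Fin 3 ≃ Γ.Flag)
    (hv : ∀ p q, Γ.vert (v p) = Γ.vert (v q) ↔ p.1 = q.1)
    (ho : ∀ i, Γ.opp (v (u (i, 0))) = v (u (i, 1))) : Γ.value g = matchingValue g h u := by
  rw [value_eq_framing g (⟨n, k, h, v, u.trans v, hv, ho⟩ : Γ.Framing)]
  change matchingValue g h ((u.trans v).trans v.symm) = _
  rw [Equiv.trans_assoc, Equiv.self_trans_symm, Equiv.trans_refl]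

-- Listing the flags after the swap restores the incidence with vertices and turns the matching into
-- `u` followed by the swap. The comparison sign of this matching is opposite to that of `u`.
open Classical in
theorem value_reattach (g : ℕ) {Γ : TrivalentGraph} (h : n * 3 = k * 2)
    (u : Fin k × Fin 2 ≃ Fin n × Fin 3) (v : Fin n × Fin 3 ≃ Γ.Flag)
    (hv : ∀ p q, Γ.vert (v p) = Γ.vert (v q) ↔ p.1 = q.1)
    (ho : ∀ i, Γ.opp (v (u (i, 0))) = v (u (i, 1))) {x y : Fin n × Fin 3} (hxy : x ≠ y) :
    (Γ.reattach (Equiv.swap (v x) (v y))).value g = -(matchingSign h u •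
      realize (fun l => vertexWedge (l ∘ Equiv.swap x y)) (matchingTensor u)) := by
  have hσ : ∀ p, Equiv.swap (v x) (v y) (v (Equiv.swap x y p)) = v p := fun p => by
    rw [v.injective.map_swap, Equiv.swap_apply_self]
  have key := value_eq_matchingValue g (Γ := Γ.reattach (Equiv.swap (v x) (v y))) h
    (u.trans (Equiv.swap x y)) ((Equiv.swap x y).trans v)
    (fun p q => by
      change Γ.vert (Equiv.swap (v x) (v y) (v (Equiv.swap x y p))) =
        Γ.vert (Equiv.swap (v x) (v y) (v (Equiv.swap x y q))) ↔ _
      rw [hσ, hσ, hv])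
    (fun i => by
      change Γ.opp (v (Equiv.swap x y (Equiv.swap x y (u (i, 0))))) =
        v (Equiv.swap x y (Equiv.swap x y (u (i, 1))))
      rw [Equiv.swap_apply_self, Equiv.swap_apply_self, ho])
  have hs := matchingSign_trans h u (Equiv.refl _) (Equiv.swap x y)
  rw [Equiv.refl_trans, Equiv.Perm.sign_refl, Equiv.Perm.sign_swap hxy] at hs
  rw [key, matchingValue, hs, realize_matchingTensor_perm, Equiv.symm_swap]
  simp

/-- The flags that do not lie on a given edge can be listed by edges. -/
theorem exists_consEdge (Γ : TrivalentGraph) {ι : Type*} [Fintype ι] [DecidableEq ι]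
    (w : Fin 2 ⊕ ι ≃ Γ.Flag)
    (hw : Γ.opp (w (Sum.inl 0)) = w (Sum.inl 1)) :
    ∃ k, ∃ e : Fin k × Fin 2 ≃ ι,
      ∀ i, Γ.opp (w (consEdge e (i, 0))) = w (consEdge e (i, 1)) := by
  have h1 : ∀ x : ι, ∃ y, Γ.opp (w (Sum.inr x)) = w (Sum.inr y) := by
    intro x
    obtain ⟨z, hz⟩ := w.surjective (Γ.opp (w (Sum.inr x)))
    rcases z with j | y
    · have h2 : w (Sum.inr x) = Γ.opp (w (Sum.inl j)) := by rw [hz, Γ.opp_opp]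
      fin_cases j
      · exact absurd (w.injective (h2.trans hw)) Sum.inr_ne_inl
      · have h3 : Γ.opp (w (Sum.inl 1)) = w (Sum.inl 0) := by rw [← hw, Γ.opp_opp]
        exact absurd (w.injective (h2.trans h3)) Sum.inr_ne_inl
    · exact ⟨y, hz.symm⟩
  choose s hs using h1
  obtain ⟨k, e, he⟩ := exists_equiv_of_involution s
    (fun x => Sum.inr_injective (w.injective (by rw [← hs, ← hs, Γ.opp_opp])))
    (fun x h => Γ.opp_ne (w (Sum.inr x)) (by rw [hs, h]))
  refine ⟨k, e, fun i => Fin.cases hw (fun i => ?_) i⟩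
  rw [consEdge_succ, consEdge_succ, hs, he]

/-- The three graphs share the matching `e` of the flags off the middle edge. Contracting that edge
leaves the local identity `sum_vertexWedge_relation`. Legs may be matched to each other, since `e`
is arbitrary on the remaining positions. -/
theorem value_relation (g : ℕ) {Γ : TrivalentGraph} (E : Γ.IEmbedding)
    (h : (n + 2) * 3 = (k + 1) * 2) (v : Fin (n + 2) × Fin 3 ≃ Γ.Flag)
    (hv : ∀ p q, Γ.vert (v p) = Γ.vert (v q) ↔ p.1 = q.1)
    (h₂ : v (0, 1) = E.leg₂) (h₃ : v (1, 0) = E.leg₃) (h₄ : v (1, 1) = E.leg₄)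
    (e : Fin k × Fin 2 ≃ Fin 4 ⊕ Fin n × Fin 3)
    (he : ∀ i, Γ.opp (v (edgePositions n (consEdge e (i, 0)))) =
      v (edgePositions n (consEdge e (i, 1)))) (a b c : ℚ) :
    a • Γ.value g + b • (Γ.graphH E).value g + c • (Γ.graphX E).value g =
      matchingSign h ((consEdge e).trans (edgePositions n)) •
        realize (relationFamily g n a b c) (matchingTensor e) := by
  rw [graphH, graphX, ← h₂, ← h₃, ← h₄,
    value_eq_matchingValue g h ((consEdge e).trans (edgePositions n)) v hv he,
    value_reattach g h ((consEdge e).trans (edgePositions n)) v hv he (by simp),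
    value_reattach g h ((consEdge e).trans (edgePositions n)) v hv he (by simp), matchingValue]
  have h1 : realize (relationFamily g n a b c) (matchingTensor e) =
      realize (fun l : Fin (n + 2) × Fin 3 → Fin g ⊕ Fin g => a • vertexWedge l -
        b • vertexWedge (l ∘ Equiv.swap (0, 1) (1, 0)) -
        c • vertexWedge (l ∘ Equiv.swap (0, 1) (1, 1)))
          (matchingTensor ((consEdge e).trans (edgePositions n))) := by
    rw [realize_consEdge]
    congr 2
    funext m
    exact (sum_vertexWedge_relation a b c m).symm
  rw [h1]
  simp only [realize_apply, smul_sub, Finset.sum_sub_distrib, smul_comm _ a, smul_comm _ b,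
    smul_comm _ c, ← Finset.smul_sum, smul_neg]
  rw [sub_eq_add_neg, sub_eq_add_neg]

theorem value_loop (g : ℕ) {Γ : TrivalentGraph}
    (h : (n + 1) * 3 = (k + 1) * 2) (v : Fin (n + 1) × Fin 3 ≃ Γ.Flag)
    (hv : ∀ p q, Γ.vert (v p) = Γ.vert (v q) ↔ p.1 = q.1)
    (e : Fin k × Fin 2 ≃ Unit ⊕ Fin n × Fin 3)
    (he : ∀ i, Γ.opp (v (loopPositions n (consEdge e (i, 0)))) =
      v (loopPositions n (consEdge e (i, 1)))) :
    Γ.value g = (matchingSign h ((consEdge e).trans (loopPositions n)) * 2) •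
        realize (loopFamily g n) (matchingTensor e) := by
  rw [value_eq_matchingValue g h ((consEdge e).trans (loopPositions n)) v hv he, matchingValue,
    mul_smul, realize_consEdge]
  congr 1
  simp only [sum_vertexWedge_loop, realize_apply, Finset.smul_sum, smul_comm _ (2 : ℚ)]

theorem realize_mem_span {V F : Type*} [AddCommGroup V] [Module ℚ V] [Fintype F] [DecidableEq F]
    (f : (F → Fin g ⊕ Fin g) → V) (t : (F → Fin g ⊕ Fin g) → ℚ) :
    realize f t ∈ Submodule.span ℚ (Set.range f) := by
  rw [← range_realize]
  exact LinearMap.mem_range_self _ _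

/-- The relation attached to an embedding of the graph `I`. -/
theorem exists_mem_span_relationFamily (g : ℕ) {Γ : TrivalentGraph} (E : Γ.IEmbedding)
    (a b c : ℚ) : ∃ n, a • Γ.value g + b • (Γ.graphH E).value g + c • (Γ.graphX E).value g ∈
      Submodule.span ℚ (Set.range (relationFamily g n a b c)) := by
  obtain ⟨n, hn⟩ : ∃ n, Nat.card Γ.Vert = n + 2 := by
    have : Nontrivial Γ.Vert := ⟨_, _, E.vert_ne⟩
    exact Nat.exists_eq_add_of_le' Finite.one_lt_card
  -- The middle flags get index `2` at the vertices `0` and `1`, as `edgePositions` expects.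
  obtain ⟨v, hv, hb⟩ := Γ.exists_byVertex hn {0, 1}
    (fun i => if i = 0 then ![E.leg₁, E.leg₂, E.mid] else ![E.leg₃, E.leg₄, Γ.opp E.mid])
    (by
      intro i hi
      simp only [Finset.mem_insert, Finset.mem_singleton] at hi
      have h0 := E.leg₁_ne_leg₂
      have h1 := E.leg₁_ne_mid
      have h2 := E.leg₂_ne_mid
      have h3 := E.leg₃_ne_leg₄
      have h4 := E.leg₃_ne_opp
      have h5 := E.leg₄_ne_opp
      rcases hi with rfl | rfl
      · intro j j' h
        fin_cases j <;> fin_cases j' <;> simp_all [eq_comm]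
      · intro j j' h
        fin_cases j <;> fin_cases j' <;> simp_all [eq_comm])
    (by
      intro i hi j
      simp only [Finset.mem_insert, Finset.mem_singleton] at hi
      rcases hi with rfl | rfl
      · fin_cases j <;> simp [E.vert₁, E.vert₂]
      · fin_cases j <;> simp [E.vert₃, E.vert₄])
    (by
      intro i hi i' hi' h
      simp only [Finset.mem_insert, Finset.mem_singleton] at hi hi'
      rcases hi with rfl | rfl <;> rcases hi' with rfl | rfl
      · rfl
      · exact absurd (by simpa [E.vert₁, E.vert₃] using h) E.vert_ne
      · exact absurd (by simpa [E.vert₁, E.vert₃] using h.symm) E.vert_ne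
      · rfl)
  have b0 : ∀ j, v (0, j) = ![E.leg₁, E.leg₂, E.mid] j := fun j => by
    rw [hb 0 (by simp), if_pos rfl]
  have b1 : ∀ j, v (1, j) = ![E.leg₃, E.leg₄, Γ.opp E.mid] j := fun j => by
    rw [hb 1 (by simp), if_neg (by simp)]
  obtain ⟨k, e, he⟩ := Γ.exists_consEdge ((edgePositions n).trans v) (by
    change Γ.opp (v (0, 2)) = v (1, 2)
    rw [b0, b1]
    rfl)
  have h := Fintype.card_congr ((consEdge e).trans (edgePositions n))
  simp only [Fintype.card_prod, Fintype.card_fin] at h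
  refine ⟨n, ?_⟩
  rw [value_relation g E h.symm v hv (b0 1) (b1 0) (b1 1) e he]
  exact Submodule.smul_mem _ _ (realize_mem_span _ _)

theorem exists_mem_span_loopFamily (g : ℕ) {Γ : TrivalentGraph} (hΓ : Γ.HasLoop) :
    ∃ n, Γ.value g ∈ Submodule.span ℚ (Set.range (loopFamily g n)) := by
  obtain ⟨f, hf⟩ := hΓ
  -- The loop takes two of the three flags at its vertex; `l` is the third one, listed first to fit
  -- `loopPositions`.
  obtain ⟨l, hl, hlf, hlo⟩ : ∃ l, Γ.vert l = Γ.vert f ∧ l ≠ f ∧ l ≠ Γ.opp f := by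
    classical
    by_contra! hcon
    have h3 := Γ.card_flags (Γ.vert f)
    have : Nat.card {f' : Γ.Flag // Γ.vert f' = Γ.vert f} ≤ 2 := by
      rw [Nat.card_eq_fintype_card, Fintype.card_subtype]
      refine (Finset.card_le_card (t := {f, Γ.opp f}) fun l hl => ?_).trans Finset.card_le_two
      rw [Finset.mem_filter] at hl
      simp only [Finset.mem_insert, Finset.mem_singleton]
      by_cases h : l = f
      · exact Or.inl h
      · exact Or.inr (hcon l hl.2 h)
    omega
  obtain ⟨n, hn⟩ : ∃ n, Nat.card Γ.Vert = n + 1 := by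
    have : Nonempty Γ.Vert := ⟨Γ.vert f⟩
    exact Nat.exists_eq_add_of_le' Finite.card_pos
  obtain ⟨v, hv, hb⟩ := Γ.exists_byVertex hn {0} (fun _ => ![l, f, Γ.opp f])
    (by
      intro i _ j j' h
      have := Γ.opp_ne f
      fin_cases j <;> fin_cases j' <;> simp_all [eq_comm])
    (by
      intro i _ j
      fin_cases j <;> simp [hl, hf])
    (by simp)
  obtain ⟨k, e, he⟩ := Γ.exists_consEdge ((loopPositions n).trans v) (by
    change Γ.opp (v (0, 1)) = v (0, 2)
    rw [hb 0 (by simp), hb 0 (by simp)]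
    rfl)
  have h := Fintype.card_congr ((consEdge e).trans (loopPositions n))
  simp only [Fintype.card_prod, Fintype.card_fin] at h
  refine ⟨n, ?_⟩
  rw [value_loop g h.symm v hv e he]
  exact Submodule.smul_mem _ _ (realize_mem_span _ _)

/-- The trivalent graph attached to a matching of the flags of `n` vertices. -/
def ofMatching (u : Fin k × Fin 2 ≃ Fin n × Fin 3) : TrivalentGraph where
  Vert := Fin n
  Flag := Fin n × Fin 3
  vert := Prod.fst
  opp f := u ((u.symm f).1, (u.symm f).2 + 1)
  opp_opp f := by
    have : ∀ j : Fin 2, j + 1 + 1 = j := by decide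
    simp [this]
  opp_ne f h := by
    have : ∀ j : Fin 2, j + 1 ≠ j := by decide
    exact this _ (congrArg Prod.snd (u.eq_symm_apply.2 h))
  card_flags i := by
    refine (Nat.card_congr (β := Fin 3) ⟨fun f => f.1.2, fun j => ⟨(i, j), rfl⟩,
      fun ⟨⟨i', j⟩, h⟩ => Subtype.ext (Prod.ext h.symm rfl), fun j => rfl⟩).trans (Nat.card_fin 3)

theorem ofMatching_opp (u : Fin k × Fin 2 ≃ Fin n × Fin 3) (i : Fin k) :
    (ofMatching u).opp (u (i, 0)) = u (i, 1) := by
  change u ((u.symm (u (i, 0))).1, (u.symm (u (i, 0))).2 + 1) = u (i, 1)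
  rw [u.symm_apply_apply]
  rfl

theorem degree_ofMatching {m : ℕ} (hn : n = 2 * m) (u : Fin k × Fin 2 ≃ Fin n × Fin 3) :
    (ofMatching u).degree = m := by
  have : (ofMatching u).degree = Nat.card (Fin n) / 2 := rfl
  rw [this, Nat.card_fin, hn]
  omega

theorem value_ofMatching (g : ℕ) (h : n * 3 = k * 2) (u : Fin k × Fin 2 ≃ Fin n × Fin 3) :
    (ofMatching u).value g = matchingValue g h u :=
  value_eq_matchingValue g (Γ := ofMatching u) h u (Equiv.refl _) (fun _ _ => Iff.rfl)
    (ofMatching_opp u)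

/-- The embedding of the graph `I` given by an edge between the first two vertices. -/
def embeddingOfMatching (u : Fin k × Fin 2 ≃ Fin (n + 2) × Fin 3)
    (hu : (ofMatching u).opp ((0, 2) : Fin (n + 2) × Fin 3) = ((1, 2) : Fin (n + 2) × Fin 3)) :
    (ofMatching u).IEmbedding where
  mid := ((0, 2) : Fin (n + 2) × Fin 3)
  leg₁ := ((0, 0) : Fin (n + 2) × Fin 3)
  leg₂ := ((0, 1) : Fin (n + 2) × Fin 3)
  leg₃ := ((1, 0) : Fin (n + 2) × Fin 3)
  leg₄ := ((1, 1) : Fin (n + 2) × Fin 3)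
  vert_ne := by
    rw [hu]
    exact zero_ne_one (α := Fin (n + 2))
  vert₁ := rfl
  vert₂ := rfl
  vert₃ := by rw [hu]; rfl
  vert₄ := by rw [hu]; rfl
  leg₁_ne_mid h := absurd (congrArg (fun f : Fin (n + 2) × Fin 3 => f.2) h) (by simp)
  leg₂_ne_mid h := absurd (congrArg (fun f : Fin (n + 2) × Fin 3 => f.2) h) (by simp)
  leg₁_ne_leg₂ h := absurd (congrArg (fun f : Fin (n + 2) × Fin 3 => f.2) h) (by simp)
  leg₃_ne_opp h := absurd (congrArg (fun f : Fin (n + 2) × Fin 3 => f.2) (h.trans hu)) (by simp)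
  leg₄_ne_opp h := absurd (congrArg (fun f : Fin (n + 2) × Fin 3 => f.2) (h.trans hu)) (by simp)
  leg₃_ne_leg₄ h := absurd (congrArg (fun f : Fin (n + 2) × Fin 3 => f.2) h) (by simp)

theorem graph_mem_graphDegree {Γ : TrivalentGraph} {m : ℕ} (h : Γ.degree = m) :
    graph Γ ∈ graphDegree m := Submodule.subset_span ⟨Γ, h, rfl⟩

theorem exists_graph_of_matching {m : ℕ} (hn : n = 2 * m) (h : n * 3 = k * 2)
    (u : Fin k × Fin 2 ≃ Fin n × Fin 3) :
    ∃ r ∈ graphDegree m, (graphHom g r : LambdaH g) = realize vertexWedge (matchingTensor u) := by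
  refine ⟨matchingSign h u • graph (ofMatching u),
    Submodule.smul_mem _ _ (graph_mem_graphDegree (degree_ofMatching hn u)), ?_⟩
  rw [map_smul, Subalgebra.coe_smul, graphHom_graph, value_ofMatching g h, matchingValue, smul_smul,
    matchingSign_mul_self, one_smul]

/-- Inserting the middle edge into any matching of four legs and other flags yields a graph with an
embedding of `I`, so `value_relation` can be read backwards. -/
theorem exists_graph_of_relation {m : ℕ} (hn : n + 2 = 2 * m) (h : (n + 2) * 3 = (k + 1) * 2)
    (a b c : ℚ) (e : Fin k × Fin 2 ≃ Fin 4 ⊕ Fin n × Fin 3) :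
    ∃ r ∈ graphDegree m ⊓ (relationIdeal a b c).restrictScalars ℚ,
      (graphHom g r : LambdaH g) = realize (relationFamily g n a b c) (matchingTensor e) := by
  let u := (consEdge e).trans (edgePositions n)
  let E : (ofMatching u).IEmbedding := embeddingOfMatching u (ofMatching_opp u 0)
  have hd := degree_ofMatching hn u
  refine ⟨matchingSign h u • (a • graph (ofMatching u) + b • graph ((ofMatching u).graphH E) +
    c • graph ((ofMatching u).graphX E)), Submodule.smul_mem _ _ ⟨?_, ?_⟩, ?_⟩
  · exact add_mem (add_mem (Submodule.smul_mem _ _ (graph_mem_graphDegree hd))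
      (Submodule.smul_mem _ _ (graph_mem_graphDegree hd)))
      (Submodule.smul_mem _ _ (graph_mem_graphDegree hd))
  · exact Ideal.subset_span ⟨_, E, rfl⟩
  · have key := value_relation g E h (Equiv.refl _) (fun _ _ => Iff.rfl) rfl rfl rfl e
      (ofMatching_opp u) a b c
    simp only [map_smul, map_add, Subalgebra.coe_smul, Subalgebra.coe_add, graphHom_graph]
    rw [key, smul_smul, matchingSign_mul_self, one_smul]

theorem exists_graph_of_loop {m : ℕ} (hn : n + 1 = 2 * m) (h : (n + 1) * 3 = (k + 1) * 2)
    (e : Fin k × Fin 2 ≃ Unit ⊕ Fin n × Fin 3) :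
    ∃ r ∈ graphDegree m ⊓ loopIdeal.restrictScalars ℚ,
      (graphHom g r : LambdaH g) = realize (loopFamily g n) (matchingTensor e) := by
  let u := (consEdge e).trans (loopPositions n)
  -- The factor `2⁻¹` undoes the double count of `sum_vertexWedge_loop`, and the sign is its own
  -- inverse.
  refine ⟨(matchingSign h u * 2⁻¹) • graph (ofMatching u), Submodule.smul_mem _ _
    ⟨graph_mem_graphDegree (degree_ofMatching hn u), Ideal.subset_span ⟨_, ?_, rfl⟩⟩, ?_⟩
  · refine ⟨((0, 1) : Fin (n + 1) × Fin 3), ?_⟩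
    exact congrArg Prod.fst (ofMatching_opp u 0)
  · have key := value_loop g (Γ := ofMatching u) h (Equiv.refl _) (fun _ _ => Iff.rfl) e
      (ofMatching_opp u)
    rw [map_smul, Subalgebra.coe_smul, graphHom_graph, key, smul_smul,
      show matchingSign h u * 2⁻¹ * (matchingSign h u * 2) = 1 by
        linear_combination matchingSign_mul_self h u, one_smul]

end TrivalentGraph

/-! ### Ideals and kernels in exterior algebras -/

section ExteriorIdeals

variable {M : Type*} [AddCommGroup M] [Module ℚ M]

/-- Elements of degree two of an exterior algebra commute with those of degree one. -/
theorem commute_ι_of_mem_exteriorPower_two {t : ExteriorAlgebra ℚ M} (ht : t ∈ ⋀[ℚ]^2 M) (v : M) :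
    ExteriorAlgebra.ι ℚ v * t = t * ExteriorAlgebra.ι ℚ v := by
  change t ∈ LinearMap.range (ExteriorAlgebra.ι ℚ (M := M)) ^ 2 at ht
  rw [pow_two] at ht
  induction ht using Submodule.mul_induction_on' with
  | mem_mul_mem a ha b hb =>
    obtain ⟨a, rfl⟩ := ha
    obtain ⟨b, rfl⟩ := hb
    have h1 := eq_neg_of_add_eq_zero_left (ExteriorAlgebra.ι_add_mul_swap (R := ℚ) v a)
    have h2 := eq_neg_of_add_eq_zero_left (ExteriorAlgebra.ι_add_mul_swap (R := ℚ) v b)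
    rw [← mul_assoc, h1, neg_mul, mul_assoc, h2, mul_neg, neg_neg, mul_assoc]
  | add x _ y _ hx hy => rw [mul_add, add_mul, hx, hy]

variable {T : Submodule ℚ (ExteriorAlgebra ℚ M)}

/-- Generators of degree two commute with vectors, so a left factor can be moved behind them. -/
theorem mul_mem_mul_top (hT : T ≤ ⋀[ℚ]^2 M) (a : ExteriorAlgebra ℚ M) {x : ExteriorAlgebra ℚ M}
    (hx : x ∈ T * ⊤) : a * x ∈ T * ⊤ := by
  induction a using ExteriorAlgebra.induction generalizing x with
  | algebraMap r =>
    rw [← Algebra.smul_def]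
    exact Submodule.smul_mem _ _ hx
  | ι v =>
    induction hx using Submodule.mul_induction_on' with
    | mem_mul_mem t ht b _ =>
      rw [← mul_assoc, commute_ι_of_mem_exteriorPower_two (hT ht), mul_assoc]
      exact Submodule.mul_mem_mul ht Submodule.mem_top
    | add x _ y _ hx hy => rw [mul_add]; exact add_mem hx hy
  | mul a b ha hb => rw [mul_assoc]; exact ha (hb hx)
  | add a b ha hb => rw [add_mul]; exact add_mem (ha hx) (hb hx)

/-- A two-sided ideal generated by elements of degree two is generated by them as a right ideal. -/
theorem mem_mul_top_of_mem_span (hT : T ≤ ⋀[ℚ]^2 M) {x : ExteriorAlgebra ℚ M}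
    (hx : x ∈ TwoSidedIdeal.span (T : Set (ExteriorAlgebra ℚ M))) : x ∈ T * ⊤ := by
  induction hx using TwoSidedIdeal.span_induction with
  | mem s hs => exact mul_one s ▸ Submodule.mul_mem_mul hs Submodule.mem_top
  | zero => exact zero_mem _
  | add a b _ _ ha hb => exact add_mem ha hb
  | neg a _ ha => exact neg_mem ha
  | left_absorb b a _ h => exact mul_mem_mul_top hT b h
  | right_absorb b a _ h =>
    have := Submodule.mul_mem_mul h (Submodule.mem_top (x := b))
    exact (mul_le_mul' le_rfl le_top : T * (⊤ * ⊤) ≤ T * ⊤) (by rwa [← mul_assoc])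

instance : GradedAlgebra (exteriorDegree M) := ExteriorAlgebra.gradedAlgebra ℚ M

/-- For `t` homogeneous of degree two, the component of `t * b` in degree `n + 2` is `t` times that
of `b` in degree `n`. -/
theorem decompose_mem_of_mem_mul_top (hT : T ≤ ⋀[ℚ]^2 M) {x : ExteriorAlgebra ℚ M}
    (hx : x ∈ T * ⊤) (n : ℕ) :
    (DirectSum.decompose (exteriorDegree M) x (n + 2) : ExteriorAlgebra ℚ M) ∈
      T * ⋀[ℚ]^n M := by
  induction hx using Submodule.mul_induction_on' with
  | mem_mul_mem t ht b _ =>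
    rw [DirectSum.coe_decompose_mul_of_left_mem_of_le (exteriorDegree M) (hT ht) (Nat.le_add_left 2 n),
      Nat.add_sub_cancel]
    exact Submodule.mul_mem_mul ht (SetLike.coe_mem _)
  | add x _ y _ hx hy =>
    rw [DirectSum.decompose_add, DirectSum.add_apply, Submodule.coe_add]
    exact add_mem hx hy

theorem decompose_eq_zero_of_mem_mul_top (hT : T ≤ ⋀[ℚ]^2 M) {x : ExteriorAlgebra ℚ M}
    (hx : x ∈ T * ⊤) {n : ℕ} (hn : ¬ 2 ≤ n) :
    (DirectSum.decompose (exteriorDegree M) x n : ExteriorAlgebra ℚ M) = 0 := by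
  induction hx using Submodule.mul_induction_on' with
  | mem_mul_mem t ht b _ => exact DirectSum.coe_decompose_mul_of_left_mem_of_not_le (exteriorDegree M) (hT ht) hn
  | add x _ y _ hx hy =>
    rw [DirectSum.decompose_add, DirectSum.add_apply, Submodule.coe_add, hx, hy, add_zero]

/-- The homogeneous elements of a two-sided ideal generated in degree two. -/
theorem mem_mul_exteriorPower_of_mem_span (hT : T ≤ ⋀[ℚ]^2 M) {x : ExteriorAlgebra ℚ M}
    (hx : x ∈ TwoSidedIdeal.span (T : Set (ExteriorAlgebra ℚ M))) {n : ℕ}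
    (hn : x ∈ ⋀[ℚ]^(n + 2) M) : x ∈ T * ⋀[ℚ]^n M := by
  have := decompose_mem_of_mem_mul_top hT (mem_mul_top_of_mem_span hT hx) n
  rwa [DirectSum.decompose_of_mem_same (exteriorDegree M) hn] at this

theorem eq_zero_of_mem_span (hT : T ≤ ⋀[ℚ]^2 M) {x : ExteriorAlgebra ℚ M}
    (hx : x ∈ TwoSidedIdeal.span (T : Set (ExteriorAlgebra ℚ M))) {n : ℕ} (hn : ¬ 2 ≤ n)
    (hxn : x ∈ ⋀[ℚ]^n M) : x = 0 := by
  have := decompose_eq_zero_of_mem_mul_top hT (mem_mul_top_of_mem_span hT hx) hn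
  rwa [DirectSum.decompose_of_mem_same (exteriorDegree M) hxn] at this

variable {N : Type*} [AddCommGroup N] [Module ℚ N]

theorem map_exteriorPower (φ : M →ₗ[ℚ] N) (hφ : Function.Surjective φ) (n : ℕ) :
    (⋀[ℚ]^n M).map (ExteriorAlgebra.map φ).toLinearMap = ⋀[ℚ]^n N := by
  change ((LinearMap.range (ExteriorAlgebra.ι ℚ (M := M))) ^ n).map _ = _
  rw [Submodule.map_pow, ← LinearMap.range_comp]
  congr 1
  rw [show (ExteriorAlgebra.map φ).toLinearMap ∘ₗ ExteriorAlgebra.ι ℚ =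
    ExteriorAlgebra.ι ℚ ∘ₗ φ from LinearMap.ext fun v => ExteriorAlgebra.map_apply_ι φ v,
    LinearMap.range_comp, LinearMap.range_eq_top.2 hφ, Submodule.map_top]

/-- The kernel of the map of exterior algebras induced by a surjection. -/
theorem mem_mul_of_map_eq_zero (φ : M →ₗ[ℚ] N) (hφ : Function.Surjective φ) {n : ℕ}
    {x : ExteriorAlgebra ℚ M} (hx : x ∈ ⋀[ℚ]^(n + 1) M) (h0 : ExteriorAlgebra.map φ x = 0) :
    x ∈ (LinearMap.ker φ).map (ExteriorAlgebra.ι ℚ) * ⋀[ℚ]^n M := by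
  -- With a linear section `s`, replacing the factors `v` of a product by `s (φ v)` one at a time
  -- changes `x` by elements of `P * Λ^n`. The final product vanishes, because its formation factors
  -- through `ExteriorAlgebra.map φ x = 0`.
  obtain ⟨s, hs⟩ := φ.exists_rightInverse_of_surjective (LinearMap.range_eq_top.2 hφ)
  have hs' : ∀ w, φ (s w) = w := fun w => LinearMap.congr_fun hs w
  set P := (LinearMap.ker φ).map (ExteriorAlgebra.ι ℚ) with hP
  have key : ∀ n, ∀ x ∈ ⋀[ℚ]^(n + 1) M,
      x - ExteriorAlgebra.map (s ∘ₗ φ) x ∈ P * ⋀[ℚ]^n M := by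
    have hker : ∀ v : M, ExteriorAlgebra.ι ℚ (v - s (φ v)) ∈ P := fun v =>
      Submodule.mem_map_of_mem (LinearMap.mem_ker.2 (by rw [map_sub, hs', sub_self]))
    have hmap : ∀ n, ∀ y ∈ ⋀[ℚ]^n M, ExteriorAlgebra.map (s ∘ₗ φ) y ∈ ⋀[ℚ]^n M := by
      intro n y hy
      have h1 := Submodule.mem_map_of_mem (f := (ExteriorAlgebra.map (s ∘ₗ φ)).toLinearMap) hy
      change _ ∈ ((LinearMap.range (ExteriorAlgebra.ι ℚ (M := M))) ^ n).map _ at h1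
      rw [Submodule.map_pow, ← LinearMap.range_comp] at h1
      refine pow_le_pow_left' (a := LinearMap.range _) ?_ n h1
      rintro _ ⟨v, rfl⟩
      exact ⟨s (φ v), (ExteriorAlgebra.map_apply_ι (s ∘ₗ φ) v).symm⟩
    have hsplit : ∀ v (y : ExteriorAlgebra ℚ M), ExteriorAlgebra.ι ℚ v * y -
        ExteriorAlgebra.map (s ∘ₗ φ) (ExteriorAlgebra.ι ℚ v * y) =
        ExteriorAlgebra.ι ℚ v * (y - ExteriorAlgebra.map (s ∘ₗ φ) y) +
          ExteriorAlgebra.ι ℚ (v - s (φ v)) * ExteriorAlgebra.map (s ∘ₗ φ) y := by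
      intro v y
      rw [map_mul, ExteriorAlgebra.map_apply_ι, map_sub, LinearMap.comp_apply]
      noncomm_ring
    have hleft : ∀ n v, ∀ z ∈ P * ⋀[ℚ]^n M, ExteriorAlgebra.ι ℚ v * z ∈ P * ⋀[ℚ]^(n + 1) M := by
      intro n v z hz
      induction hz using Submodule.mul_induction_on' with
      | mem_mul_mem p hp y hy =>
        obtain ⟨w, hw, rfl⟩ := hp
        rw [← mul_assoc, eq_neg_of_add_eq_zero_left (ExteriorAlgebra.ι_add_mul_swap (R := ℚ) v w),
          neg_mul, mul_assoc]
        refine neg_mem (Submodule.mul_mem_mul (Submodule.mem_map_of_mem hw) ?_)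
        change _ ∈ (LinearMap.range (ExteriorAlgebra.ι ℚ (M := M))) ^ (n + 1)
        rw [pow_succ']
        exact Submodule.mul_mem_mul (LinearMap.mem_range_self _ v) hy
      | add x _ y _ hx hy => rw [mul_add]; exact add_mem hx hy
    intro n
    induction n with
    | zero =>
      intro x hx
      change x ∈ LinearMap.range (ExteriorAlgebra.ι ℚ (M := M)) ^ (0 + 1) at hx
      rw [zero_add, pow_one] at hx
      obtain ⟨v, rfl⟩ := hx
      have h1 := Submodule.mul_mem_mul (hker v) (Submodule.one_le.1 (pow_zero
        (LinearMap.range (ExteriorAlgebra.ι ℚ (M := M)))).ge)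
      rw [mul_one] at h1
      rwa [ExteriorAlgebra.map_apply_ι, ← map_sub]
    | succ n ih =>
      intro x hx
      change x ∈ (LinearMap.range (ExteriorAlgebra.ι ℚ (M := M))) ^ (n + 1 + 1) at hx
      rw [pow_succ'] at hx
      induction hx using Submodule.mul_induction_on' with
      | mem_mul_mem p hp y hy =>
        obtain ⟨v, rfl⟩ := hp
        rw [hsplit]
        exact add_mem (hleft n v _ (ih y hy)) (Submodule.mul_mem_mul (hker v) (hmap _ y hy))
      | add x _ y _ hx hy =>
        rw [map_add, add_sub_add_comm]
        exact add_mem hx hy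
  have h1 := key n x hx
  rwa [← ExteriorAlgebra.map_comp_map, AlgHom.comp_apply, h0, map_zero, sub_zero] at h1

end ExteriorIdeals

/-! ### Equivariance and spans of the relation and loop families -/

section Families

variable {g : ℕ}

theorem quotientMap_surjective (g : ℕ) : Function.Surjective
    (LieSubmodule.Quotient.mk' (wedgeOmega g) : ⋀[ℚ]^3 (H g) →ₗ[ℚ] U g) :=
  LieSubmodule.Quotient.surjective_mk' (wedgeOmega g)

theorem map_projU_exteriorPower (g n : ℕ) :
    (⋀[ℚ]^n (⋀[ℚ]^3 (H g))).map (projU g).toLinearMap = ⋀[ℚ]^n (U g) :=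
  map_exteriorPower _ (quotientMap_surjective g) n

/-- The element `h ∧ ω` as a linear function of `h`. -/
def omegaMap (g : ℕ) : H g →ₗ[ℚ] ⋀[ℚ]^3 (H g) where
  toFun h := ∑ i, wedge₃ h (xVec i) (yVec i)
  map_add' h h' := by simp only [wedge₃_add₁, Finset.sum_add_distrib]
  map_smul' r h := by simp only [wedge₃_smul₁, Finset.smul_sum, RingHom.id_apply]

theorem omegaMap_apply (h : H g) : omegaMap g h = ∑ i, wedge₃ h (xVec i) (yVec i) := rfl

theorem range_omegaMap (g : ℕ) :
    LinearMap.range (omegaMap g) = (wedgeOmega g : Submodule ℚ (⋀[ℚ]^3 (H g))) := by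
  ext v
  constructor
  · rintro ⟨h, rfl⟩
    exact ⟨h, rfl⟩
  · rintro ⟨h, rfl⟩
    exact ⟨h, rfl⟩

/-- The form `ω` is invariant: `sum_lie_symplectic` for `(v, w) ↦ h ∧ v ∧ w` gives twice the terms
in which `X` acts on `ω`. -/
theorem lie_omegaMap (X : sp g) (h : H g) : ⁅X, omegaMap g h⁆ = omegaMap g ⁅X, h⁆ := by
  let B : H g →ₗ[ℚ] H g →ₗ[ℚ] ⋀[ℚ]^3 (H g) := LinearMap.mk₂ ℚ (fun v w => wedge₃ h v w)
    (fun v v' w => wedge₃_add₂ h v v' w) (fun r v w => wedge₃_smul₂ r h v w)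
    (fun v w w' => wedge₃_add₃ h v w w') (fun r v w => wedge₃_smul₃ r h v w)
  have key := sum_lie_symplectic B X
  have h2 : (2 : ℚ) • ∑ i : Fin g, (wedge₃ h ⁅X, xVec i⁆ (yVec i) +
      wedge₃ h (xVec i) ⁅X, yVec i⁆) = 0 := by
    rw [← key, Finset.smul_sum]
    refine Finset.sum_congr rfl fun i _ => ?_
    simp only [B, LinearMap.mk₂_apply]
    rw [wedge₃_swap₂₃ h (xVec i) ⁅X, yVec i⁆, wedge₃_swap₂₃ h ⁅X, xVec i⁆ (yVec i), two_smul]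
    abel
  have h3 := (smul_eq_zero.1 h2).resolve_left two_ne_zero
  rw [omegaMap_apply, omegaMap_apply, lie_sum]
  simp only [lie_wedge₃, add_assoc]
  rw [Finset.sum_add_distrib, h3, add_zero]

theorem isEquivariant_relationFamily (g n : ℕ) (a b c : ℚ) :
    IsEquivariant (relationFamily g n a b c) := by
  refine IsEquivariant.mul (f := fun l : Fin 4 → Fin g ⊕ Fin g =>
    (a • fI g + b • fH g + c • fX g) fun j => basisVec (l j))
    (isEquivariant_of_multilinear _ fun X t => ?_) (isEquivariant_vertexWedge n)
  simp only [add_apply, smul_apply, fI_apply, fH_apply, fX_apply, lie_add, lie_smul, lie_edgeSum,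
    Fin.sum_univ_four]
  simp [smul_add]
  abel

theorem isEquivariant_loopFamily (g n : ℕ) : IsEquivariant (loopFamily g n) := by
  refine IsEquivariant.mul (f := fun l : Unit → Fin g ⊕ Fin g =>
    ExteriorAlgebra.ι ℚ (omegaMap g (basisVec (l ()))))
    (fun X l => ?_) (isEquivariant_vertexWedge n)
  rw [Fintype.sum_unique (ι := Unit), lie_ι, lie_omegaMap, sum_smul_basisVec, map_sum, map_sum]
  refine Finset.sum_congr rfl fun p _ => ?_
  rw [map_smul, map_smul]
  simp

theorem span_range_tprod_basisVec (g : ℕ) : Submodule.span ℚ (Set.range fun l : Fin 4 →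
    Fin g ⊕ Fin g => PiTensorProduct.tprod ℚ fun j => (basisVec (l j) : H g)) = ⊤ := by
  have h := (Basis.piTensorProduct fun _ : Fin 4 => Pi.basisFun ℚ (Fin g ⊕ Fin g)).span_eq
  rw [← h]
  congr 2
  funext l
  rw [Basis.piTensorProduct_apply]
  congr 1
  funext j
  simp [basisVec]

theorem range_fABC (g : ℕ) (a b c : ℚ) : LinearMap.range (fABC g a b c) =
    Submodule.span ℚ (Set.range fun l : Fin 4 → Fin g ⊕ Fin g =>
      (a • fI g + b • fH g + c • fX g) fun j => basisVec (l j)) := by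
  rw [← Submodule.map_top, ← span_range_tprod_basisVec, Submodule.map_span, ← Set.range_comp]
  congr 2
  funext l
  exact PiTensorProduct.lift.tprod _

theorem span_range_mul {A F F' : Type*} [Ring A] [Algebra ℚ A] (f : (F → Fin g ⊕ Fin g) → A)
    (f' : (F' → Fin g ⊕ Fin g) → A) :
    Submodule.span ℚ (Set.range fun l : F ⊕ F' → Fin g ⊕ Fin g =>
      f (l ∘ Sum.inl) * f' (l ∘ Sum.inr)) =
      Submodule.span ℚ (Set.range f) * Submodule.span ℚ (Set.range f') := by
  rw [Submodule.span_mul_span]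
  congr 1
  ext z
  constructor
  · rintro ⟨l, rfl⟩
    exact Set.mul_mem_mul ⟨_, rfl⟩ ⟨_, rfl⟩
  · rintro ⟨_, ⟨l, rfl⟩, _, ⟨l', rfl⟩, rfl⟩
    exact ⟨Sum.elim l l', rfl⟩

/-- The degree `n + 2` part of `(Im f)` is thus the image of a tensor space, so that its invariants
can be lifted. -/
theorem span_range_relationFamily (g n : ℕ) (a b c : ℚ) :
    Submodule.span ℚ (Set.range (relationFamily g n a b c)) =
      LinearMap.range (fABC g a b c) * ⋀[ℚ]^n (⋀[ℚ]^3 (H g)) := by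
  rw [range_fABC, ← span_range_vertexWedge]
  exact span_range_mul (fun l : Fin 4 → Fin g ⊕ Fin g =>
    (a • fI g + b • fH g + c • fX g) fun j => basisVec (l j)) vertexWedge

theorem span_range_loopFamily (g n : ℕ) :
    Submodule.span ℚ (Set.range (loopFamily g n)) =
      (wedgeOmega g : Submodule ℚ (⋀[ℚ]^3 (H g))).map (ExteriorAlgebra.ι ℚ) *
        ⋀[ℚ]^n (⋀[ℚ]^3 (H g)) := by
  have h1 : (wedgeOmega g : Submodule ℚ (⋀[ℚ]^3 (H g))).map (ExteriorAlgebra.ι ℚ) =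
      Submodule.span ℚ (Set.range fun l : Unit → Fin g ⊕ Fin g =>
        ExteriorAlgebra.ι ℚ (omegaMap g (basisVec (l ())))) := by
    rw [← range_omegaMap, ← Submodule.map_top, ← span_range_basisVec, Submodule.map_span,
      Submodule.map_span, ← Set.range_comp, ← Set.range_comp]
    congr 1
    ext z
    constructor
    · rintro ⟨p, rfl⟩
      exact ⟨fun _ => p, rfl⟩
    · rintro ⟨l, rfl⟩
      exact ⟨l (), rfl⟩
  rw [h1, ← span_range_vertexWedge]
  exact span_range_mul (fun l : Unit → Fin g ⊕ Fin g =>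
    ExteriorAlgebra.ι ℚ (omegaMap g (basisVec (l ())))) vertexWedge

theorem range_fABC_le (g : ℕ) (a b c : ℚ) :
    LinearMap.range (fABC g a b c) ≤ ⋀[ℚ]^2 (⋀[ℚ]^3 (H g)) := by
  have hE : ∀ p q r s : H g, edgeSum p q r s ∈ ⋀[ℚ]^2 (⋀[ℚ]^3 (H g)) := by
    intro p q r s
    have hι : ∀ v w : ⋀[ℚ]^3 (H g), ExteriorAlgebra.ι ℚ v * ExteriorAlgebra.ι ℚ w ∈
        ⋀[ℚ]^2 (⋀[ℚ]^3 (H g)) := fun v w => by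
      change _ ∈ LinearMap.range (ExteriorAlgebra.ι ℚ (M := ⋀[ℚ]^3 (H g))) ^ 2
      rw [pow_two]
      exact Submodule.mul_mem_mul (LinearMap.mem_range_self _ _) (LinearMap.mem_range_self _ _)
    exact Submodule.sum_mem _ fun i _ => sub_mem (hι _ _) (hι _ _)
  rw [range_fABC, Submodule.span_le]
  rintro _ ⟨l, rfl⟩
  exact add_mem (add_mem (Submodule.smul_mem _ _ (hE _ _ _ _))
    (Submodule.smul_mem _ _ (hE _ _ _ _))) (Submodule.smul_mem _ _ (hE _ _ _ _))

theorem range_fABCbar (g : ℕ) (a b c : ℚ) : LinearMap.range (fABCbar g a b c) =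
    (LinearMap.range (fABC g a b c)).map (projU g).toLinearMap := by
  rw [fABCbar, LinearMap.range_comp]

theorem range_fABCbar_le (g : ℕ) (a b c : ℚ) :
    LinearMap.range (fABCbar g a b c) ≤ ⋀[ℚ]^2 (U g) := by
  rw [range_fABCbar, ← map_projU_exteriorPower]
  exact Submodule.map_mono (range_fABC_le g a b c)

end Families

open TrivalentSymplectic.TrivalentGraph

/-! ### From invariant relations to stable isomorphisms -/

section StableIso

variable {g : ℕ} {A : Type*} [Ring A] [Algebra ℚ A] [LieRingModule (sp g) A]
  [LieModule ℚ (sp g) A]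

/-- Invariants in the image of an equivariant family of vectors indexed by words of even length are
realized by graphs, when this is true of matchings. -/
theorem exists_graphHom_eq (π : LambdaH g →ₐ[ℚ] A) (hπ : ∀ (X : sp g) v, ⁅X, π v⁆ = π ⁅X, v⁆)
    {ι : Type*} [Fintype ι] [DecidableEq ι] {f : (ι → Fin g ⊕ Fin g) → LambdaH g}
    (hf : IsEquivariant f) {k : ℕ} (hk : k ≤ g) (hι : Fintype.card ι = k * 2)
    (D : Submodule ℚ GraphAlgebra)
    (hD : ∀ e : Fin k × Fin 2 ≃ ι,
      ∃ r ∈ D, (graphHom g r : LambdaH g) = realize f (matchingTensor e))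
    {v : A} (hv : v ∈ (Submodule.span ℚ (Set.range f)).map π.toLinearMap)
    (hinv : ∀ X : sp g, ⁅X, v⁆ = 0) : ∃ r ∈ D, π (graphHom g r) = v := by
  rw [Submodule.map_span, ← Set.range_comp] at hv
  -- The invariant is lifted to an invariant tensor, which is a combination of matchings; the rest
  -- is linear.
  obtain ⟨t, ht, rfl⟩ := (hf.comp_linear π.toLinearMap hπ).exists_isInvariant hv hinv
  have ht' := ht.mem_span_matchingTensor hk hι
  have hsum : ∀ t, realize (fun l => π.toLinearMap (f l)) t = π (realize f t) := fun t => by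
    rw [realize_apply, realize_apply, map_sum]
    exact Finset.sum_congr rfl fun l _ => (map_smul π _ _).symm
  rw [hsum]
  clear ht hv hinv
  suffices h : ∃ r ∈ D, (graphHom g r : LambdaH g) = realize f t by
    obtain ⟨r, hr, h⟩ := h
    exact ⟨r, hr, congrArg π h⟩
  induction ht' using Submodule.span_induction with
  | mem t ht =>
    obtain ⟨e, rfl⟩ := ht
    exact hD e
  | zero => exact ⟨0, zero_mem _, by simp⟩
  | add t t' _ _ h h' =>
    obtain ⟨r, hr, h⟩ := h
    obtain ⟨r', hr', h'⟩ := h'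
    exact ⟨r + r', add_mem hr hr', by rw [map_add, map_add, ← h, ← h']; rfl⟩
  | smul x t _ h =>
    obtain ⟨r, hr, h⟩ := h
    exact ⟨x • r, Submodule.smul_mem _ _ hr, by rw [map_smul, map_smul, ← h]; rfl⟩

/-- The invariants of odd degree vanish. -/
theorem eq_zero_of_odd_degree (π : LambdaH g →ₐ[ℚ] A)
    (hπ : ∀ (X : sp g) v, ⁅X, π v⁆ = π ⁅X, v⁆) {n : ℕ} (hn : Odd n) {v : A}
    (hv : v ∈ (⋀[ℚ]^n (⋀[ℚ]^3 (H g))).map π.toLinearMap) (hinv : ∀ X : sp g, ⁅X, v⁆ = 0) :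
    v = 0 := by
  rw [← span_range_vertexWedge, Submodule.map_span, ← Set.range_comp] at hv
  obtain ⟨t, ht, rfl⟩ :=
    ((isEquivariant_vertexWedge n).comp_linear π.toLinearMap hπ).exists_isInvariant hv hinv
  rw [ht.eq_zero_of_odd (by
    rw [Fintype.card_prod, Fintype.card_fin, Fintype.card_fin]
    exact hn.mul (by decide)), map_zero]

variable [ActsByDerivations ℚ (sp g) A] {C : Type*} [CommRing C] [Algebra ℚ C]

/-- A homomorphism from a quotient of the algebra of graphs to the invariants of a quotient of
`Λ Λ³H` is a stable isomorphism if invariant relations come from relations between graphs. -/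
theorem isStableIso_of_relations (π : LambdaH g →ₐ[ℚ] A)
    (hπ : ∀ (X : sp g) v, ⁅X, π v⁆ = π ⁅X, v⁆) (q : GraphAlgebra →ₐ[ℚ] C)
    (Ψ : C →ₐ[ℚ] invariants ℚ (sp g) A) (hΨ : ∀ z, (Ψ (q z) : A) = π (graphHom g z))
    (hker : ∀ m, 3 * m ≤ g → ∀ a ∈ ⋀[ℚ]^(2 * m) (⋀[ℚ]^3 (H g)), (∀ X : sp g, ⁅X, a⁆ = 0) →
      π a = 0 → ∃ r ∈ graphDegree m, q r = 0 ∧ (graphHom g r : LambdaH g) = a) :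
    IsStableIso g (fun m => (graphDegree m).map q.toLinearMap)
      (subalgebraDegree (fun n => (⋀[ℚ]^n (⋀[ℚ]^3 (H g))).map π.toLinearMap)
        (invariants ℚ (sp g) A)) Ψ := by
  have hdeg : ∀ m, ∀ z ∈ (graphDegree m).map q.toLinearMap, Ψ z ∈
      subalgebraDegree (fun n => (⋀[ℚ]^n (⋀[ℚ]^3 (H g))).map π.toLinearMap)
        (invariants ℚ (sp g) A) (2 * m) := by
    rintro m _ ⟨z, hz, rfl⟩
    exact ⟨graphHom g z, graphHom_mem hz, (hΨ z).symm⟩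
  refine ⟨hdeg, fun m hm => ⟨hdeg m, ?_, ?_⟩, fun n hn => ?_⟩
  · rintro _ ⟨z, hz, rfl⟩ _ ⟨z', hz', rfl⟩ h
    have h1 : π (graphHom g (z - z') : LambdaH g) = 0 := by
      rw [map_sub, Subalgebra.coe_sub, map_sub, ← hΨ, ← hΨ, sub_eq_zero]
      exact congrArg Subtype.val h
    -- The value of `z - z'` is an invariant killed by `π`, hence the value of some `r` killed by
    -- `q`. By `graphHom_injOn`, `r` equals `z - z'`.
    obtain ⟨r, hr, hqr, hr'⟩ := hker m hm _ (graphHom_mem (sub_mem hz hz'))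
      (graphHom g (z - z')).2 h1
    have h2 : r - (z - z') = 0 := graphHom_injOn hm (sub_mem hr (sub_mem hz hz')) (by
      rw [map_sub, sub_eq_zero]
      exact Subtype.ext hr')
    rw [sub_eq_zero] at h2
    rw [h2, map_sub, sub_eq_zero] at hqr
    exact hqr
  · rintro ⟨v, hv⟩ hv'
    have hv' : v ∈ (⋀[ℚ]^(2 * m) (⋀[ℚ]^3 (H g))).map π.toLinearMap := hv'
    rw [← span_range_vertexWedge] at hv'
    obtain ⟨r, hr, h⟩ := exists_graphHom_eq π hπ (isEquivariant_vertexWedge (2 * m)) hm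
      (by rw [Fintype.card_prod, Fintype.card_fin, Fintype.card_fin]; ring) (graphDegree m)
      (fun e => exists_graph_of_matching rfl (by ring) e) hv' hv
    exact ⟨q r, ⟨r, hr, rfl⟩, Subtype.ext ((hΨ r).trans h)⟩
  · refine eq_bot_iff.2 ?_
    rintro ⟨v, hv⟩ hv'
    exact (Submodule.mem_bot _).2 (Subtype.ext (eq_zero_of_odd_degree π hπ hn hv' hv))

end StableIso

/-! ### Invariant relations come from relations between graphs -/

section Relations

variable {g : ℕ}

theorem mem_idealF_of_mem_span {n : ℕ} (a b c : ℚ) {z : LambdaH g}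
    (hz : z ∈ Submodule.span ℚ (Set.range (relationFamily g n a b c))) :
    z ∈ idealF g a b c := by
  rw [span_range_relationFamily] at hz
  refine (Submodule.mul_le.2 fun t ht y _ => ?_ : _ ≤ (idealF g a b c).restrictScalars ℚ) hz
  exact TwoSidedIdeal.mul_mem_right _ _ _ (TwoSidedIdeal.subset_span ht)

theorem projU_eq_zero_of_mem_span {n : ℕ} {z : LambdaH g}
    (hz : z ∈ Submodule.span ℚ (Set.range (loopFamily g n))) : projU g z = 0 := by
  rw [span_range_loopFamily] at hz
  refine (Submodule.mul_le.2 fun t ht y _ => ?_ : _ ≤ LinearMap.ker (projU g).toLinearMap) hz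
  obtain ⟨w, hw, rfl⟩ := ht
  rw [LinearMap.mem_ker, AlgHom.toLinearMap_apply, map_mul, projU, ExteriorAlgebra.map_apply_ι]
  have : (LieSubmodule.Quotient.mk' (wedgeOmega g) : ⋀[ℚ]^3 (H g) →ₗ[ℚ] U g) w = 0 :=
    (LieSubmodule.Quotient.mk_eq_zero _).2 hw
  rw [this, map_zero, zero_mul]

theorem projU_mem_idealFbar {a b c : ℚ} {z : LambdaH g} (hz : z ∈ idealF g a b c) :
    projU g z ∈ idealFbar g a b c := by
  rw [idealF, TwoSidedIdeal.mem_asIdeal] at hz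
  rw [idealFbar, TwoSidedIdeal.mem_asIdeal]
  induction hz using TwoSidedIdeal.span_induction with
  | mem s hs =>
    obtain ⟨w, rfl⟩ := hs
    exact TwoSidedIdeal.subset_span ⟨w, rfl⟩
  | zero => rw [map_zero]; exact zero_mem _
  | add a b _ _ ha hb => rw [map_add]; exact add_mem ha hb
  | neg a _ ha => rw [map_neg]; exact neg_mem ha
  | left_absorb b a _ h => rw [map_mul]; exact TwoSidedIdeal.mul_mem_left _ _ _ h
  | right_absorb b a _ h => rw [map_mul]; exact TwoSidedIdeal.mul_mem_right _ _ _ h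

/-- The homomorphism `graphHom` maps the relations between graphs to relations. -/
theorem graphHom_mem_idealF {a b c : ℚ} {z : GraphAlgebra} (hz : z ∈ relationIdeal a b c) :
    (graphHom g z : LambdaH g) ∈ idealF g a b c := by
  induction hz using Submodule.span_induction with
  | mem z hz =>
    obtain ⟨Γ, E, rfl⟩ := hz
    obtain ⟨n, hn⟩ := exists_mem_span_relationFamily g E a b c
    simp only [map_smul, map_add, Subalgebra.coe_smul, Subalgebra.coe_add, graphHom_graph]
    exact mem_idealF_of_mem_span a b c hn
  | zero => rw [map_zero]; exact zero_mem _
  | add x y _ _ hx hy => rw [map_add]; exact add_mem hx hy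
  | smul r x _ hx => rw [smul_eq_mul, map_mul]; exact Ideal.mul_mem_left _ _ hx

theorem projU_graphHom_eq_zero {z : GraphAlgebra} (hz : z ∈ loopIdeal) :
    projU g (graphHom g z : LambdaH g) = 0 := by
  induction hz using Submodule.span_induction with
  | mem z hz =>
    obtain ⟨Γ, hΓ, rfl⟩ := hz
    obtain ⟨n, hn⟩ := exists_mem_span_loopFamily g hΓ
    rw [graphHom_graph]
    exact projU_eq_zero_of_mem_span hn
  | zero => rw [map_zero]; exact map_zero _
  | add x y _ _ hx hy => rw [map_add, Subalgebra.coe_add, map_add, hx, hy, add_zero]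
  | smul r x _ hx => rw [smul_eq_mul, map_mul, Subalgebra.coe_mul, map_mul, hx, mul_zero]

/-- Invariants in the kernel of `Λ Λ³H → Λ U` come from graphs with loops. -/
theorem exists_loop_of_projU_eq_zero {m : ℕ} (hm : 3 * m ≤ g) {v : LambdaH g}
    (hv : v ∈ ⋀[ℚ]^(2 * m) (⋀[ℚ]^3 (H g))) (hinv : ∀ X : sp g, ⁅X, v⁆ = 0)
    (h0 : projU g v = 0) :
    ∃ r ∈ graphDegree m, r ∈ loopIdeal ∧ (graphHom g r : LambdaH g) = v := by
  rcases m with _ | m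
  -- In degree zero both exterior algebras consist of scalars, so the kernel is trivial.
  · refine ⟨0, zero_mem _, zero_mem _, ?_⟩
    obtain ⟨x, rfl⟩ := Submodule.mem_one.1 hv
    rw [AlgHom.commutes, map_eq_zero_iff _ (algebraMap ℚ (LambdaU g)).injective] at h0
    rw [h0, map_zero, map_zero, Subalgebra.coe_zero]
  · have hspan : v ∈ Submodule.span ℚ (Set.range (loopFamily g (2 * m + 1))) := by
      rw [span_range_loopFamily]
      have := mem_mul_of_map_eq_zero _ (quotientMap_surjective g) (n := 2 * m + 1) hv h0
      have hker : LinearMap.ker (LieSubmodule.Quotient.mk' (wedgeOmega g) :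
          ⋀[ℚ]^3 (H g) →ₗ[ℚ] U g) = (wedgeOmega g : Submodule ℚ (⋀[ℚ]^3 (H g))) :=
        Submodule.ext fun w => LieSubmodule.Quotient.mk_eq_zero _
      rwa [hker] at this
    -- A graph of degree `m + 1` has `3m + 3` edges; `3m + 2` remain besides the loop.
    obtain ⟨r, hr, h⟩ := exists_graphHom_eq (AlgHom.id ℚ (LambdaH g)) (fun _ _ => rfl)
      (isEquivariant_loopFamily g (2 * m + 1)) (k := 3 * m + 2) (by omega)
      (by simp; ring) (graphDegree (m + 1) ⊓ loopIdeal.restrictScalars ℚ)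
      (fun e => exists_graph_of_loop (by ring) (by ring) e)
      (by rwa [AlgHom.toLinearMap_id, Submodule.map_id]) hinv
    exact ⟨r, hr.1, hr.2, h⟩

theorem exists_relation_of_mem {A : Type*} [Ring A] [Algebra ℚ A] [LieRingModule (sp g) A]
    [LieModule ℚ (sp g) A] (π : LambdaH g →ₐ[ℚ] A) (hπ : ∀ (X : sp g) v, ⁅X, π v⁆ = π ⁅X, v⁆)
    {m : ℕ} (hm : 3 * (m + 1) ≤ g) (a b c : ℚ) {v : A}
    (hv : v ∈ (LinearMap.range (fABC g a b c) * ⋀[ℚ]^(2 * m) (⋀[ℚ]^3 (H g))).map π.toLinearMap)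
    (hinv : ∀ X : sp g, ⁅X, v⁆ = 0) :
    ∃ r ∈ graphDegree (m + 1), r ∈ relationIdeal a b c ∧ π (graphHom g r) = v := by
  rw [← span_range_relationFamily] at hv
  -- Four legs and `3 * 2m` flags at the other vertices form `3m + 2` edges; the middle edge is the
  -- remaining one.
  obtain ⟨r, hr, h⟩ := exists_graphHom_eq π hπ
    (isEquivariant_relationFamily g (2 * m) a b c) (k := 3 * m + 2) (by omega)
    (by simp; ring) (graphDegree (m + 1) ⊓ (relationIdeal a b c).restrictScalars ℚ)
    (fun e => exists_graph_of_relation (by ring) (by ring) a b c e) hv hinv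
  exact ⟨r, hr.1, hr.2, h⟩

/-- Invariants in the ideal `(Im f_{a,b,c})` come from relations between graphs. -/
theorem exists_relation_of_mem_idealF {m : ℕ} (hm : 3 * m ≤ g) {a b c : ℚ} {v : LambdaH g}
    (hv : v ∈ ⋀[ℚ]^(2 * m) (⋀[ℚ]^3 (H g))) (hinv : ∀ X : sp g, ⁅X, v⁆ = 0)
    (h0 : v ∈ idealF g a b c) :
    ∃ r ∈ graphDegree m, r ∈ relationIdeal a b c ∧ (graphHom g r : LambdaH g) = v := by
  rw [idealF, TwoSidedIdeal.mem_asIdeal] at h0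
  rcases m with _ | m
  · refine ⟨0, zero_mem _, zero_mem _, ?_⟩
    rw [eq_zero_of_mem_span (range_fABC_le g a b c) h0 (by norm_num) hv, map_zero,
      Subalgebra.coe_zero]
  · have h1 := mem_mul_exteriorPower_of_mem_span (range_fABC_le g a b c) h0 (n := 2 * m) hv
    exact exists_relation_of_mem (AlgHom.id ℚ (LambdaH g)) (fun _ _ => rfl) hm a b c
      (by rwa [AlgHom.toLinearMap_id, Submodule.map_id]) hinv

theorem exists_relation_of_mem_idealFbar {m : ℕ} (hm : 3 * m ≤ g) {a b c : ℚ} {v : LambdaH g}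
    (hv : v ∈ ⋀[ℚ]^(2 * m) (⋀[ℚ]^3 (H g))) (hinv : ∀ X : sp g, ⁅X, v⁆ = 0)
    (h0 : projU g v ∈ idealFbar g a b c) :
    ∃ r ∈ graphDegree m, r ∈ relationIdeal a b c ⊔ loopIdeal ∧
      (graphHom g r : LambdaH g) = v := by
  -- First the image in `Λ U` is matched by graph relations, applying the lifting of invariants to
  -- the family projected to `Λ U`. What is left of `v` is an invariant killed by `projU`, so it
  -- comes from graphs with loops.
  have h1 : ∃ r ∈ graphDegree m, r ∈ relationIdeal a b c ∧
      projU g (graphHom g r) = projU g v := by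
    have hmem : projU g v ∈ ⋀[ℚ]^(2 * m) (U g) := by
      rw [← map_projU_exteriorPower]
      exact Submodule.mem_map_of_mem hv
    rw [idealFbar, TwoSidedIdeal.mem_asIdeal] at h0
    rcases m with _ | m
    · refine ⟨0, zero_mem _, zero_mem _, ?_⟩
      rw [eq_zero_of_mem_span (range_fABCbar_le g a b c) h0 (by norm_num) hmem, map_zero,
        Subalgebra.coe_zero, map_zero]
    · have h1 := mem_mul_exteriorPower_of_mem_span (range_fABCbar_le g a b c) h0 (n := 2 * m) hmem
      refine exists_relation_of_mem (projU g) lie_projU hm a b c ?_ fun X => ?_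
      · rwa [Submodule.map_mul, ← range_fABCbar, map_projU_exteriorPower]
      · rw [lie_projU, hinv, map_zero]
  obtain ⟨r, hr, hr', h⟩ := h1
  obtain ⟨s, hs, hs', h'⟩ := exists_loop_of_projU_eq_zero hm (sub_mem hv (graphHom_mem hr))
    (fun X => by rw [lie_sub, hinv, zero_sub, neg_eq_zero]; exact (graphHom g r).2 X)
    (by rw [map_sub, h, sub_self])
  refine ⟨r + s, add_mem hr hs, add_mem (Ideal.mem_sup_left hr') (Ideal.mem_sup_right hs'), ?_⟩
  rw [map_add, Subalgebra.coe_add, h', add_sub_cancel]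

end Relations

/-! ### Passage to quotients of the graph algebra -/

section Quotients

variable {g : ℕ} {A : Type*} [Ring A] [Algebra ℚ A] [LieRingModule (sp g) A]
  [LieModule ℚ (sp g) A] [ActsByDerivations ℚ (sp g) A]

/-- The stable isomorphism induced on the quotient by an ideal of relations. -/
theorem exists_isStableIso_quotient (π : LambdaH g →ₐ[ℚ] A)
    (hπ : ∀ (X : sp g) v, ⁅X, π v⁆ = π ⁅X, v⁆) (J : Ideal GraphAlgebra)
    (hJ : ∀ z ∈ J, π (graphHom g z) = 0)
    (hker : ∀ m, 3 * m ≤ g → ∀ a ∈ ⋀[ℚ]^(2 * m) (⋀[ℚ]^3 (H g)), (∀ X : sp g, ⁅X, a⁆ = 0) →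
      π a = 0 → ∃ r ∈ graphDegree m, r ∈ J ∧ (graphHom g r : LambdaH g) = a) :
    ∃ Ψ : GraphAlgebra ⧸ J →ₐ[ℚ] invariants ℚ (sp g) A,
      (∀ z : GraphAlgebra, (Ψ (Ideal.Quotient.mk J z) : A) = π (graphHom g z)) ∧
      IsStableIso g (quotientDegree graphDegree J)
        (subalgebraDegree (fun n => (⋀[ℚ]^n (⋀[ℚ]^3 (H g))).map π.toLinearMap)
          (invariants ℚ (sp g) A)) Ψ := by
  have hinv : ∀ z, π (graphHom g z) ∈ invariants ℚ (sp g) A := fun z X => by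
    rw [hπ, (graphHom g z).2 X, map_zero]
  let Φ : GraphAlgebra →ₐ[ℚ] invariants ℚ (sp g) A :=
    ((π.comp (invariants ℚ (sp g) (LambdaH g)).val).comp (graphHom g)).codRestrict _ hinv
  let Ψ : GraphAlgebra ⧸ J →ₐ[ℚ] invariants ℚ (sp g) A :=
    Ideal.Quotient.liftₐ J Φ fun z hz => Subtype.ext (hJ z hz)
  have hΨ : ∀ z : GraphAlgebra, (Ψ (Ideal.Quotient.mkₐ ℚ J z) : A) = π (graphHom g z) :=
    fun z => rfl
  refine ⟨Ψ, hΨ, isStableIso_of_relations π hπ (Ideal.Quotient.mkₐ ℚ J) Ψ hΨ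
    fun m hm a ha hinv h0 => ?_⟩
  obtain ⟨r, hr, hrJ, h⟩ := hker m hm a ha hinv h0
  exact ⟨r, hr, Ideal.Quotient.eq_zero_iff_mem.2 hrJ, h⟩

end Quotients

end TrivalentSymplectic

end

open TrivalentSymplectic

theorem mainTheorem3 (g : ℕ) :
    ∃ Φ : GraphAlgebra →ₐ[ℚ] invariants ℚ (sp g) (LambdaH g),
      (∀ (Γ : TrivalentGraph) (τ : Γ.TotalOrdering), τ.IsAdmissible →
        (Φ (graph Γ) : LambdaH g) = τ.alpha g) ∧
      IsStableIso g graphDegree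
        (subalgebraDegree (exteriorDegree (⋀[ℚ]^3 (H g))) (invariants ℚ (sp g) (LambdaH g))) Φ ∧
      (∃ Φ' : GraphAlgebra ⧸ loopIdeal →ₐ[ℚ] invariants ℚ (sp g) (LambdaU g),
        (∀ z : GraphAlgebra,
          (Φ' (Ideal.Quotient.mk loopIdeal z) : LambdaU g) = projU g (Φ z)) ∧
        IsStableIso g (quotientDegree graphDegree loopIdeal)
          (subalgebraDegree (exteriorDegree (U g)) (invariants ℚ (sp g) (LambdaU g))) Φ') ∧
      ∀ a b c : ℚ,
        (∃ Ψ : GraphAlgebra ⧸ relationIdeal a b c →ₐ[ℚ]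
            invariants ℚ (sp g) (LambdaH g ⧸ idealF g a b c),
          (∀ z : GraphAlgebra,
            (Ψ (Ideal.Quotient.mk (relationIdeal a b c) z) : LambdaH g ⧸ idealF g a b c) =
              Ideal.Quotient.mk (idealF g a b c) (Φ z)) ∧
          IsStableIso g (quotientDegree graphDegree (relationIdeal a b c))
            (subalgebraDegree
              (quotientDegree (exteriorDegree (⋀[ℚ]^3 (H g))) (idealF g a b c))
              (invariants ℚ (sp g) (LambdaH g ⧸ idealF g a b c))) Ψ) ∧
        (∃ Ψ' : GraphAlgebra ⧸ (relationIdeal a b c ⊔ loopIdeal) →ₐ[ℚ]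
            invariants ℚ (sp g) (LambdaU g ⧸ idealFbar g a b c),
          (∀ z : GraphAlgebra,
            (Ψ' (Ideal.Quotient.mk (relationIdeal a b c ⊔ loopIdeal) z) :
                LambdaU g ⧸ idealFbar g a b c) =
              Ideal.Quotient.mk (idealFbar g a b c) (projU g (Φ z))) ∧
          IsStableIso g (quotientDegree graphDegree (relationIdeal a b c ⊔ loopIdeal))
            (subalgebraDegree
              (quotientDegree (exteriorDegree (U g)) (idealFbar g a b c))
              (invariants ℚ (sp g) (LambdaU g ⧸ idealFbar g a b c))) Ψ') := by
  -- The general lemmas grade the target by images of `Λ^n Λ³H`; on `Λ U` this is the usual grading.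
  have hU : (fun n => (⋀[ℚ]^n (⋀[ℚ]^3 (H g))).map (projU g).toLinearMap) =
      exteriorDegree (U g) := funext fun n => map_projU_exteriorPower g n
  refine ⟨graphHom g, fun Γ τ hτ => (graphHom_graph g Γ).trans <|
    TrivalentGraph.TotalOrdering.IsAdmissible.value_eq τ g hτ, ?_, ?_,
    fun a b c => ⟨?_, ?_⟩⟩
  -- With `π` the identity the only relation is `0`, realized by `r = 0`.
  · have h := isStableIso_of_relations (AlgHom.id ℚ (LambdaH g)) (fun _ _ => rfl)
      (AlgHom.id ℚ GraphAlgebra) (graphHom g) (fun _ => rfl) fun m hm a ha hinv h0 =>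
        ⟨0, zero_mem _, map_zero _, by rw [map_zero]; exact h0.symm⟩
    simp only [AlgHom.toLinearMap_id, Submodule.map_id] at h
    exact h
  · have h := exists_isStableIso_quotient (projU g) lie_projU loopIdeal
      (fun z hz => projU_graphHom_eq_zero hz)
      fun m hm a ha hinv h0 => exists_loop_of_projU_eq_zero hm ha hinv h0
    rw [hU] at h
    exact h
  · exact exists_isStableIso_quotient (Ideal.Quotient.mkₐ ℚ (idealF g a b c)) (fun _ _ => rfl)
      (relationIdeal a b c)
      (fun z hz => Ideal.Quotient.eq_zero_iff_mem.2 (graphHom_mem_idealF hz))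
      fun m hm v hv hinv h0 => exists_relation_of_mem_idealF hm hv hinv
        (Ideal.Quotient.eq_zero_iff_mem.1 h0)
  · have h := exists_isStableIso_quotient
      ((Ideal.Quotient.mkₐ ℚ (idealFbar g a b c)).comp (projU g))
      (fun X v => congrArg (Ideal.Quotient.mk (idealFbar g a b c)) (lie_projU X v))
      (relationIdeal a b c ⊔ loopIdeal)
      (fun z hz => by
        obtain ⟨x, hx, y, hy, rfl⟩ := Submodule.mem_sup.1 hz
        refine Ideal.Quotient.eq_zero_iff_mem.2 ?_
        change projU g (graphHom g (x + y) : LambdaH g) ∈ _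
        rw [map_add, Subalgebra.coe_add, map_add, projU_graphHom_eq_zero hy, add_zero]
        exact projU_mem_idealFbar (graphHom_mem_idealF hx))
      fun m hm v hv hinv h0 => exists_relation_of_mem_idealFbar hm hv hinv
        (Ideal.Quotient.eq_zero_iff_mem.1 h0)
    simp only [AlgHom.comp_toLinearMap, Submodule.map_comp, map_projU_exteriorPower] at h
    exact h
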